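/- **Setting.** Let $T\in(0,\infty)$, let $w_k$, $k\ge1$, be independent standard Wiener processes on a probability space, and let $\{m_i\}_{i\ge1}$ be an orthonormal basis of $L_2((0,T))$ with each $m_i$ bounded. Let $\mathcal J$ be the set of multi-indices $\alpha=(\alpha_i^k)_{i,k\ge1}$ of non-negative integers with $\sum_{i,k}\alpha_i^k<\infty$, $\alpha!=\prod_{i,k}\alpha_i^k!$, and let $\alpha^-(i,k)$ be $\alpha$ with $\alpha_i^k$ replaced by $\max(\alpha_i^k-1,0)$. Put $\xi_{ik}=\int_0^T m_i\,dw_k$ and $\xi_\alpha=\frac1{\sqrt{\alpha!}}\prod_{i,k}H_{\alpha_i^k}(\xi_{ik})$, with $H_n$ the (probabilists') Hermite polynomials. Let $\mathcal D(\mathbb W)$ be the space of finite linear combinations of the $\xi_\alpha$; a sequence converges there if all its terms are supported in one finite subset of $\mathcal J$ and the coefficients converge. Let $\mathcal D'(\mathbb W;X)$ be the space of continuous linear maps $\mathcal D(\mathbb W)\to X$, and write $u_\alpha=u(\xi_\alpha)$ for $u\in\mathcal D'(\mathbb W;X)$. Let $(V,H,V')$ be a normal triple of real Hilbert spaces: $V\hookrightarrow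 H\hookrightarrow V'$ densely and continuously, where $V'$ is the dual of $V$ relative to the inner product of $H$, with the dual norm, and $\langle\cdot,\cdot\rangle$ is the duality pairing of $V'$ and $V$. For $t\in[0,T]$ let $\mathcal A(t):V\to V'$ and $\mathcal M_k(t):V\to H$ be bounded linear operators, strongly measurable in $t$, with $\sup_{t\in[0,T]}\|\mathcal A(t)\|<\infty$. Assume that there are $\delta>0$, $C_1>0$ and $C_2\in\mathbb R$ such that for all $v\in V$, $t\in[0,T]$: (A1) $\langle\mathcal A(t)v,v\rangle+\delta\|v\|_V^2\le C_1\|v\|_H^2$; (A2) $2\langle\mathcal A(t)v,v\rangle+\sum_{k\ge1}\|\mathcal M_k(t)v\|_H^2\le C_2\|v\|_H^2$. Let $u_0\in\mathcal D'(\mathbb W;H)$, $f\in\mathcal D'(\mathbb W;L_2((0,T);V'))$ and $g_k\in\mathcal D'(\mathbb W;L_2((0,T);H))$, $k\ge1$, be arbitrary. A $w(V,V')$ Wiener Chaos solution of $$du=(\mathcal A u+f)\,dt+\sum_k(\mathcal M_ku+g_k)\,dw_k,\quad 0<t\le T,\qquad u|_{t=0}=u_0,$$ is an element $u\in\mathcal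 D'(\mathbb W;L_1((0,T);V))$ such that, for every $\alpha\in\mathcal J$, in $L_1((0,T);V')$, $$u_\alpha(t)=u_{0,\alpha}+\int_0^t(\mathcal A u_\alpha+f_\alpha)(s)\,ds+\sum_{i,k}\int_0^t\sqrt{\alpha_i^k}\,m_i(s)\,(\mathcal M_ku_{\alpha^-(i,k)}+g_{k,\alpha^-(i,k)})(s)\,ds.$$ **Theorem.** There is exactly one such solution $u$ with $u_\alpha\in L_2((0,T);V)$ for all $\alpha\in\mathcal J$. Each $u_\alpha$ has a version in $\mathbf C([0,T];H)$ and, for these versions and every $t\in[0,T]$, $$\sqrt{\sum_{\alpha\in\mathcal J}\frac{\|u_\alpha(t)\|_H^2}{\alpha!}}\le C\sum_{\alpha\in\mathcal J}\frac1{\sqrt{\alpha!}}\left(\|u_{0,\alpha}\|_H+\Big(\int_0^t\|f_\alpha(s)\|_{V'}^2ds\Big)^{1/2}+\Big(\sum_{k\ge1}\int_0^t\|g_{k,\alpha}(s)\|_H^2ds\Big)^{1/2}\right),$$ where $C>0$ depends only on $T,\delta,C_1,C_2$ (the right-hand side may be $+\infty$). The left-hand side is the norm of $u(t)$ in $(\mathcal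 S)_{-1,0}(H)$. -/

import Mathlib

open MeasureTheory ProbabilityTheory Set Filter Topology
open scoped NNReal ENNReal

namespace WienerChaos

noncomputable section

/-- Lebesgue measure on the time interval `(0, T)`. -/
abbrev timeMeasure (T : ℝ) : Measure ℝ := volume.restrict (Ioo 0 T)

/-- Finitely supported multi-indices `α = (α_i^k)`; the pair `(i, k)` consists of the time index
`i` and the space index `k` (both counted from `0`). -/
abbrev MultiIndex : Type := ℕ × ℕ →₀ ℕ

/-- `α! = ∏_{i,k} α_i^k!`. -/
def MultiIndex.fact (α : MultiIndex) : ℕ := ∏ p ∈ α.support, (α p).factorial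

/-- `α⁻(i,k)`: the entry `(i, k)` is replaced by `max (α_i^k - 1) 0`. -/
def MultiIndex.pred (α : MultiIndex) (p : ℕ × ℕ) : MultiIndex := α - Finsupp.single p 1

/-- Independent standard Wiener processes `w_k` on a probability space, together with an
orthonormal basis `m_i` of `L_2((0,T))` consisting of bounded functions. -/
structure WienerNoise (Ω : Type*) [MeasurableSpace Ω] (P : Measure Ω) (T : ℝ) where
  w : ℕ → ℝ≥0 → Ω → ℝ
  measurable_w : ∀ k t, Measurable (w k t)
  isBrownian : ∀ k, IsBrownianReal (w k) P
  indep : iIndepFun (fun k ω t => w k t ω) P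
  m : HilbertBasis ℕ ℝ (Lp ℝ 2 (timeMeasure T))
  m_bounded : ∀ i, MemLp (m i) ∞ (timeMeasure T)

/-- The graph of the Wiener integral `h ↦ ∫_0^T h dw` on `L_2((0,T))`: the `L_2`-closure of the
linear span of the pairs `(1_{(a,b]}, w(b) - w(a))`. -/
def wienerGraph {Ω : Type*} [MeasurableSpace Ω] (P : Measure Ω) (T : ℝ) (w : ℝ≥0 → Ω → ℝ) :
    Set (Lp ℝ 2 (timeMeasure T) × Lp ℝ 2 P) :=
  closure (Submodule.span ℝ {p : Lp ℝ 2 (timeMeasure T) × Lp ℝ 2 P |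
    ∃ a b : ℝ≥0, a ≤ b ∧ (b : ℝ) ≤ T ∧
      (p.1 : ℝ → ℝ) =ᵐ[timeMeasure T] (Ioc (a : ℝ) b).indicator (fun _ => 1) ∧
      (p.2 : Ω → ℝ) =ᵐ[P] fun ω => w b ω - w a ω} :
    Set (Lp ℝ 2 (timeMeasure T) × Lp ℝ 2 P))

open Classical in
/-- The Wiener integral `∫_0^T h dw`. For a Wiener process `w` the graph is that of an isometry
defined on all of `L_2((0,T))`, so that the value is the unique `I` with `(h, I)` in it. -/
def wienerIntegral {Ω : Type*} [MeasurableSpace Ω] (P : Measure Ω) (T : ℝ) (w : ℝ≥0 → Ω → ℝ)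
    (h : Lp ℝ 2 (timeMeasure T)) : Lp ℝ 2 P :=
  if H : ∃ I : Lp ℝ 2 P, (h, I) ∈ wienerGraph P T w then H.choose else 0

section Noise

variable {Ω : Type*} [MeasurableSpace Ω] {P : Measure Ω} {T : ℝ}

/-- `ξ_{ik} = ∫_0^T m_i dw_k`. -/
def WienerNoise.gauss (N : WienerNoise Ω P T) (p : ℕ × ℕ) : Lp ℝ 2 P :=
  wienerIntegral P T (N.w p.2) (N.m p.1)

/-- `ξ_α = (α!)^{-1/2} ∏_{i,k} H_{α_i^k}(ξ_{ik})`, as a function on `Ω`. -/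
def WienerNoise.xiFun (N : WienerNoise Ω P T) (α : MultiIndex) (ω : Ω) : ℝ :=
  (√(α.fact : ℝ))⁻¹ *
    ∏ p ∈ α.support, ((Polynomial.hermite (α p)).map (Int.castRingHom ℝ)).eval (N.gauss p ω)

theorem WienerNoise.aestronglyMeasurable_xiFun (N : WienerNoise Ω P T) (α : MultiIndex) :
    AEStronglyMeasurable (N.xiFun α) P := by
  unfold WienerNoise.xiFun
  refine AEStronglyMeasurable.const_mul ?_ _
  refine Finset.aestronglyMeasurable_fun_prod _ fun p _ => ?_
  exact (Polynomial.continuous _).comp_aestronglyMeasurable (Lp.aestronglyMeasurable (N.gauss p))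

/-- The random variable `ξ_α` (an element of the Cameron-Martin basis), modulo equality a.s. -/
def WienerNoise.xi (N : WienerNoise Ω P T) (α : MultiIndex) : Ω →ₘ[P] ℝ :=
  AEEqFun.mk (N.xiFun α) (N.aestronglyMeasurable_xiFun α)

/-- The space of test random variables: finite linear combinations of the `ξ_α`. -/
def WienerNoise.Test (N : WienerNoise Ω P T) : Submodule ℝ (Ω →ₘ[P] ℝ) :=
  Submodule.span ℝ (range N.xi)

/-- `ξ_α` as a test random variable. -/
def WienerNoise.xiTest (N : WienerNoise Ω P T) (α : MultiIndex) : N.Test :=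
  ⟨N.xi α, Submodule.subset_span ⟨α, rfl⟩⟩

/-- Convergence of a sequence of test random variables: all expansions are supported in one finite
set of multi-indices and the coefficients converge. -/
def WienerNoise.TestTendsto (N : WienerNoise Ω P T) (v : ℕ → N.Test) (v₀ : N.Test) : Prop :=
  ∃ (J : Finset MultiIndex) (c : ℕ → MultiIndex → ℝ) (c₀ : MultiIndex → ℝ),
    (∀ n, v n = ∑ α ∈ J, c n α • N.xiTest α) ∧ v₀ = ∑ α ∈ J, c₀ α • N.xiTest α ∧
      ∀ α ∈ J, Tendsto (fun n => c n α) atTop (𝓝 (c₀ α))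

/-- `X`-valued generalized random elements: continuous linear maps from the space of test random
variables to `X`. Every linear map is continuous for the convergence above, see
`GenElement.tendsto`, so that no continuity requirement has to be added. -/
abbrev GenElement (N : WienerNoise Ω P T) (X : Type*) [AddCommGroup X] [Module ℝ X] : Type _ :=
  N.Test →ₗ[ℝ] X

theorem GenElement.tendsto {N : WienerNoise Ω P T} {X : Type*} [AddCommGroup X] [Module ℝ X]
    [TopologicalSpace X] [IsTopologicalAddGroup X] [ContinuousSMul ℝ X] (u : GenElement N X)
    {v : ℕ → N.Test} {v₀ : N.Test} (h : N.TestTendsto v v₀) :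
    Tendsto (fun n => u (v n)) atTop (𝓝 (u v₀)) := by
  obtain ⟨J, c, c₀, hv, hv₀, hc⟩ := h
  simp only [hv, hv₀, map_sum, map_smul]
  exact tendsto_finsetSum _ fun α hα => (hc α hα).smul_const _

/-- The generalized Fourier coefficient `u_α = u(ξ_α)`. -/
def coeff {N : WienerNoise Ω P T} {X : Type*} [AddCommGroup X] [Module ℝ X]
    (u : GenElement N X) (α : MultiIndex) : X :=
  u (N.xiTest α)

/-- The `α`-coefficient at time `t` of `∑_k 𝔻_k^* h_k`, the adjoint of the Malliavin derivative
(Skorokhod integral), where `h k β s` is the `β`-coefficient of `h_k` at time `s`: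
`∑_{i,k} ∫_0^t √(α_i^k) m_i(s) h_{k,α⁻(i,k)}(s) ds`. -/
def skorokhodCoeff (N : WienerNoise Ω P T) {X : Type*} [NormedAddCommGroup X] [NormedSpace ℝ X]
    (h : ℕ → MultiIndex → ℝ → X) (α : MultiIndex) (t : ℝ) : X :=
  ∑ p ∈ α.support, ∫ s in (0 : ℝ)..t, (√(α p : ℝ) * N.m p.1 s) • h p.2 (α.pred p) s

end Noise

section Triple

variable {V H : Type*} [NormedAddCommGroup V] [InnerProductSpace ℝ V]
  [NormedAddCommGroup H] [InnerProductSpace ℝ H]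

/-- The embedding `H ↪ V'`, `h ↦ (h, ·)_H`, of the normal triple `(V, H, V')` determined by the
embedding `ι : V ↪ H`; here `V'` is the dual space of `V` with its dual norm. -/
def toDual (ι : V →L[ℝ] H) (h : H) : StrongDual ℝ V := (innerSL ℝ h).comp ι

/-- `u` is a `w(V, V')` Wiener Chaos solution of
`du = (A u + f) dt + ∑_k (M_k u + g_k) dw_k`, `u(0) = u₀`: for every `α` the coefficients of the
two sides of
`u(t) = u₀ + ∫_0^t (A u + f) ds + ∑_k (𝔻_k^* (M_k u + g_k))(t)`
agree as elements of `L_1((0,T); V')`. -/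
def IsWienerChaosSolution {Ω : Type*} [MeasurableSpace Ω] {P : Measure Ω} {T : ℝ}
    (N : WienerNoise Ω P T) (ι : V →L[ℝ] H)
    (A : ℝ → V →L[ℝ] StrongDual ℝ V) (M : ℕ → ℝ → V →L[ℝ] H)
    (u₀ : GenElement N H) (f : GenElement N (Lp (StrongDual ℝ V) 2 (timeMeasure T)))
    (g : ℕ → GenElement N (Lp H 2 (timeMeasure T)))
    (u : GenElement N (Lp V 1 (timeMeasure T))) : Prop :=
  ∀ α : MultiIndex, ∀ᵐ t ∂(timeMeasure T),
    toDual ι (ι (coeff u α t)) =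
      toDual ι (coeff u₀ α)
        + (∫ s in (0 : ℝ)..t, (A s (coeff u α s) + coeff f α s))
        + skorokhodCoeff N
            (fun k β s => toDual ι (M k s (coeff u β s) + coeff (g k) β s)) α t

end Triple

end

end WienerChaos

open WienerChaos

/-!
The random variables `ξ_α` are linearly independent: the `ξ_{ik}` are jointly standard Gaussian, so
a polynomial relation between finitely many of them that holds almost surely is an identity, and
products of Hermite polynomials in different variables are linearly independent. Hence a generalized
random element is an arbitrary family of coefficients (`exists_genElement_coeff_eq`), and the
theorem concerns the system of deterministic equations for the coefficients.

In the normalized coefficients `c_α = u_α / √(α!)` the factors `√(α_i^k)` disappear and the system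
`IsChaosFamily` reads `c_α' = A c_α + f_α + ∑_{i,k} m_i (M_k c_{α⁻(i,k)} + g_{k,α⁻(i,k)})`, the sum
extending over the support of `α`. It is lower triangular with respect to the degree of `α`, so
existence and uniqueness follow from those for the deterministic equation `u' = A u + F`. A solution
of the latter is obtained from Lions' projection theorem (`exists_weakSolution`). The energy equality
(`IsPath.norm_sq`), which gives the continuous `H`-valued version and uniqueness, is proved by
regularizing with the resolvents `(ι^* ι + ε)⁻¹`.

The normalized system is linear and invariant under translations of `α`, and the norm of
`(𝒮)_{-1,0}(H)` is the `ℓ_2` norm of the normalized coefficients. Writing the solution as a sum of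
translates of solutions with data concentrated at `α = 0` (`IsChaosFamily.superposition`) and
applying Minkowski's inequality, one is reduced to the estimate for deterministic data
(`IsChaosFamily.sum_norm_sq_le`).

For deterministic data consider words `p = (p_1, …, p_n)` in a finite alphabet of pairs `(i, k)`, and
the functions `y_p = α(p)! c_{α(p)}`, where `α(p)` counts the letters of `p`. They satisfy
`y_p' = A y_p + ∑_j a_{p_j} M y_{p without p_j}`, where the vector `a_k(t)` has the entry `m_i(t)` at
the letter `(i, k)` and `0` at the letters with another space index. The multi-index `β` of degree
`n` belongs to `n! / β!` words, so that `∑_β ‖c_β‖²` is dominated by `∑_n (n!)⁻¹ ∑_p ‖y_p‖²`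
(`sum_le_sum_words`). Let `b(t)` be the inverse of `ε + ∑_k ∫_0^t a_k a_kᵀ`. By Bessel's inequality
`b ≥ (1 + ε)⁻¹`, and `b' = -∑_k (b a_k) (b a_k)ᵀ`. Consequently, in the derivative of
`R_n = (n!)⁻¹ ⟨b^{⊗n} y, y⟩` the derivative of `b` and the source terms combine to a square
(`slot_le`), and what remains is at most `((n - 1)!)⁻¹ ∑_k ⟨b^{⊗(n-1)} M_k y, M_k y⟩`, which the
parabolicity condition absorbs in the derivative of `R_{n-1}`. Thus `∑_n R_n` satisfies a Gronwall
inequality (`sum_norm_sq_words_le`). Its right-hand side involves only the equation for `α = 0`,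
where the coercivity of `A` applies (`IsPath.integral_source_le`). Letting `ε` be small depending on
the number of degrees under consideration gives a constant that depends only on `T`, `δ`, `C₁` and
`C₂`.
-/

namespace WienerChaos

noncomputable section

/-! ### Linear independence of the Cameron-Martin basis -/

section NoiseBasis

variable {Ω : Type*} [MeasurableSpace Ω] {P : Measure Ω} {T : ℝ}

/-- The Wiener processes are jointly Gaussian, as a process indexed by the number of the process
and the time. -/
theorem WienerNoise.jointly_gaussian (N : WienerNoise Ω P T) :
    IsGaussianProcess (fun (q : ℕ × ℝ≥0) ω => N.w q.1 q.2 ω) P where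
  hasGaussianLaw I := by
    classical
    let K := I.image Prod.fst
    let J := I.image Prod.snd
    have h0 := fun k => IsPreBrownianReal.isGaussianProcess (N.isBrownian k).toIsPreBrownianReal
    have h1 : HasGaussianLaw (fun ω (k : K) (t : J) => N.w k t ω) P := by
      refine iIndepFun.hasGaussianLaw (X := fun (k : K) ω (t : J) => N.w k t ω)
        (fun k => (h0 k).hasGaussianLaw J) ?_
      have h2 := N.indep.precomp (g := fun k : K => (k : ℕ)) Subtype.val_injective
      exact h2.comp (fun k (x : ℝ≥0 → ℝ) (t : J) => x t) (fun k => by fun_prop)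
    let L : (K → J → ℝ) →L[ℝ] (I → ℝ) :=
      { toFun := fun x q => x ⟨q.1.1, Finset.mem_image_of_mem _ q.2⟩
          ⟨q.1.2, Finset.mem_image_of_mem _ q.2⟩
        map_add' := by intros; rfl
        map_smul' := by intros; rfl }
    exact h1.map_fun L

/-- Increments `w_k(b) - w_k(a)`, indexed by `(k, a, b)`. -/
def WienerNoise.inc (N : WienerNoise Ω P T) (q : ℕ × ℝ≥0 × ℝ≥0) (ω : Ω) : ℝ :=
  N.w q.1 q.2.2 ω - N.w q.1 q.2.1 ω

theorem WienerNoise.inc_jointly_gaussian (N : WienerNoise Ω P T) :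
    IsGaussianProcess N.inc P := by
  classical
  refine IsGaussianProcess.of_isGaussianProcess N.jointly_gaussian fun q =>
    ⟨{(q.1, q.2.2), (q.1, q.2.1)},
    { toFun := fun x => x ⟨(q.1, q.2.2), by simp⟩ - x ⟨(q.1, q.2.1), by simp⟩
      map_add' := fun x y => by simp; ring
      map_smul' := fun c x => by simp; ring }, fun ω => rfl⟩

theorem WienerNoise.memLp_inc (N : WienerNoise Ω P T) (q : ℕ × ℝ≥0 × ℝ≥0) :
    MemLp (N.inc q) 2 P :=
  (N.inc_jointly_gaussian.hasGaussianLaw_eval q).memLp_two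

theorem WienerNoise.integral_inc (N : WienerNoise Ω P T) (q : ℕ × ℝ≥0 × ℝ≥0) :
    ∫ ω, N.inc q ω ∂P = 0 := by
  unfold WienerNoise.inc
  rw [integral_sub ((N.isBrownian _).integrable_eval _) ((N.isBrownian _).integrable_eval _)]
  have := (N.isBrownian q.1).integral_eval
  rw [this, this, sub_zero]

/-- The closed subspace of `L_2(P)` spanned by all increments. -/
def WienerNoise.gaussSpace (N : WienerNoise Ω P T) : Submodule ℝ (Lp ℝ 2 P) :=
  (Submodule.span ℝ (range fun q => (N.memLp_inc q).toLp)).topologicalClosure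

/-- The characteristic function is continuous in `L_2`, hence Gaussianity is a closed condition. -/
theorem continuous_integral_cexp [IsProbabilityMeasure P] :
    Continuous fun X : Lp ℝ 2 P => ∫ ω, Complex.exp (X ω * Complex.I) ∂P := by
  have hint : ∀ X : Lp ℝ 2 P, Integrable (fun ω => Complex.exp (X ω * Complex.I)) P := by
    intro X
    refine (integrable_const (1 : ℝ)).mono' ?_ (ae_of_all _ fun ω => ?_)
    · have := Lp.aestronglyMeasurable X
      exact Complex.continuous_exp.comp_aestronglyMeasurable
        ((Complex.continuous_ofReal.comp_aestronglyMeasurable this).mul_const _)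
    · rw [Complex.norm_exp_ofReal_mul_I]
  refine LipschitzWith.continuous (K := 1) (LipschitzWith.of_dist_le_mul fun X Y => ?_)
  rw [dist_eq_norm, dist_eq_norm, ← integral_sub (hint X) (hint Y), NNReal.coe_one, one_mul]
  have hle : ∀ x y : ℝ, ‖Complex.exp (x * Complex.I) - Complex.exp (y * Complex.I)‖ ≤ |x - y| := by
    intro x y
    have h := Real.norm_exp_I_mul_ofReal_sub_one_le (x := x - y)
    have e : Complex.exp (x * Complex.I) - Complex.exp (y * Complex.I)
        = Complex.exp (y * Complex.I) * (Complex.exp (Complex.I * ((x - y : ℝ) : ℂ)) - 1) := by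
      rw [mul_sub, ← Complex.exp_add]
      push_cast
      ring_nf
    rw [e, norm_mul, Complex.norm_exp_ofReal_mul_I, one_mul]
    simpa using h
  calc ‖∫ ω, (Complex.exp (X ω * Complex.I) - Complex.exp (Y ω * Complex.I)) ∂P‖
      ≤ ∫ ω, ‖(X - Y) ω‖ ∂P := by
        refine norm_integral_le_of_norm_le
          ((Lp.memLp (X - Y)).integrable (by norm_num)).norm ?_
        filter_upwards [Lp.coeFn_sub X Y] with ω hω
        rw [hω]
        exact hle _ _
    _ ≤ ‖X - Y‖ := by
        rw [integral_norm_eq_lintegral_enorm (Lp.aestronglyMeasurable _), Lp.norm_def,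
          ← eLpNorm_one_eq_lintegral_enorm]
        exact ENNReal.toReal_mono (Lp.eLpNorm_ne_top _)
          (eLpNorm_le_eLpNorm_of_exponent_le (by norm_num) (Lp.aestronglyMeasurable _))

theorem norm_sq_eq_integral_sq (X : Lp ℝ 2 P) : ‖X‖ ^ 2 = ∫ ω, X ω ^ 2 ∂P := by
  rw [← real_inner_self_eq_norm_sq, L2.inner_def]
  simp [sq]

/-- The elements of the closed span of the increments are centered Gaussian variables. -/
theorem WienerNoise.integral_cexp_of_mem [IsProbabilityMeasure P] (N : WienerNoise Ω P T)
    {X : Lp ℝ 2 P} (hX : X ∈ N.gaussSpace) :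
    ∫ ω, Complex.exp (X ω * Complex.I) ∂P = Complex.exp (-(‖X‖ ^ 2 : ℝ) / 2) := by
  have hcl : IsClosed {X : Lp ℝ 2 P | ∫ ω, Complex.exp (X ω * Complex.I) ∂P =
      Complex.exp (-(‖X‖ ^ 2 : ℝ) / 2)} :=
    isClosed_eq continuous_integral_cexp (by fun_prop)
  refine closure_minimal ?_ hcl hX
  intro X hX
  obtain ⟨c, rfl⟩ := Finsupp.mem_span_range_iff_exists_finsupp.1 hX
  set X : Lp ℝ 2 P := c.sum fun q a => a • (N.memLp_inc q).toLp with hXdef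
  have hae : X =ᵐ[P] fun ω => ∑ q ∈ c.support, c q * N.inc q ω := by
    rw [hXdef, Finsupp.sum]
    refine (Lp.coeFn_fun_finsetSum _ _).trans ?_
    have h1 : ∀ᵐ ω ∂P, ∀ q ∈ c.support, (c q • (N.memLp_inc q).toLp : Lp ℝ 2 P) ω
        = c q * N.inc q ω := by
      refine (ae_ball_iff c.support.countable_toSet).2 fun q _ => ?_
      filter_upwards [Lp.coeFn_smul (c q) ((N.memLp_inc q).toLp), (N.memLp_inc q).coeFn_toLp]
        with ω h2 h3
      rw [h2, Pi.smul_apply, h3, smul_eq_mul]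
    filter_upwards [h1] with ω hω
    exact Finset.sum_congr rfl hω
  have hg : HasGaussianLaw X P := by
    refine HasGaussianLaw.congr ?_ hae.symm
    exact (N.inc_jointly_gaussian.smul (fun q => c q)).hasGaussianLaw_fun_sum
  have hmean : ∫ ω, X ω ∂P = 0 := by
    rw [integral_congr_ae hae, integral_finsetSum _ fun q _ =>
      ((N.memLp_inc q).integrable (by norm_num)).const_mul _]
    simp [integral_const_mul, N.integral_inc]
  have hvar : Var[X; P] = ‖X‖ ^ 2 := by
    rw [variance_of_integral_eq_zero hg.aemeasurable hmean, norm_sq_eq_integral_sq]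
  have h2 := hg.charFun_map_eq (1 : ℝ)
  rw [charFun_apply_real, integral_map hg.aemeasurable (by fun_prop)] at h2
  have h3 : (fun ω => inner ℝ (1 : ℝ) (X ω)) = X := by ext ω; simp
  rw [h3, hmean, hvar] at h2
  simp only [mem_ofPred_eq]
  simpa [neg_div] using h2

theorem WienerNoise.integral_inc_mul_inc_of_ne (N : WienerNoise Ω P T) {k l : ℕ} (hkl : k ≠ l)
    (a b c d : ℝ≥0) : ∫ ω, N.inc (k, a, b) ω * N.inc (l, c, d) ω ∂P = 0 := by
  have h := N.indep.indepFun hkl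
  have h2 := h.comp (φ := fun x : ℝ≥0 → ℝ => x b - x a) (ψ := fun x : ℝ≥0 → ℝ => x d - x c)
    (by fun_prop) (by fun_prop)
  have h3 := h2.integral_fun_mul_eq_mul_integral
    (N.memLp_inc (k, a, b)).1 (N.memLp_inc (l, c, d)).1
  have h4 := N.integral_inc (k, a, b)
  simp only [Function.comp_apply] at h3
  simp only [WienerNoise.inc] at h4 ⊢
  rw [h3, h4, zero_mul]

theorem WienerNoise.integral_inc_mul_inc [IsProbabilityMeasure P] (N : WienerNoise Ω P T) (k : ℕ)
    {a b c d : ℝ≥0} (hab : a ≤ b) (hcd : c ≤ d) :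
    ∫ ω, N.inc (k, a, b) ω * N.inc (k, c, d) ω ∂P = max 0 (min (b : ℝ) d - max (a : ℝ) c) := by
  have h0 := IsPreBrownianReal.isGaussianProcess (N.isBrownian k).toIsPreBrownianReal
  have hm := fun t => (h0.hasGaussianLaw_eval t).memLp_two
  have h := covariance_eq_sub (N.memLp_inc (k, a, b)) (N.memLp_inc (k, c, d))
  rw [N.integral_inc, N.integral_inc, mul_zero, sub_zero] at h
  have h2 : ∫ ω, N.inc (k, a, b) ω * N.inc (k, c, d) ω ∂P
      = cov[N.inc (k, a, b), N.inc (k, c, d); P] := by rw [h]; rfl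
  rw [h2]
  unfold WienerNoise.inc
  rw [covariance_fun_sub_fun_sub (hm _) (hm _) (hm _) (hm _)]
  simp only [(N.isBrownian k).covariance_fun_eval, NNReal.coe_min]
  have hab' : (a : ℝ) ≤ b := hab
  have hcd' : (c : ℝ) ≤ d := hcd
  grind

theorem integral_indicator_Ioc_mul (a b c d : ℝ≥0) (hb : (b : ℝ) ≤ T) :
    ∫ t, (Ioc (a : ℝ) b).indicator (fun _ => (1 : ℝ)) t * (Ioc (c : ℝ) d).indicator (fun _ => 1) t
      ∂(timeMeasure T) = max 0 (min (b : ℝ) d - max (a : ℝ) c) := by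
  have h1 : (fun t => (Ioc (a : ℝ) b).indicator (fun _ => (1 : ℝ)) t *
      (Ioc (c : ℝ) d).indicator (fun _ => 1) t) =
      (Ioc (max (a : ℝ) c) (min b d)).indicator fun _ => 1 := by
    ext t
    rw [← Ioc_inter_Ioc]
    by_cases h1 : t ∈ Ioc (a : ℝ) b <;> by_cases h2 : t ∈ Ioc (c : ℝ) d <;>
      simp only [indicator, mem_inter_iff, h1, h2] <;> norm_num
  have h0 : timeMeasure T = volume.restrict (Ioc 0 T) := restrict_Ioo_eq_restrict_Ioc
  rw [h1, integral_indicator_const _ measurableSet_Ioc, h0, smul_eq_mul, mul_one,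
    measureReal_restrict_apply measurableSet_Ioc, inter_eq_left.2, Real.volume_real_Ioc, max_comm]
  refine Ioc_subset_Ioc (le_max_of_le_left a.2) (min_le_of_left_le hb)

/-- The generators of `wienerGraph`. -/
def stepGraph (P : Measure Ω) (T : ℝ) (w : ℝ≥0 → Ω → ℝ) :
    Set (Lp ℝ 2 (timeMeasure T) × Lp ℝ 2 P) :=
  {p | ∃ a b : ℝ≥0, a ≤ b ∧ (b : ℝ) ≤ T ∧
      (p.1 : ℝ → ℝ) =ᵐ[timeMeasure T] (Ioc (a : ℝ) b).indicator (fun _ => 1) ∧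
      (p.2 : Ω → ℝ) =ᵐ[P] fun ω => w b ω - w a ω}

/-- A relation between inner products passes from sets of generators to the closures of their
spans. -/
theorem inner_eq_of_mem_closure_span {E F : Type*} [NormedAddCommGroup E] [InnerProductSpace ℝ E]
    [NormedAddCommGroup F] [InnerProductSpace ℝ F] {S S' : Set (E × F)} {c : ℝ}
    (h : ∀ p ∈ S, ∀ q ∈ S', inner ℝ p.2 q.2 = c * inner ℝ p.1 q.1) :
    ∀ p ∈ closure (Submodule.span ℝ S : Set (E × F)),
      ∀ q ∈ closure (Submodule.span ℝ S' : Set (E × F)),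
        inner ℝ p.2 q.2 = c * inner ℝ p.1 q.1 := by
  have h1 : ∀ p ∈ S, ∀ q ∈ Submodule.span ℝ S', inner ℝ p.2 q.2 = c * inner ℝ p.1 q.1 := by
    intro p hp q hq
    induction hq using Submodule.span_induction with
    | mem q hq => exact h p hp q hq
    | zero => simp
    | add x y _ _ hx hy => simp only [Prod.snd_add, Prod.fst_add, inner_add_right, hx, hy]; ring
    | smul a x _ hx => simp only [Prod.smul_snd, Prod.smul_fst, inner_smul_right, hx]; ring
  have h2 : ∀ p ∈ Submodule.span ℝ S, ∀ q ∈ Submodule.span ℝ S',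
      inner ℝ p.2 q.2 = c * inner ℝ p.1 q.1 := by
    intro p hp q hq
    induction hp using Submodule.span_induction with
    | mem p hp => exact h1 p hp q hq
    | zero => simp
    | add x y _ _ hx hy => simp only [Prod.snd_add, Prod.fst_add, inner_add_left, hx, hy]; ring
    | smul a x _ hx => simp only [Prod.smul_snd, Prod.smul_fst, real_inner_smul_left, hx]; ring
  have h3 : ∀ p ∈ Submodule.span ℝ S, ∀ q ∈ closure (Submodule.span ℝ S' : Set (E × F)),
      inner ℝ p.2 q.2 = c * inner ℝ p.1 q.1 := fun p hp =>
    closure_minimal (s := (Submodule.span ℝ S' : Set (E × F)))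
      (t := {q | inner ℝ p.2 q.2 = c * inner ℝ p.1 q.1}) (fun q hq => h2 p hp q hq)
      (isClosed_eq (by fun_prop) (by fun_prop))
  intro p hp q hq
  exact closure_minimal (s := (Submodule.span ℝ S : Set (E × F)))
      (t := {p | inner ℝ p.2 q.2 = c * inner ℝ p.1 q.1}) (fun p hp => h3 p hp q hq)
      (isClosed_eq (by fun_prop) (by fun_prop)) hp

/-- The Wiener integral is isometric, and integrals with respect to different processes are
orthogonal. -/
theorem WienerNoise.inner_of_mem_wienerGraph [IsProbabilityMeasure P] (N : WienerNoise Ω P T)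
    {k l : ℕ} {p q : Lp ℝ 2 (timeMeasure T) × Lp ℝ 2 P} (hp : p ∈ wienerGraph P T (N.w k))
    (hq : q ∈ wienerGraph P T (N.w l)) :
    inner ℝ p.2 q.2 = (if k = l then 1 else 0) * inner ℝ p.1 q.1 := by
  refine inner_eq_of_mem_closure_span (S := stepGraph P T (N.w k)) (S' := stepGraph P T (N.w l))
    ?_ p hp q hq
  rintro p ⟨a, b, hab, hb, h1, h2⟩ q ⟨c, d, hcd, hd, h3, h4⟩
  have e1 : inner ℝ p.2 q.2 = ∫ ω, N.inc (k, a, b) ω * N.inc (l, c, d) ω ∂P := by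
    rw [L2.inner_def]
    refine integral_congr_ae ?_
    filter_upwards [h2, h4] with ω h2 h4
    simp [h2, h4, WienerNoise.inc, mul_comm]
  have e2 : inner ℝ p.1 q.1 = max 0 (min (b : ℝ) d - max (a : ℝ) c) := by
    rw [L2.inner_def, ← integral_indicator_Ioc_mul a b c d hb]
    refine integral_congr_ae ?_
    filter_upwards [h1, h3] with ω h2 h4
    rw [h2, h4]
    simp [mul_comm]
  rw [e1, e2]
  split_ifs with hkl
  · subst hkl
    rw [N.integral_inc_mul_inc k hab hcd, one_mul]
  · rw [N.integral_inc_mul_inc_of_ne hkl, zero_mul]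

theorem WienerNoise.mem_gaussSpace_of_mem_wienerGraph (N : WienerNoise Ω P T) {k : ℕ}
    {p : Lp ℝ 2 (timeMeasure T) × Lp ℝ 2 P} (hp : p ∈ wienerGraph P T (N.w k)) :
    p.2 ∈ N.gaussSpace := by
  have hcl : IsClosed {p : Lp ℝ 2 (timeMeasure T) × Lp ℝ 2 P | p.2 ∈ N.gaussSpace} :=
    (Submodule.isClosed_topologicalClosure _).preimage continuous_snd
  refine closure_minimal ?_ hcl hp
  intro p hp
  have hp' : p ∈ Submodule.span ℝ (stepGraph P T (N.w k)) := hp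
  have : Submodule.span ℝ (stepGraph P T (N.w k)) ≤ N.gaussSpace.comap (LinearMap.snd ℝ _ _) := by
    rw [Submodule.span_le]
    rintro p ⟨a, b, hab, hb, h1, h2⟩
    refine Submodule.le_topologicalClosure _ (Submodule.subset_span ⟨(k, a, b), ?_⟩)
    refine Lp.ext ((N.memLp_inc _).coeFn_toLp.trans h2.symm)
  exact this hp'

/-- Step functions are dense in `L_2((0,T))`: a function orthogonal to all of them has vanishing
primitive. -/
theorem eq_zero_of_forall_integral_Ioc (h : Lp ℝ 2 (timeMeasure T))
    (hz : ∀ b : ℝ≥0, (b : ℝ) ≤ T →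
      ∫ t, (Ioc (0 : ℝ) b).indicator (fun _ => (1 : ℝ)) t * h t ∂(timeMeasure T) = 0) : h = 0 := by
  rcases le_or_gt T 0 with hT | hT
  · have : ae (timeMeasure T) = ⊥ := by simp [hT]
    refine Lp.ext ?_
    rw [this]
    exact eventually_bot
  have h0 : timeMeasure T = volume.restrict (Ioc 0 T) := restrict_Ioo_eq_restrict_Ioc
  have hint : IntervalIntegrable h volume 0 T := by
    rw [intervalIntegrable_iff_integrableOn_Ioc_of_le hT.le, IntegrableOn, ← h0]
    exact (Lp.memLp h).integrable (by norm_num)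
  have hprim : ∀ b ∈ Icc 0 T, ∫ t in (0 : ℝ)..b, h t = 0 := by
    intro b hb
    have h0' : ∀ F : ℝ → ℝ, ∫ t, F t ∂(timeMeasure T) = ∫ t in Ioc 0 T, F t :=
      fun F => by rw [h0]
    have : ∫ t in Ioc 0 T, (Ioc (0 : ℝ) b).indicator (fun _ => (1 : ℝ)) t * h t = 0 := by
      rw [← h0']
      exact hz ⟨b, hb.1⟩ hb.2
    rw [intervalIntegral.integral_of_le hb.1]
    refine Eq.trans ?_ this
    have e : (fun t => (Ioc (0 : ℝ) b).indicator (fun _ => (1 : ℝ)) t * h t) =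
        (Ioc (0 : ℝ) b).indicator h := by
      ext t
      by_cases ht : t ∈ Ioc 0 b <;> simp [ht]
    rw [e, integral_indicator measurableSet_Ioc, Measure.restrict_restrict measurableSet_Ioc,
      inter_eq_left.2 (Ioc_subset_Ioc_right hb.2)]
  refine Lp.ext ?_
  refine EventuallyEq.trans ?_ (Lp.coeFn_zero _ _ _).symm
  rw [EventuallyEq, ae_restrict_iff' measurableSet_Ioo]
  filter_upwards [hint.ae_hasDerivAt_integral] with t ht htT
  have h1 := ht (by rw [uIcc_of_le hT.le]; exact Ioo_subset_Icc_self htT) 0 (by simp [hT.le])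
  have h2 : HasDerivAt (fun x => ∫ t in (0 : ℝ)..x, h t) 0 t := by
    refine (hasDerivAt_const t (0 : ℝ)).congr_of_eventuallyEq ?_
    filter_upwards [Icc_mem_nhds htT.1 htT.2] with x hx using hprim x hx
  exact h1.unique h2

/-- The Wiener integral of every `h ∈ L_2((0,T))` exists: the domain of the graph is dense, and it
is closed since the graph is closed and isometric. -/
theorem WienerNoise.exists_mem_wienerGraph [IsProbabilityMeasure P] (N : WienerNoise Ω P T) (k : ℕ)
    (h : Lp ℝ 2 (timeMeasure T)) : ∃ I, (h, I) ∈ wienerGraph P T (N.w k) := by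
  set S := Submodule.span ℝ (stepGraph P T (N.w k)) with hS
  set D := S.map (LinearMap.fst ℝ (Lp ℝ 2 (timeMeasure T)) (Lp ℝ 2 P)) with hD
  have hdense : D.topologicalClosure = ⊤ := by
    rw [Submodule.topologicalClosure_eq_top_iff, Submodule.eq_bot_iff]
    intro x hx
    refine eq_zero_of_forall_integral_Ioc x fun b hb => ?_
    have hmem : MemLp ((Ioc (0 : ℝ) b).indicator fun _ => (1 : ℝ)) 2 (timeMeasure T) :=
      memLp_indicator_const 2 measurableSet_Ioc 1 (Or.inr (measure_ne_top _ _))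
    have hgen : (hmem.toLp, (N.memLp_inc (k, 0, b)).toLp) ∈ stepGraph P T (N.w k) := by
      refine ⟨0, b, zero_le, hb, ?_, (N.memLp_inc (k, 0, b)).coeFn_toLp⟩
      simpa using hmem.coeFn_toLp
    have := (Submodule.mem_orthogonal _ _).1 hx hmem.toLp
      ⟨_, Submodule.subset_span hgen, rfl⟩
    rw [L2.inner_def] at this
    refine Eq.trans (integral_congr_ae ?_) this
    filter_upwards [hmem.coeFn_toLp] with t ht
    rw [ht]
    simp [mul_comm]
  have hiso : ∀ p ∈ S, ‖p.2‖ = ‖p.1‖ := by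
    intro p hp
    have h1 := N.inner_of_mem_wienerGraph (subset_closure hp) (subset_closure hp)
    simp only [if_true, one_mul, real_inner_self_eq_norm_sq] at h1
    exact (sq_eq_sq₀ (norm_nonneg _) (norm_nonneg _)).1 h1
  have hh : h ∈ closure (D : Set (Lp ℝ 2 (timeMeasure T))) := by
    have : h ∈ D.topologicalClosure := hdense ▸ Submodule.mem_top
    exact this
  obtain ⟨x, hx, hlim⟩ := mem_closure_iff_seq_limit.1 hh
  choose p hp hpx using hx
  have hcau : CauchySeq fun n => (p n).2 := by
    rw [Metric.cauchySeq_iff']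
    intro ε hε
    obtain ⟨n₀, hn₀⟩ := Metric.cauchySeq_iff'.1 hlim.cauchySeq ε hε
    refine ⟨n₀, fun n hn => ?_⟩
    have := hn₀ n hn
    rw [← hpx, ← hpx, dist_eq_norm] at this
    rw [dist_eq_norm]
    have h2 := hiso _ (S.sub_mem (hp n) (hp n₀))
    simp only [Prod.snd_sub, Prod.fst_sub] at h2
    rw [h2]
    exact this
  obtain ⟨I, hI⟩ := cauchySeq_tendsto_of_complete hcau
  refine ⟨I, mem_closure_of_tendsto (b := atTop) (f := p) ?_ (Eventually.of_forall hp)⟩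
  refine Tendsto.prodMk_nhds ?_ hI
  have : (fun n => (p n).1) = x := funext hpx
  rw [this]
  exact hlim

theorem WienerNoise.gauss_mem_wienerGraph [IsProbabilityMeasure P] (N : WienerNoise Ω P T)
    (p : ℕ × ℕ) : (N.m p.1, N.gauss p) ∈ wienerGraph P T (N.w p.2) := by
  have h := N.exists_mem_wienerGraph p.2 (N.m p.1)
  unfold WienerNoise.gauss wienerIntegral
  rw [dif_pos h]
  exact h.choose_spec

theorem WienerNoise.orthonormal_gauss [IsProbabilityMeasure P] (N : WienerNoise Ω P T) :
    Orthonormal ℝ N.gauss := by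
  rw [orthonormal_iff_ite]
  intro p q
  rw [N.inner_of_mem_wienerGraph (N.gauss_mem_wienerGraph p) (N.gauss_mem_wienerGraph q),
    orthonormal_iff_ite.1 N.m.orthonormal]
  have : p = q ↔ p.2 = q.2 ∧ p.1 = q.1 := by rw [Prod.ext_iff, and_comm]
  by_cases h1 : p.2 = q.2 <;> by_cases h2 : p.1 = q.1 <;> simp [this, h1, h2]

/-- Finitely many of the `ξ_{ik}` are jointly standard Gaussian. -/
theorem WienerNoise.map_gauss_eq_stdGaussian [IsProbabilityMeasure P] (N : WienerNoise Ω P T)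
    (s : Finset (ℕ × ℕ)) :
    P.map (fun ω => WithLp.toLp 2 fun p : s => N.gauss p ω) =
      stdGaussian (EuclideanSpace ℝ s) := by
  have hm : AEMeasurable (fun ω => WithLp.toLp 2 fun p : s => N.gauss p ω) P := by
    refine (WithLp.measurable_toLp 2 _).comp_aemeasurable ?_
    exact aemeasurable_pi_lambda _ fun p => (Lp.aestronglyMeasurable (N.gauss p)).aemeasurable
  have : IsProbabilityMeasure (P.map (fun ω => WithLp.toLp 2 fun p : s => N.gauss p ω)) :=
    Measure.isProbabilityMeasure_map hm
  refine Measure.ext_of_charFun ?_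
  ext t
  rw [charFun_stdGaussian, charFun_apply, integral_map hm (by fun_prop)]
  set X : Lp ℝ 2 P := ∑ p : s, t p • N.gauss p with hX
  have hXm : X ∈ N.gaussSpace := Submodule.sum_mem _ fun p _ => Submodule.smul_mem _ _
    (N.mem_gaussSpace_of_mem_wienerGraph (N.gauss_mem_wienerGraph p))
  have hXn : ‖X‖ ^ 2 = ‖t‖ ^ 2 := by
    have ho : Orthonormal ℝ fun p : s => N.gauss p :=
      N.orthonormal_gauss.comp _ Subtype.val_injective
    rw [← real_inner_self_eq_norm_sq, hX, ho.inner_sum, EuclideanSpace.norm_sq_eq]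
    simp [sq]
  have h := N.integral_cexp_of_mem hXm
  rw [hXn] at h
  push_cast at h
  rw [← h]
  refine integral_congr_ae ?_
  have h1 : ∀ᵐ ω ∂P, ∀ p : s, (t p • N.gauss p : Lp ℝ 2 P) ω = t p * N.gauss p ω := by
    refine ae_all_iff.2 fun p => ?_
    filter_upwards [Lp.coeFn_smul (t p) (N.gauss p)] with ω h2
    rw [h2, Pi.smul_apply, smul_eq_mul]
  filter_upwards [h1, Lp.coeFn_fun_finsetSum Finset.univ fun p : s => t p • N.gauss p]
    with ω h2 h3
  rw [hX, h3]
  simp only [h2, PiLp.inner_apply]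
  simp [mul_comm]

/-- Continuous functions of finitely many `ξ_{ik}` that vanish almost surely vanish identically:
the standard Gaussian measure charges every non-empty open set. -/
theorem WienerNoise.eq_zero_of_ae_gauss [IsProbabilityMeasure P] (N : WienerNoise Ω P T)
    (s : Finset (ℕ × ℕ)) {F : (s → ℝ) → ℝ} (hF : Continuous F)
    (h : ∀ᵐ ω ∂P, F (fun p => N.gauss p ω) = 0) : F = 0 := by
  have hop1 : (gaussianReal 0 1).IsOpenPosMeasure :=
    (gaussianReal_absolutelyContinuous' 0 one_ne_zero).isOpenPosMeasure
  have hm : AEMeasurable (fun ω => fun p : s => N.gauss p ω) P :=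
    aemeasurable_pi_lambda _ fun p => (Lp.aestronglyMeasurable (N.gauss p)).aemeasurable
  have hlaw : P.map (fun ω => fun p : s => N.gauss p ω) =
      Measure.pi fun _ : s => gaussianReal 0 1 := by
    have h1 := N.map_gauss_eq_stdGaussian s
    rw [← map_pi_eq_stdGaussian] at h1
    have h2 : P.map (fun ω => WithLp.toLp 2 fun p : s => N.gauss p ω) =
        (P.map fun ω => fun p : s => N.gauss p ω).map (WithLp.toLp 2) := by
      rw [AEMeasurable.map_map_of_aemeasurable (WithLp.measurable_toLp 2 _).aemeasurable hm]
      rfl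
    rw [h2] at h1
    exact (MeasurableEquiv.toLp 2 (s → ℝ)).map_measurableEquiv_injective h1
  have h3 : ∀ᵐ x ∂(Measure.pi fun _ : s => gaussianReal 0 1), F x = 0 := by
    rw [← hlaw, ae_map_iff (p := fun x => F x = 0) hm
      (hF.measurable (measurableSet_singleton (0 : ℝ)))]
    exact h
  exact Measure.eq_of_ae_eq (μ := Measure.pi fun _ : s => gaussianReal 0 1) h3 hF continuous_const

/-- Hermite polynomials as real polynomials. -/
def realHermite (n : ℕ) : Polynomial ℝ := (Polynomial.hermite n).map (Int.castRingHom ℝ)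

theorem linearIndependent_realHermite : LinearIndependent ℝ realHermite := by
  let S : Polynomial.Sequence ℝ :=
    { elems' := realHermite
      degree_eq' := fun i => by
        rw [realHermite, (Polynomial.hermite_monic i).degree_map, Polynomial.degree_hermite] }
  exact S.linearIndependent

/-- Products of Hermite polynomials in different variables are linearly independent as functions;
by induction on the set of variables. -/
theorem coeff_eq_zero_of_sum_prod_realHermite_eq_zero {ι : Type*} [DecidableEq ι] (s : Finset ι) :
    ∀ (A : Finset (ι →₀ ℕ)), (∀ α ∈ A, ∀ β ∈ A, (∀ p ∈ s, α p = β p) → α = β) →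
      ∀ c : (ι →₀ ℕ) → ℝ,
        (∀ x : ι → ℝ, ∑ α ∈ A, c α * ∏ p ∈ s, (realHermite (α p)).eval (x p) = 0) →
        ∀ α ∈ A, c α = 0 := by
  induction s using Finset.induction_on with
  | empty =>
    intro A hA c h α hα
    have hA' : A = {α} := by
      refine Finset.eq_singleton_iff_unique_mem.2 ⟨hα, fun β hβ => hA β hβ α hα (by simp)⟩
    have := h 0
    simpa [hA'] using this
  | insert p₀ s hp₀ ih =>
    intro A hA c h α hα
    set A' := A.filter fun β => β p₀ = α p₀ with hA'
    refine ih A' ?_ c ?_ α (by simp [hA', hα])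
    · intro β hβ γ hγ hβγ
      simp only [hA', Finset.mem_filter] at hβ hγ
      refine hA β hβ.1 γ hγ.1 fun p hp => ?_
      rcases Finset.mem_insert.1 hp with rfl | hp
      · rw [hβ.2, hγ.2]
      · exact hβγ p hp
    · intro x
      set B : ℕ → ℝ := fun n => ∑ β ∈ A.filter (fun β => β p₀ = n),
        c β * ∏ p ∈ s, (realHermite (β p)).eval (x p) with hB
      have hpoly : ∑ n ∈ A.image (fun β => β p₀), B n • realHermite n = 0 := by
        refine Polynomial.funext fun y => ?_
        have h1 := h (Function.update x p₀ y)
        rw [Polynomial.eval_finsetSum, Polynomial.eval_zero, ← h1]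
        rw [← Finset.sum_fiberwise_of_maps_to
          (fun β hβ => Finset.mem_image_of_mem (fun β : ι →₀ ℕ => β p₀) hβ)]
        refine Finset.sum_congr rfl fun n _ => ?_
        rw [Polynomial.eval_smul, hB, smul_eq_mul, Finset.sum_mul]
        refine Finset.sum_congr rfl fun β hβ => ?_
        rw [Finset.prod_insert hp₀, Function.update_self, (Finset.mem_filter.1 hβ).2]
        have : ∏ p ∈ s, (realHermite (β p)).eval (Function.update x p₀ y p) =
            ∏ p ∈ s, (realHermite (β p)).eval (x p) := by
          refine Finset.prod_congr rfl fun p hp => ?_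
          rw [Function.update_of_ne]
          rintro rfl
          exact hp₀ hp
        rw [this]
        ring
      exact linearIndependent_iff'.1 linearIndependent_realHermite _ B hpoly (α p₀)
        (Finset.mem_image_of_mem (fun β : ι →₀ ℕ => β p₀) hα)

theorem MultiIndex.fact_pos (α : MultiIndex) : 0 < α.fact :=
  Finset.prod_pos fun _ _ => Nat.factorial_pos _

theorem WienerNoise.xiFun_eq_prod (N : WienerNoise Ω P T) {α : MultiIndex} {s : Finset (ℕ × ℕ)}
    (hs : α.support ⊆ s) (ω : Ω) :
    N.xiFun α ω = (√(α.fact : ℝ))⁻¹ * ∏ p ∈ s, (realHermite (α p)).eval (N.gauss p ω) := by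
  unfold WienerNoise.xiFun
  congr 1
  refine Finset.prod_subset hs fun p _ hp => ?_
  rw [Finsupp.notMem_support_iff.1 hp]
  simp

/-- A linear relation between the `ξ_α` is a polynomial relation between finitely many `ξ_{ik}` that
holds almost surely, hence identically. -/
theorem WienerNoise.linearIndependent_xi [IsProbabilityMeasure P] (N : WienerNoise Ω P T) :
    LinearIndependent ℝ N.xi := by
  classical
  rw [linearIndependent_iff']
  intro A c hsum α hα
  set s : Finset (ℕ × ℕ) := A.sup fun β => β.support with hs
  have hsub : ∀ β ∈ A, β.support ⊆ s := fun β hβ => Finset.le_sup (f := fun β => β.support) hβ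
  set d : MultiIndex → ℝ := fun β => c β * (√(β.fact : ℝ))⁻¹ with hd
  have hfun : ∀ᵐ ω ∂P, ∑ β ∈ A, c β * N.xiFun β ω = 0 := by
    have h1 : ∀ᵐ ω ∂P, ∀ β ∈ A, (c β • N.xi β) ω = c β * N.xiFun β ω := by
      refine (ae_ball_iff A.countable_toSet).2 fun β _ => ?_
      filter_upwards [AEEqFun.coeFn_smul (c β) (N.xi β), AEEqFun.coeFn_mk (N.xiFun β)
        (N.aestronglyMeasurable_xiFun β)] with ω h2 h3
      rw [h2, Pi.smul_apply, WienerNoise.xi, h3, smul_eq_mul]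
    have h2 := AEEqFun.coeFn_fun_finsetSum A fun β => c β • N.xi β
    rw [hsum] at h2
    filter_upwards [h1, h2, AEEqFun.coeFn_zero (α := Ω) (β := ℝ) (μ := P)] with ω h1 h2 h3
    rw [← Finset.sum_congr rfl h1, ← h2, h3]
    rfl
  set F : (s → ℝ) → ℝ := fun x => ∑ β ∈ A, d β * ∏ p : s, (realHermite (β p)).eval (x p) with hF
  have hF0 : F = 0 := by
    refine N.eq_zero_of_ae_gauss s (by fun_prop) ?_
    filter_upwards [hfun] with ω hω
    rw [← hω, hF]
    refine Finset.sum_congr rfl fun β hβ => ?_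
    rw [N.xiFun_eq_prod (hsub β hβ), ← Finset.prod_coe_sort s, hd, mul_assoc]
  have hd0 : d α = 0 := by
    refine coeff_eq_zero_of_sum_prod_realHermite_eq_zero s A ?_ d ?_ α hα
    · intro β hβ γ hγ h
      ext p
      by_cases hp : p ∈ s
      · exact h p hp
      · rw [Finsupp.notMem_support_iff.1 fun h => hp (hsub β hβ h),
          Finsupp.notMem_support_iff.1 fun h => hp (hsub γ hγ h)]
    · intro x
      have := congrFun hF0 fun p => x p
      rw [hF] at this
      simp only [Pi.zero_apply] at this
      rw [← this]
      refine Finset.sum_congr rfl fun β hβ => ?_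
      rw [← Finset.prod_coe_sort s]
  have : (√(α.fact : ℝ))⁻¹ ≠ 0 := by
    have := α.fact_pos
    positivity
  exact (mul_eq_zero.1 hd0).resolve_right this

/-- Generalized random elements may be prescribed by their coefficients. -/
theorem exists_genElement_coeff_eq [IsProbabilityMeasure P] (N : WienerNoise Ω P T) {X : Type*}
    [AddCommGroup X] [Module ℝ X] (x : MultiIndex → X) :
    ∃ u : GenElement N X, ∀ α, coeff u α = x α := by
  let b : Module.Basis MultiIndex ℝ N.Test := Module.Basis.span N.linearIndependent_xi
  refine ⟨b.constr ℝ x, fun α => ?_⟩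
  have : N.xiTest α = b α := Subtype.ext (Module.Basis.coe_span_apply N.linearIndependent_xi α).symm
  rw [coeff, this, Module.Basis.constr_basis]

theorem genElement_ext {N : WienerNoise Ω P T} {X : Type*}
    [AddCommGroup X] [Module ℝ X] {u v : GenElement N X} (h : ∀ α, coeff u α = coeff v α) :
    u = v := by
  have hspan : Submodule.span ℝ (range N.xiTest) = ⊤ := by
    have h1 : range N.xiTest = ((↑) : N.Test → Ω →ₘ[P] ℝ) ⁻¹' range N.xi := by
      ext x
      constructor
      · rintro ⟨α, rfl⟩
        exact ⟨α, rfl⟩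
      · rintro ⟨α, hα⟩
        exact ⟨α, Subtype.ext hα⟩
    rw [h1]
    exact Submodule.span_span_coe_preimage
  exact LinearMap.ext_on_range hspan h

end NoiseBasis

/-! ### Integration on the time interval -/

section Analysis

variable {T : ℝ}

theorem timeMeasure_eq_restrict_Ioc (T : ℝ) : timeMeasure T = volume.restrict (Ioc 0 T) :=
  restrict_Ioo_eq_restrict_Ioc

theorem integral_timeMeasure {E : Type*} [NormedAddCommGroup E] [NormedSpace ℝ E] (hT : 0 ≤ T)
    (f : ℝ → E) : ∫ t, f t ∂(timeMeasure T) = ∫ t in (0 : ℝ)..T, f t := by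
  rw [timeMeasure_eq_restrict_Ioc, intervalIntegral.integral_of_le hT]

theorem intervalIntegrable_iff_timeMeasure {E : Type*} [NormedAddCommGroup E] (hT : 0 ≤ T)
    {f : ℝ → E} : IntervalIntegrable f volume 0 T ↔ Integrable f (timeMeasure T) := by
  rw [timeMeasure_eq_restrict_Ioc, intervalIntegrable_iff_integrableOn_Ioc_of_le hT, IntegrableOn]

theorem Integrable.intervalIntegrable_of_mem {E : Type*} [NormedAddCommGroup E]
    {f : ℝ → E} (hf : Integrable f (timeMeasure T)) {a b : ℝ} (ha : a ∈ Icc 0 T)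
    (hb : b ∈ Icc 0 T) : IntervalIntegrable f volume a b := by
  have hT : 0 ≤ T := ha.1.trans ha.2
  refine ((intervalIntegrable_iff_timeMeasure hT).2 hf).mono_set ?_
  rw [uIcc_of_le hT]
  exact uIcc_subset_Icc ha hb

theorem ae_timeMeasure_mem (T : ℝ) : ∀ᵐ t ∂(timeMeasure T), t ∈ Ioo 0 T :=
  ae_restrict_mem measurableSet_Ioo

/-- Composition of a pointwise strongly measurable family of bounded operators with a strongly
measurable function. The spaces need not be separable. -/
theorem aestronglyMeasurable_clm_apply {α E F : Type*} [MeasurableSpace α] {μ : Measure α}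
    [NormedAddCommGroup E] [NormedSpace ℝ E] [NormedAddCommGroup F] [NormedSpace ℝ F]
    {A : α → E →L[ℝ] F} (hA : ∀ v, AEStronglyMeasurable (fun t => A t v) μ) {u : α → E}
    (hu : AEStronglyMeasurable u μ) : AEStronglyMeasurable (fun t => A t (u t)) μ := by
  obtain ⟨u', hu', huu'⟩ := hu
  have h1 : AEStronglyMeasurable (fun t => A t (u' t)) μ := by
    refine aestronglyMeasurable_of_tendsto_ae atTop
      (f := fun n t => A t (hu'.approx n t)) (fun n => ?_)
      (ae_of_all _ fun t => ((A t).continuous.tendsto _).comp (hu'.tendsto_approx t))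
    have e : (fun t => A t (hu'.approx n t)) = fun t => ∑ v ∈ (hu'.approx n).range,
        ((hu'.approx n) ⁻¹' {v}).indicator (fun t => A t v) t := by
      ext t
      rw [Finset.sum_eq_single (hu'.approx n t)]
      · rw [indicator_of_mem]
        exact mem_singleton _
      · intro v _ hv
        rw [indicator_of_notMem]
        exact fun h => hv (mem_singleton_iff.1 h).symm
      · intro h
        exact absurd ((hu'.approx n).mem_range_self t) h
    rw [e]
    exact Finset.aestronglyMeasurable_fun_sum _ fun v _ =>
      (hA v).indicator ((hu'.approx n).measurableSet_fiber v)
  refine h1.congr ?_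
  filter_upwards [huu'] with t ht
  rw [ht]

theorem memLp_clm_apply {α E F : Type*} [MeasurableSpace α] {μ : Measure α}
    [NormedAddCommGroup E] [NormedSpace ℝ E] [NormedAddCommGroup F] [NormedSpace ℝ F]
    {A : α → E →L[ℝ] F} (hA : ∀ v, AEStronglyMeasurable (fun t => A t v) μ) {K : ℝ}
    (hK : ∀ᵐ t ∂μ, ∀ v, ‖A t v‖ ≤ K * ‖v‖) {p : ℝ≥0∞} {u : α → E} (hu : MemLp u p μ) :
    MemLp (fun t => A t (u t)) p μ := by
  refine hu.of_le_mul (c := K) (aestronglyMeasurable_clm_apply hA hu.1) ?_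
  filter_upwards [hK] with t ht using ht _

theorem memLp_fun_add {α E : Type*} [MeasurableSpace α] {μ : Measure α} [NormedAddCommGroup E]
    {p : ℝ≥0∞} {f g : α → E} (hf : MemLp f p μ) (hg : MemLp g p μ) :
    MemLp (fun t => f t + g t) p μ := MemLp.add hf hg

/-- Fubini's theorem on the triangle `0 ≤ s ≤ r ≤ T`, as integration by parts. -/
theorem integral_mul_integral_Ici {f g : ℝ → ℝ} (hf : IntervalIntegrable f volume 0 T)
    (hg : IntervalIntegrable g volume 0 T) :
    ∫ s in (0 : ℝ)..T, f s * ∫ r in s..T, g r = ∫ r in (0 : ℝ)..T, (∫ s in (0 : ℝ)..r, f s) * g r := by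
  have hF := hf.absolutelyContinuousOnInterval_intervalIntegral (c := 0) (by simp)
  have hG := hg.absolutelyContinuousOnInterval_intervalIntegral (c := T) (by simp)
  have h := hF.integral_mul_deriv_eq_deriv_mul hG
  simp only [intervalIntegral.integral_same, mul_zero, zero_mul, sub_zero, zero_sub] at h
  have e1 : ∫ r in (0 : ℝ)..T, (∫ s in (0 : ℝ)..r, f s) * deriv (fun x => ∫ t in T..x, g t) r =
      ∫ r in (0 : ℝ)..T, (∫ s in (0 : ℝ)..r, f s) * g r := by
    refine intervalIntegral.integral_congr_ae ?_
    filter_upwards [hg.ae_hasDerivAt_integral] with r hr hrT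
    rw [(hr (uIoc_subset_uIcc hrT) T (by simp)).deriv]
  have e2 : ∫ s in (0 : ℝ)..T, deriv (fun x => ∫ t in (0 : ℝ)..x, f t) s * ∫ t in T..s, g t =
      - ∫ s in (0 : ℝ)..T, f s * ∫ r in s..T, g r := by
    rw [← intervalIntegral.integral_neg]
    refine intervalIntegral.integral_congr_ae ?_
    filter_upwards [hf.ae_hasDerivAt_integral] with r hr hrT
    rw [(hr (uIoc_subset_uIcc hrT) 0 (by simp)).deriv, intervalIntegral.integral_symm r T]
    ring
  rw [e1, e2] at h
  rw [h, neg_neg]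

/-! ### Functionals dominated by a family of functionals -/

/-- A linear functional dominated by the norm of `K ψ` is a continuous functional of `K ψ`. -/
theorem exists_dual_comp_eq_of_abs_le {Ψ Y : Type*} [AddCommGroup Ψ] [Module ℝ Ψ]
    [NormedAddCommGroup Y] [NormedSpace ℝ Y] (K : Ψ →ₗ[ℝ] Y) (L : Ψ →ₗ[ℝ] ℝ) (C : ℝ)
    (h : ∀ ψ, |L ψ| ≤ C * ‖K ψ‖) : ∃ g : StrongDual ℝ Y, ∀ ψ, g (K ψ) = L ψ := by
  obtain ⟨s, hs⟩ := K.rangeRestrict.exists_rightInverse_of_surjective K.range_rangeRestrict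
  have hs' : ∀ x : K.range, K (s x) = x := fun x => by
    have := LinearMap.congr_fun hs x
    simpa using congrArg Subtype.val this
  let g : StrongDual ℝ K.range := (L.comp s).mkContinuous C fun x => by
    have := h (s x)
    rw [hs'] at this
    exact this
  obtain ⟨g', hg', -⟩ := _root_.exists_extension_norm_eq K.range g
  refine ⟨g', fun ψ => ?_⟩
  have h3 : g' (K ψ) = L (s ⟨K ψ, ⟨ψ, rfl⟩⟩) := hg' ⟨K ψ, ⟨ψ, rfl⟩⟩
  have h4 : L (ψ - s ⟨K ψ, ⟨ψ, rfl⟩⟩) = 0 := by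
    have := h (ψ - s ⟨K ψ, ⟨ψ, rfl⟩⟩)
    rw [map_sub K, hs', sub_self, norm_zero, mul_zero] at this
    exact abs_nonpos_iff.1 this
  rw [map_sub, sub_eq_zero] at h4
  rw [h3, h4]

/-- The representation step of Lions' projection theorem: a linear functional dominated by the norm
of the functional `K ψ` is evaluation of `K ψ` at a vector. -/
theorem exists_apply_eq_of_abs_le {Ψ X : Type*} [AddCommGroup Ψ] [Module ℝ Ψ]
    [NormedAddCommGroup X] [InnerProductSpace ℝ X] [CompleteSpace X] (K : Ψ →ₗ[ℝ] StrongDual ℝ X)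
    (L : Ψ →ₗ[ℝ] ℝ) (C : ℝ) (h : ∀ ψ, |L ψ| ≤ C * ‖K ψ‖) : ∃ u : X, ∀ ψ, K ψ u = L ψ := by
  obtain ⟨g, hg⟩ := exists_dual_comp_eq_of_abs_le K L C h
  let e := InnerProductSpace.toDual ℝ X
  let g' : StrongDual ℝ X := LinearMap.mkContinuous
    { toFun := fun x => g (e x)
      map_add' := fun x y => by simp
      map_smul' := fun c x => by simp } ‖g‖ fun x => by
        simpa [e] using g.le_opNorm (e x)
  refine ⟨e.symm g', fun ψ => ?_⟩
  rw [← hg ψ]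
  have h2 : ∀ u, K ψ u = inner ℝ (e.symm (K ψ)) u := fun u => by
    rw [InnerProductSpace.toDual_symm_apply]
  rw [h2, real_inner_comm, InnerProductSpace.toDual_symm_apply]
  simp [g', e]

end Analysis

/-! ### Existence for the deterministic equation -/

section Existence

variable {T : ℝ}

theorem norm_sq_Lp_two {α E : Type*} [MeasurableSpace α] {μ : Measure α} [NormedAddCommGroup E]
    [InnerProductSpace ℝ E] (u : Lp E 2 μ) : ‖u‖ ^ 2 = ∫ t, ‖u t‖ ^ 2 ∂μ := by
  rw [← real_inner_self_eq_norm_sq, L2.inner_def]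
  simp

theorem Continuous.memLp_timeMeasure {E : Type*} [NormedAddCommGroup E] {f : ℝ → E}
    (hf : Continuous f) (p : ℝ≥0∞) : MemLp f p (timeMeasure T) := by
  obtain ⟨C, hC⟩ := (isCompact_Icc (a := (0 : ℝ)) (b := T)).exists_bound_of_continuousOn
    hf.continuousOn
  refine MemLp.of_bound hf.aestronglyMeasurable C ?_
  filter_upwards [ae_timeMeasure_mem T] with t ht using hC t (Ioo_subset_Icc_self ht)

variable {V H : Type*} [NormedAddCommGroup V] [InnerProductSpace ℝ V]
  [NormedAddCommGroup H] [InnerProductSpace ℝ H]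

theorem integrable_dual_apply {α : Type*} [MeasurableSpace α] {μ : Measure α}
    {φ : α → StrongDual ℝ V} {u : α → V} (hφ : MemLp φ 2 μ) (hu : MemLp u 2 μ) :
    Integrable (fun t => φ t (u t)) μ := by
  refine (hφ.norm.integrable_mul hu.norm).mono ?_ (ae_of_all _ fun t => ?_)
  · exact (isBoundedBilinearMap_apply (𝕜 := ℝ) (E := V) (F := ℝ)).continuous.comp_aestronglyMeasurable
      (hφ.1.prodMk hu.1)
  · simpa using (φ t).le_opNorm (u t)

theorem abs_integral_dual_apply_le {α : Type*} [MeasurableSpace α] {μ : Measure α}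
    {φ : α → StrongDual ℝ V} {u : α → V} (hφ : MemLp φ 2 μ) (hu : MemLp u 2 μ) :
    |∫ t, φ t (u t) ∂μ| ≤ √(∫ t, ‖φ t‖ ^ 2 ∂μ) * √(∫ t, ‖u t‖ ^ 2 ∂μ) := by
  calc |∫ t, φ t (u t) ∂μ| ≤ ∫ t, ‖φ t‖ * ‖u t‖ ∂μ := by
        rw [← Real.norm_eq_abs]
        refine norm_integral_le_of_norm_le (hφ.norm.integrable_mul hu.norm) ?_
        exact ae_of_all _ fun t => (φ t).le_opNorm (u t)
    _ ≤ _ := by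
        have h := integral_mul_le_Lp_mul_Lq_of_nonneg (μ := μ) Real.HolderConjugate.two_two
          (f := fun t => ‖φ t‖) (g := fun t => ‖u t‖) (ae_of_all _ fun t => norm_nonneg _)
          (ae_of_all _ fun t => norm_nonneg _) (by simpa using hφ.norm) (by simpa using hu.norm)
        simpa [Real.sqrt_eq_rpow] using h

@[simp]
theorem toDual_apply (ι : V →L[ℝ] H) (h : H) (v : V) : toDual ι h v = inner ℝ h (ι v) := rfl

/-- `toDual` as a continuous linear map. -/
def toDualL (ι : V →L[ℝ] H) : H →L[ℝ] StrongDual ℝ V :=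
  LinearMap.mkContinuous
    { toFun := toDual ι
      map_add' := fun x y => by ext v; simp [inner_add_left]
      map_smul' := fun c x => by ext v; simp [real_inner_smul_left] } ‖ι‖ fun h => by
    refine ContinuousLinearMap.opNorm_le_bound _ (by positivity) fun v => ?_
    calc ‖toDual ι h v‖ ≤ ‖h‖ * ‖ι v‖ := norm_inner_le_norm _ _
      _ ≤ ‖h‖ * (‖ι‖ * ‖v‖) := by gcongr; exact ι.le_opNorm v
      _ = ‖ι‖ * ‖h‖ * ‖v‖ := by ring

/-- `∫_t^T ψ`, the primitive vanishing at the final time. -/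
def tail (T : ℝ) (ψ : ℝ → V) (t : ℝ) : V := ∫ s in t..T, ψ s

theorem tail_final (ψ : ℝ → V) : tail T ψ T = 0 := intervalIntegral.integral_same

theorem hasDerivAt_tail [CompleteSpace V] {ψ : ℝ → V} (hψ : Continuous ψ) (t : ℝ) :
    HasDerivAt (tail T ψ) (-ψ t) t :=
  intervalIntegral.integral_hasDerivAt_left (hψ.intervalIntegrable _ _)
    hψ.aestronglyMeasurable.stronglyMeasurableAtFilter hψ.continuousAt

theorem continuous_tail [CompleteSpace V] {ψ : ℝ → V} (hψ : Continuous ψ) :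
    Continuous (tail T ψ) :=
  continuous_iff_continuousAt.2 fun t => (hasDerivAt_tail hψ t).continuousAt

theorem tail_add {ψ φ : ℝ → V} (hψ : Continuous ψ) (hφ : Continuous φ) (t : ℝ) :
    tail T (ψ + φ) t = tail T ψ t + tail T φ t :=
  intervalIntegral.integral_add (hψ.intervalIntegrable _ _) (hφ.intervalIntegrable _ _)

theorem tail_smul (c : ℝ) (ψ : ℝ → V) (t : ℝ) : tail T (c • ψ) t = c • tail T ψ t :=
  intervalIntegral.integral_smul _ _

/-- The coercivity estimate behind the existence theorem: the space-time form
`∫ ((u, ψ)_H - ⟨A u, χ⟩) dt`, where `χ = ∫_t^T ψ`, is coercive at `u = e^{2 C₁ t} χ`. Indeed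
`(χ, ψ)_H = -(‖χ‖_H²)' / 2`, and the weight compensates for the lower order term of the coercivity
of `A`. -/
theorem coercive_tail [CompleteSpace V] (hT : 0 ≤ T) (ι : V →L[ℝ] H)
    {A : ℝ → V →L[ℝ] StrongDual ℝ V}
    (hA : ∀ v, AEStronglyMeasurable (fun t => A t v) (timeMeasure T)) {K δ C₁ : ℝ}
    (hK : ∀ t ∈ Icc 0 T, ‖A t‖ ≤ K) (hδ : 0 ≤ δ) (hC₁ : 0 ≤ C₁)
    (hcoer : ∀ t ∈ Icc 0 T, ∀ v, A t v v + δ * ‖v‖ ^ 2 ≤ C₁ * ‖ι v‖ ^ 2)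
    {ψ : ℝ → V} (hψ : Continuous ψ) :
    ‖ι (tail T ψ 0)‖ ^ 2 / 2 + δ * Real.exp (-(2 * C₁ * T)) *
        ∫ t, ‖Real.exp (2 * C₁ * t) • tail T ψ t‖ ^ 2 ∂(timeMeasure T) ≤
      ∫ t, (toDual ι (ι (Real.exp (2 * C₁ * t) • tail T ψ t)) (ψ t) -
        A t (Real.exp (2 * C₁ * t) • tail T ψ t) (tail T ψ t)) ∂(timeMeasure T) := by
  set χ := tail T ψ with hχ
  have hχc : Continuous χ := continuous_tail hψ
  have hφc : Continuous fun t => Real.exp (2 * C₁ * t) • χ t := by fun_prop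
  set E' : ℝ → ℝ := fun t => C₁ * Real.exp (2 * C₁ * t) * ‖ι (χ t)‖ ^ 2 -
    Real.exp (2 * C₁ * t) * inner ℝ (ι (χ t)) (ι (ψ t)) with hE'
  have hE'c : Continuous E' := by fun_prop
  -- `E'` is the derivative of `e^{2 C₁ t} ‖χ‖_H² / 2`, which vanishes at the time `T`
  have hE : ∀ t, HasDerivAt (fun t => Real.exp (2 * C₁ * t) * ‖ι (χ t)‖ ^ 2 / 2) (E' t) t := by
    intro t
    have h1 : HasDerivAt (fun t => ι (χ t)) (ι (-ψ t)) t :=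
      ι.hasFDerivAt.comp_hasDerivAt t (hasDerivAt_tail hψ t)
    have h2 : HasDerivAt (fun t => Real.exp (2 * C₁ * t)) (Real.exp (2 * C₁ * t) * (2 * C₁)) t := by
      have := ((hasDerivAt_id t).const_mul (2 * C₁)).exp
      simpa using this
    have h3 := (h2.mul h1.norm_sq).div_const 2
    refine h3.congr_deriv ?_
    rw [hE', map_neg, inner_neg_right]
    ring
  have hint : ∫ t, -E' t ∂(timeMeasure T) = ‖ι (χ 0)‖ ^ 2 / 2 := by
    rw [integral_timeMeasure hT, intervalIntegral.integral_neg,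
      intervalIntegral.integral_eq_sub_of_hasDerivAt (fun t _ => hE t)
        (hE'c.intervalIntegrable _ _), hχ, tail_final]
    simp
  have hAb : ∀ᵐ t ∂(timeMeasure T), ∀ v, ‖A t v‖ ≤ K * ‖v‖ := by
    filter_upwards [ae_timeMeasure_mem T] with t ht v
    exact (A t).le_of_opNorm_le (hK t (Ioo_subset_Icc_self ht)) v
  have hi1 : Integrable (fun t => ‖Real.exp (2 * C₁ * t) • χ t‖ ^ 2) (timeMeasure T) :=
    memLp_one_iff_integrable.1 (Continuous.memLp_timeMeasure (by fun_prop) 1)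
  have hi2 : Integrable (fun t => -E' t) (timeMeasure T) :=
    memLp_one_iff_integrable.1 (Continuous.memLp_timeMeasure hE'c.neg 1)
  have hi3 : Integrable (fun t => toDual ι (ι (Real.exp (2 * C₁ * t) • χ t)) (ψ t) -
        A t (Real.exp (2 * C₁ * t) • χ t) (χ t)) (timeMeasure T) := by
    refine Integrable.sub ?_ ?_
    · simp only [toDual_apply]
      exact memLp_one_iff_integrable.1 (Continuous.memLp_timeMeasure (by fun_prop) 1)
    · exact integrable_dual_apply (memLp_clm_apply hA hAb (Continuous.memLp_timeMeasure hφc 2))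
        (Continuous.memLp_timeMeasure hχc 2)
  rw [← hint, ← integral_const_mul, ← integral_add hi2 (hi1.const_mul _)]
  refine integral_mono_ae (hi2.add (hi1.const_mul _)) hi3 ?_
  filter_upwards [ae_timeMeasure_mem T] with t ht
  have h1 := hcoer t (Ioo_subset_Icc_self ht) (χ t)
  have h2 : Real.exp (-(2 * C₁ * T)) * Real.exp (2 * C₁ * t) ≤ 1 := by
    rw [← Real.exp_add, Real.exp_le_one_iff]
    nlinarith [ht.2]
  have h3 : 0 < Real.exp (2 * C₁ * t) := Real.exp_pos _
  simp only [hE', map_smul, toDual_apply, real_inner_smul_left,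
    _root_.smul_apply, smul_eq_mul, norm_smul, Real.norm_eq_abs, abs_of_pos h3]
  set e := Real.exp (2 * C₁ * t)
  have h4 : δ * Real.exp (-(2 * C₁ * T)) * (e * ‖χ t‖) ^ 2 ≤ δ * e * ‖χ t‖ ^ 2 := by
    have : δ * Real.exp (-(2 * C₁ * T)) * (e * ‖χ t‖) ^ 2 =
      (Real.exp (-(2 * C₁ * T)) * e) * (δ * e * ‖χ t‖ ^ 2) := by ring
    rw [this]
    exact mul_le_of_le_one_left (by positivity) h2
  have h5 := mul_le_mul_of_nonneg_left h1 h3.le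
  linarith

set_option maxHeartbeats 400000 in
/-- Lions' projection theorem for `u' = A u + F`, `u(0) = h₀`: there is `u ∈ L_2((0,T); V)` that
satisfies the equation tested with the functions `∫_t^T ψ`. -/
theorem exists_variationalSolution [CompleteSpace V] (hT : 0 < T) (ι : V →L[ℝ] H)
    {A : ℝ → V →L[ℝ] StrongDual ℝ V}
    (hA : ∀ v, AEStronglyMeasurable (fun t => A t v) (timeMeasure T)) {K δ C₁ : ℝ}
    (hK : ∀ t ∈ Icc 0 T, ‖A t‖ ≤ K) (hδ : 0 < δ) (hC₁ : 0 ≤ C₁)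
    (hcoer : ∀ t ∈ Icc 0 T, ∀ v, A t v v + δ * ‖v‖ ^ 2 ≤ C₁ * ‖ι v‖ ^ 2)
    (h₀ : H) {F : ℝ → StrongDual ℝ V} (hF : MemLp F 2 (timeMeasure T)) :
    ∃ u : Lp V 2 (timeMeasure T), ∀ ψ : C(ℝ, V),
      ∫ t, (toDual ι (ι (u t)) (ψ t) - A t (u t) (tail T ψ t)) ∂(timeMeasure T) =
        inner ℝ h₀ (ι (tail T ψ 0)) + ∫ t, F t (tail T ψ t) ∂(timeMeasure T) := by
  have hAb : ∀ᵐ t ∂(timeMeasure T), ∀ v, ‖A t v‖ ≤ K * ‖v‖ := by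
    filter_upwards [ae_timeMeasure_mem T] with t ht v
    exact (A t).le_of_opNorm_le (hK t (Ioo_subset_Icc_self ht)) v
  have hcψ : ∀ ψ : C(ℝ, V), MemLp ψ 2 (timeMeasure T) := fun ψ =>
    Continuous.memLp_timeMeasure ψ.continuous 2
  have hcχ : ∀ ψ : C(ℝ, V), MemLp (tail T ψ) 2 (timeMeasure T) := fun ψ =>
    Continuous.memLp_timeMeasure (continuous_tail ψ.continuous) 2
  have hAu : ∀ u : Lp V 2 (timeMeasure T), MemLp (fun t => A t (u t)) 2 (timeMeasure T) :=
    fun u => memLp_clm_apply hA hAb (Lp.memLp u)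
  have hιu : ∀ u : Lp V 2 (timeMeasure T),
      MemLp (fun t => toDual ι (ι (u t))) 2 (timeMeasure T) :=
    fun u => ((toDualL ι).comp ι).comp_memLp' (Lp.memLp u)
  have hint1 : ∀ (u : Lp V 2 (timeMeasure T)) (ψ : C(ℝ, V)),
      Integrable (fun t => toDual ι (ι (u t)) (ψ t)) (timeMeasure T) :=
    fun u ψ => integrable_dual_apply (hιu u) (hcψ ψ)
  have hint2 : ∀ (u : Lp V 2 (timeMeasure T)) (ψ : C(ℝ, V)),
      Integrable (fun t => A t (u t) (tail T ψ t)) (timeMeasure T) :=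
    fun u ψ => integrable_dual_apply (hAu u) (hcχ ψ)
  have hint : ∀ (u : Lp V 2 (timeMeasure T)) (ψ : C(ℝ, V)),
      Integrable (fun t => toDual ι (ι (u t)) (ψ t) - A t (u t) (tail T ψ t)) (timeMeasure T) :=
    fun u ψ => (hint1 u ψ).sub (hint2 u ψ)
  -- the space-time form as a functional of its first argument
  have hbound : ∀ ψ : C(ℝ, V), ∃ c : ℝ, ∀ u : Lp V 2 (timeMeasure T),
      ‖∫ t, (toDual ι (ι (u t)) (ψ t) - A t (u t) (tail T ψ t)) ∂(timeMeasure T)‖ ≤ c * ‖u‖ := by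
    intro ψ
    refine ⟨‖(toDualL ι).comp ι‖ * √(∫ t, ‖ψ t‖ ^ 2 ∂(timeMeasure T)) +
      |K| * √(∫ t, ‖tail T ψ t‖ ^ 2 ∂(timeMeasure T)), fun u => ?_⟩
    have hle : ∀ {φ : ℝ → StrongDual ℝ V} {k : ℝ}, MemLp φ 2 (timeMeasure T) → 0 ≤ k →
        (∀ᵐ t ∂(timeMeasure T), ‖φ t‖ ≤ k * ‖u t‖) →
        √(∫ t, ‖φ t‖ ^ 2 ∂(timeMeasure T)) ≤ k * ‖u‖ := by
      intro φ k hφ hk hφk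
      refine Real.sqrt_le_iff.2 ⟨by positivity, ?_⟩
      rw [mul_pow, norm_sq_Lp_two, ← integral_const_mul]
      refine integral_mono_ae hφ.norm.integrable_sq
        ((Lp.memLp u).norm.integrable_sq.const_mul _) ?_
      filter_upwards [hφk] with t ht
      rw [← mul_pow]
      exact pow_le_pow_left₀ (norm_nonneg _) ht 2
    have h1 := hle (hιu u) (norm_nonneg ((toDualL ι).comp ι))
      (ae_of_all _ fun t => ((toDualL ι).comp ι).le_opNorm (u t))
    have h2 := hle (hAu u) (abs_nonneg K) (by
      filter_upwards [hAb] with t ht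
      exact (ht _).trans (by gcongr; exact le_abs_self K))
    rw [integral_sub (hint1 u ψ) (hint2 u ψ)]
    refine (norm_sub_le _ _).trans ?_
    rw [Real.norm_eq_abs, Real.norm_eq_abs]
    have h3 := abs_integral_dual_apply_le (hιu u) (hcψ ψ)
    have h4 := abs_integral_dual_apply_le (hAu u) (hcχ ψ)
    have h5 := mul_le_mul_of_nonneg_right h1 (Real.sqrt_nonneg (∫ t, ‖ψ t‖ ^ 2 ∂(timeMeasure T)))
    have h6 := mul_le_mul_of_nonneg_right h2
      (Real.sqrt_nonneg (∫ t, ‖tail T ψ t‖ ^ 2 ∂(timeMeasure T)))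
    linarith
  choose c hc using hbound
  let ℓ : C(ℝ, V) → StrongDual ℝ (Lp V 2 (timeMeasure T)) := fun ψ =>
    LinearMap.mkContinuous
      { toFun := fun u =>
          ∫ t, (toDual ι (ι (u t)) (ψ t) - A t (u t) (tail T ψ t)) ∂(timeMeasure T)
        map_add' := fun u v => by
          rw [← integral_add (hint u ψ) (hint v ψ)]
          refine integral_congr_ae ?_
          filter_upwards [Lp.coeFn_add u v] with t ht
          rw [ht]
          simp only [Pi.add_apply, map_add, toDual_apply, inner_add_left,
            _root_.add_apply]
          ring
        map_smul' := fun a u => by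
          rw [RingHom.id_apply, smul_eq_mul, ← integral_const_mul]
          refine integral_congr_ae ?_
          filter_upwards [Lp.coeFn_smul a u] with t ht
          rw [ht]
          simp only [Pi.smul_apply, map_smul, toDual_apply, real_inner_smul_left,
            _root_.smul_apply, smul_eq_mul]
          ring } (c ψ) (hc ψ)
  have hℓ : ∀ ψ u, ℓ ψ u =
      ∫ t, (toDual ι (ι (u t)) (ψ t) - A t (u t) (tail T ψ t)) ∂(timeMeasure T) :=
    fun _ _ => rfl
  let Kl : C(ℝ, V) →ₗ[ℝ] StrongDual ℝ (Lp V 2 (timeMeasure T)) :=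
    { toFun := ℓ
      map_add' := fun ψ φ => by
        ext u
        rw [_root_.add_apply, hℓ, hℓ, hℓ, ← integral_add (hint u ψ) (hint u φ)]
        refine integral_congr_ae (ae_of_all _ fun t => ?_)
        simp only [ContinuousMap.coe_add, Pi.add_apply, map_add,
          tail_add ψ.continuous φ.continuous]
        ring
      map_smul' := fun a ψ => by
        ext u
        rw [RingHom.id_apply, _root_.smul_apply, hℓ, hℓ, smul_eq_mul,
          ← integral_const_mul]
        refine integral_congr_ae (ae_of_all _ fun t => ?_)
        simp only [ContinuousMap.coe_smul, Pi.smul_apply, map_smul, tail_smul, smul_eq_mul]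
        ring }
  let L : C(ℝ, V) →ₗ[ℝ] ℝ :=
    { toFun := fun ψ => inner ℝ h₀ (ι (tail T ψ 0)) + ∫ t, F t (tail T ψ t) ∂(timeMeasure T)
      map_add' := fun ψ φ => by
        simp only [ContinuousMap.coe_add, tail_add ψ.continuous φ.continuous, map_add,
          inner_add_right]
        rw [integral_add (integrable_dual_apply hF (hcχ ψ)) (integrable_dual_apply hF (hcχ φ))]
        ring
      map_smul' := fun a ψ => by
        simp only [ContinuousMap.coe_smul, tail_smul, map_smul, inner_smul_right, smul_eq_mul,
          integral_const_mul, RingHom.id_apply]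
        ring }
  -- testing the form with `e^{2 C₁ t} ∫_t^T ψ` bounds the right-hand side by the norm of the form
  set κ : ℝ := δ * Real.exp (-(2 * C₁ * T)) with hκ
  have hκ0 : 0 < κ := by positivity
  set f : ℝ := √(∫ t, ‖F t‖ ^ 2 ∂(timeMeasure T)) with hf
  have hLK : ∀ ψ, |L ψ| ≤ (‖h₀‖ * √(2 / κ) + f / κ) * ‖Kl ψ‖ := by
    intro ψ
    have hφm : MemLp (fun t => Real.exp (2 * C₁ * t) • tail T ψ t) 2 (timeMeasure T) :=
      Continuous.memLp_timeMeasure (by have := continuous_tail (T := T) ψ.continuous; fun_prop) 2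
    have hco := coercive_tail hT.le ι hA hK hδ.le hC₁ hcoer ψ.continuous
    set φ : Lp V 2 (timeMeasure T) := hφm.toLp with hφ
    have e1 : Kl ψ φ = ∫ t, (toDual ι (ι (Real.exp (2 * C₁ * t) • tail T ψ t)) (ψ t) -
        A t (Real.exp (2 * C₁ * t) • tail T ψ t) (tail T ψ t)) ∂(timeMeasure T) := by
      change ℓ ψ φ = _
      rw [hℓ]
      refine integral_congr_ae ?_
      filter_upwards [hφm.coeFn_toLp] with t ht
      rw [ht]
    have e2 : ‖φ‖ ^ 2 = ∫ t, ‖Real.exp (2 * C₁ * t) • tail T ψ t‖ ^ 2 ∂(timeMeasure T) := by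
      rw [norm_sq_Lp_two]
      refine integral_congr_ae ?_
      filter_upwards [hφm.coeFn_toLp] with t ht
      rw [ht]
    rw [← e1, ← e2, ← hκ] at hco
    have h1 : Kl ψ φ ≤ ‖Kl ψ‖ * ‖φ‖ := (le_abs_self _).trans ((Kl ψ).le_opNorm φ)
    have h2 : κ * ‖φ‖ ≤ ‖Kl ψ‖ := by
      rcases (norm_nonneg φ).eq_or_lt with h0 | h0
      · rw [← h0, mul_zero]
        positivity
      · refine le_of_mul_le_mul_right ?_ h0
        nlinarith [sq_nonneg ‖ι (tail T ψ 0)‖]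
    have h3 : ‖φ‖ ≤ ‖Kl ψ‖ / κ := by
      rw [le_div_iff₀ hκ0, mul_comm]
      exact h2
    have h4 : ‖ι (tail T ψ 0)‖ ≤ √(2 / κ) * ‖Kl ψ‖ := by
      refine abs_le_of_sq_le_sq' ?_ (by positivity) |>.2
      rw [mul_pow, Real.sq_sqrt (by positivity)]
      have h5 : ‖Kl ψ‖ * ‖φ‖ ≤ ‖Kl ψ‖ * (‖Kl ψ‖ / κ) := by gcongr
      have h6 : 2 / κ * ‖Kl ψ‖ ^ 2 = 2 * (‖Kl ψ‖ * (‖Kl ψ‖ / κ)) := by ring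
      rw [h6]
      nlinarith [mul_nonneg hκ0.le (sq_nonneg ‖φ‖)]
    have h5 : √(∫ t, ‖tail T ψ t‖ ^ 2 ∂(timeMeasure T)) ≤ ‖φ‖ := by
      refine Real.sqrt_le_iff.2 ⟨norm_nonneg _, ?_⟩
      rw [e2]
      refine integral_mono_ae (hcχ ψ).norm.integrable_sq hφm.norm.integrable_sq ?_
      filter_upwards [ae_timeMeasure_mem T] with t ht
      refine pow_le_pow_left₀ (norm_nonneg _) ?_ 2
      rw [norm_smul, Real.norm_of_nonneg (Real.exp_pos _).le]
      refine le_mul_of_one_le_left (norm_nonneg _) (Real.one_le_exp ?_)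
      have := ht.1
      positivity
    have h6 : |L ψ| ≤ ‖h₀‖ * ‖ι (tail T ψ 0)‖ + f * ‖φ‖ := by
      refine (abs_add_le _ _).trans (add_le_add (abs_real_inner_le_norm _ _) ?_)
      refine (abs_integral_dual_apply_le hF (hcχ ψ)).trans ?_
      gcongr
    calc |L ψ| ≤ ‖h₀‖ * (√(2 / κ) * ‖Kl ψ‖) + f * (‖Kl ψ‖ / κ) := by
          refine h6.trans ?_
          gcongr
      _ = _ := by ring
  exact exists_apply_eq_of_abs_le Kl L _ hLK

/-- The lemma of du Bois-Reymond: the weak formulation, tested with `θ(t) v`, determines the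
function almost everywhere. -/
theorem ae_eq_add_integral_of_forall_integral_eq (hT : 0 < T) {u G : ℝ → StrongDual ℝ V}
    (hu : Integrable u (timeMeasure T)) (hG : Integrable G (timeMeasure T)) (x₀ : StrongDual ℝ V)
    (h : ∀ θ : ℝ → ℝ, Continuous θ → ∀ v, ∫ t, θ t * u t v ∂(timeMeasure T) =
      x₀ v * (∫ t in (0 : ℝ)..T, θ t) + ∫ s in (0 : ℝ)..T, G s v * ∫ r in s..T, θ r) :
    ∀ᵐ t ∂(timeMeasure T), u t = x₀ + ∫ s in (0 : ℝ)..t, G s := by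
  have hG' := (intervalIntegrable_iff_timeMeasure hT.le).2 hG
  set D : ℝ → StrongDual ℝ V := fun t => u t - (x₀ + ∫ s in (0 : ℝ)..t, G s) with hD
  have hDi : Integrable D (timeMeasure T) := by
    refine hu.sub ((integrable_const _).add ?_)
    have h2 := intervalIntegral.continuousOn_primitive_interval' hG' left_mem_uIcc
    rw [uIcc_of_le hT.le] at h2
    exact IntegrableOn.mono_set h2.integrableOn_Icc Ioo_subset_Icc_self
  have hD0 : ∀ᵐ t, (Ioo 0 T).indicator D t = 0 := by
    refine ae_eq_zero_of_integral_contDiff_smul_eq_zero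
      ((integrable_indicator_iff measurableSet_Ioo).2
        (show IntegrableOn D (Ioo 0 T) volume from hDi)).locallyIntegrable fun θ hθ hθs => ?_
    have hθc : Continuous θ := hθ.continuous
    have e0 : (fun t => θ t • (Ioo 0 T).indicator D t) = (Ioo 0 T).indicator fun t => θ t • D t := by
      ext1 t
      by_cases ht : t ∈ Ioo 0 T
      · rw [indicator_of_mem ht, indicator_of_mem ht]
      · rw [indicator_of_notMem ht, indicator_of_notMem ht, smul_zero]
    rw [e0, integral_indicator measurableSet_Ioo]
    obtain ⟨C, hC⟩ := hθs.exists_bound_of_continuous hθc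
    have hθD : Integrable (fun t => θ t • D t) (timeMeasure T) :=
      hDi.bdd_smul C hθc.aestronglyMeasurable (ae_of_all _ hC)
    have hθu : Integrable (fun t => θ t • u t) (timeMeasure T) :=
      hu.bdd_smul C hθc.aestronglyMeasurable (ae_of_all _ hC)
    refine ContinuousLinearMap.ext fun v => ?_
    have e4 := ContinuousLinearMap.integral_apply hθD v
    refine e4.trans ?_
    rw [_root_.zero_apply]
    have hGv : IntervalIntegrable (fun s => G s v) volume 0 T :=
      (intervalIntegrable_iff_timeMeasure hT.le).2 (hG.apply_continuousLinearMap v)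
    have hi1 : Integrable (fun r => x₀ v * θ r) (timeMeasure T) :=
      memLp_one_iff_integrable.1 (Continuous.memLp_timeMeasure (by fun_prop) 1)
    have hi2 : Integrable (fun r => (∫ s in (0 : ℝ)..r, G s v) * θ r) (timeMeasure T) := by
      rw [← intervalIntegrable_iff_timeMeasure hT.le]
      have h2 := intervalIntegral.continuousOn_primitive_interval' hGv left_mem_uIcc
      exact (h2.mul hθc.continuousOn).intervalIntegrable
    have e3 : ∀ᵐ t ∂(timeMeasure T), (θ t • D t) v = θ t * u t v -
        (x₀ v * θ t + (∫ s in (0 : ℝ)..t, G s v) * θ t) := by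
      filter_upwards [ae_timeMeasure_mem T] with t ht
      have hGt : IntervalIntegrable G volume 0 t :=
        Integrable.intervalIntegrable_of_mem hG ⟨le_rfl, hT.le⟩ (Ioo_subset_Icc_self ht)
      have e5 := ContinuousLinearMap.intervalIntegral_apply hGt v
      rw [hD, _root_.smul_apply, _root_.sub_apply, _root_.add_apply, e5, smul_eq_mul]
      ring
    have hi3 : Integrable (fun t => θ t * u t v) (timeMeasure T) :=
      hθu.apply_continuousLinearMap v
    have hi12 : Integrable (fun r => x₀ v * θ r + (∫ s in (0 : ℝ)..r, G s v) * θ r)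
        (timeMeasure T) := hi1.add hi2
    rw [integral_congr_ae e3, integral_sub hi3 hi12, h θ hθc v, integral_add hi1 hi2,
      integral_mul_integral_Ici hGv (hθc.intervalIntegrable _ _), integral_timeMeasure hT.le,
      integral_timeMeasure hT.le, intervalIntegral.integral_const_mul, sub_self]
  rw [ae_restrict_iff' measurableSet_Ioo]
  filter_upwards [hD0] with t ht htT
  rw [indicator_of_mem htT] at ht
  exact sub_eq_zero.1 ht

/-- The existence of a solution of `u' = A u + F`, `u(0) = h₀`, in the integrated form. -/
theorem exists_weakSolution [CompleteSpace V] (hT : 0 < T) (ι : V →L[ℝ] H)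
    {A : ℝ → V →L[ℝ] StrongDual ℝ V}
    (hA : ∀ v, AEStronglyMeasurable (fun t => A t v) (timeMeasure T)) {K δ C₁ : ℝ}
    (hK : ∀ t ∈ Icc 0 T, ‖A t‖ ≤ K) (hδ : 0 < δ) (hC₁ : 0 ≤ C₁)
    (hcoer : ∀ t ∈ Icc 0 T, ∀ v, A t v v + δ * ‖v‖ ^ 2 ≤ C₁ * ‖ι v‖ ^ 2)
    (h₀ : H) {F : ℝ → StrongDual ℝ V} (hF : MemLp F 2 (timeMeasure T)) :
    ∃ u : ℝ → V, MemLp u 2 (timeMeasure T) ∧ ∀ᵐ t ∂(timeMeasure T),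
      toDual ι (ι (u t)) = toDual ι h₀ + ∫ s in (0 : ℝ)..t, (A s (u s) + F s) := by
  have hAb : ∀ᵐ t ∂(timeMeasure T), ∀ v, ‖A t v‖ ≤ K * ‖v‖ := by
    filter_upwards [ae_timeMeasure_mem T] with t ht v
    exact (A t).le_of_opNorm_le (hK t (Ioo_subset_Icc_self ht)) v
  obtain ⟨u, hu⟩ := exists_variationalSolution hT ι hA hK hδ hC₁ hcoer h₀ hF
  have hAu : MemLp (fun t => A t (u t)) 2 (timeMeasure T) := memLp_clm_apply hA hAb (Lp.memLp u)
  have hιu : MemLp (fun t => toDual ι (ι (u t))) 2 (timeMeasure T) :=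
    ((toDualL ι).comp ι).comp_memLp' (Lp.memLp u)
  have hG : MemLp (fun s => A s (u s) + F s) 2 (timeMeasure T) := memLp_fun_add hAu hF
  refine ⟨u, Lp.memLp u, ?_⟩
  refine ae_eq_add_integral_of_forall_integral_eq (u := fun t => toDual ι (ι (u t)))
    (G := fun s => A s (u s) + F s) hT
    (hιu.integrable (by norm_num)) (hG.integrable (by norm_num)) (toDual ι h₀) ?_
  -- the test functions `θ(t) v` suffice
  intro θ hθ v
  let ψ : C(ℝ, V) := ⟨fun t => θ t • v, by fun_prop⟩
  have hψm : MemLp ψ 2 (timeMeasure T) := Continuous.memLp_timeMeasure ψ.continuous 2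
  have hχm : MemLp (tail T ψ) 2 (timeMeasure T) :=
    Continuous.memLp_timeMeasure (continuous_tail ψ.continuous) 2
  have hψ := hu ψ
  have hχ : ∀ t, tail T ψ t = (∫ r in t..T, θ r) • v := fun t =>
    intervalIntegral.integral_smul_const _ _
  rw [integral_sub (integrable_dual_apply hιu hψm) (integrable_dual_apply hAu hχm),
    sub_eq_iff_eq_add, add_assoc,
    ← integral_add (integrable_dual_apply hF hχm) (integrable_dual_apply hAu hχm)] at hψ
  have e1 : ∫ t, θ t * toDual ι (ι (u t)) v ∂(timeMeasure T) =
      ∫ t, toDual ι (ι (u t)) (ψ t) ∂(timeMeasure T) := by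
    refine integral_congr_ae (ae_of_all _ fun t => ?_)
    change _ = toDual ι (ι (u t)) (θ t • v)
    rw [map_smul, smul_eq_mul]
  rw [e1, hψ, integral_timeMeasure hT.le, hχ, map_smul, inner_smul_right, toDual_apply, mul_comm]
  congr 1
  refine intervalIntegral.integral_congr fun t _ => ?_
  simp only [hχ, map_smul, smul_eq_mul, _root_.add_apply]
  ring

end Existence

/-! ### Absolutely continuous functions -/

section AC

theorem absolutelyContinuousOnInterval_of_dist_le {X Y : Type*} [PseudoMetricSpace X]
    [PseudoMetricSpace Y] {f : ℝ → X} {g : ℝ → Y} {a b C : ℝ}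
    (hg : AbsolutelyContinuousOnInterval g a b)
    (h : ∀ x ∈ uIcc a b, ∀ y ∈ uIcc a b, dist (f x) (f y) ≤ C * dist (g x) (g y)) :
    AbsolutelyContinuousOnInterval f a b := by
  rw [absolutelyContinuousOnInterval_iff] at hg ⊢
  intro ε hε
  obtain ⟨δ, hδ, hgδ⟩ := hg (ε / (|C| + 1)) (by positivity)
  refine ⟨δ, hδ, fun E hE hEδ => ?_⟩
  have h1 := hgδ E hE hEδ
  rw [lt_div_iff₀ (by positivity)] at h1
  refine lt_of_le_of_lt ?_ h1
  rw [Finset.sum_mul]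
  refine Finset.sum_le_sum fun i hi => ?_
  have h2 := hE.1 i hi
  refine (h _ h2.1 _ h2.2).trans ?_
  rw [mul_comm]
  gcongr
  linarith [le_abs_self C]

theorem absolutelyContinuousOnInterval_integral {E : Type*} [NormedAddCommGroup E]
    [NormedSpace ℝ E] {f : ℝ → E} {a b : ℝ} (hf : IntervalIntegrable f volume a b) :
    AbsolutelyContinuousOnInterval (fun x => ∫ t in a..x, f t) a b := by
  refine absolutelyContinuousOnInterval_of_dist_le (C := 1)
    (hf.norm.absolutelyContinuousOnInterval_intervalIntegral (c := a) left_mem_uIcc) ?_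
  intro x hx y hy
  have h1 : ∀ z ∈ uIcc a b, IntervalIntegrable f volume a z := fun z hz =>
    hf.mono_set (uIcc_subset_uIcc left_mem_uIcc hz)
  rw [one_mul, dist_eq_norm, Real.dist_eq,
    intervalIntegral.integral_interval_sub_left (h1 x hx) (h1 y hy),
    intervalIntegral.integral_interval_sub_left (h1 x hx).norm (h1 y hy).norm]
  exact intervalIntegral.norm_integral_le_abs_integral_norm

/-- The fundamental theorem of calculus for an absolutely continuous function whose derivative is
known almost everywhere. -/
theorem integral_eq_sub_of_ae_hasDerivAt {f f' : ℝ → ℝ} {a b : ℝ}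
    (hf : AbsolutelyContinuousOnInterval f a b)
    (h : ∀ᵐ t, t ∈ uIcc a b → HasDerivAt f (f' t) t) :
    ∫ t in a..b, f' t = f b - f a := by
  rw [← hf.integral_deriv_eq_sub]
  refine intervalIntegral.integral_congr_ae ?_
  filter_upwards [h] with t ht htab
  exact (ht (uIoc_subset_uIcc htab)).deriv.symm

end AC

/-! ### Regularization in a normal triple -/

section Triple

variable {V H : Type*} [NormedAddCommGroup V] [InnerProductSpace ℝ V] [CompleteSpace V]
  [NormedAddCommGroup H] [InnerProductSpace ℝ H]

/-- The operators `(ι^* ι + ε)⁻¹ : V' → V`, which regularize the embedding `V ↪ H ↪ V'`. -/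
theorem exists_resolvent (ι : V →L[ℝ] H) {ε : ℝ} (hε : 0 < ε) :
    ∃ R : StrongDual ℝ V →L[ℝ] V, ∀ F v,
      inner ℝ (ι (R F)) (ι v) + ε * inner ℝ (R F) v = F v := by
  let B : V →L[ℝ] V →L[ℝ] ℝ :=
    (toDualL ι).comp ι + ε • toDualL (ContinuousLinearMap.id ℝ V)
  have hB : ∀ v w, B v w = inner ℝ (ι v) (ι w) + ε * inner ℝ v w := fun v w => rfl
  have hco : IsCoercive B := by
    refine ⟨ε, hε, fun v => ?_⟩
    rw [hB, real_inner_self_eq_norm_mul_norm, real_inner_self_eq_norm_mul_norm]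
    nlinarith [mul_self_nonneg ‖ι v‖]
  let e := hco.continuousLinearEquivOfBilin
  have he : ∀ v w, inner ℝ (e v) w = B v w := hco.continuousLinearEquivOfBilin_apply
  have hex : ∀ F : StrongDual ℝ V, ∃ w, ∀ v, B w v = F v := fun F =>
    ⟨e.symm ((InnerProductSpace.toDual ℝ V).symm F), fun v => by
      rw [← he, ContinuousLinearEquiv.apply_symm_apply, InnerProductSpace.toDual_symm_apply]⟩
  choose r hr using hex
  have huniq : ∀ w w', (∀ v, B w v = B w' v) → w = w' := fun w w' h => by
    refine e.injective (ext_inner_right ℝ fun v => ?_)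
    rw [he, he, h]
  refine ⟨LinearMap.mkContinuous
    { toFun := r
      map_add' := fun F G => huniq _ _ fun v => by
        rw [hr, map_add, _root_.add_apply, _root_.add_apply, hr, hr]
      map_smul' := fun c F => huniq _ _ fun v => by
        rw [hr, map_smul, RingHom.id_apply, _root_.smul_apply, _root_.smul_apply, hr] } (1 / ε)
      fun F => ?_, fun F v => hr F v⟩
  change ‖r F‖ ≤ _
  rcases (norm_nonneg (r F)).eq_or_lt with h0 | h0
  · rw [← h0]
    positivity
  · have h1 : ε * ‖r F‖ * ‖r F‖ ≤ ‖F‖ * ‖r F‖ := by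
      refine le_trans ?_ ((le_abs_self _).trans (F.le_opNorm (r F)))
      rw [← hr F, hB, real_inner_self_eq_norm_mul_norm, real_inner_self_eq_norm_mul_norm]
      nlinarith [mul_self_nonneg ‖ι (r F)‖]
    have h2 := le_of_mul_le_mul_right h1 h0
    rw [one_div, inv_mul_eq_div, le_div_iff₀ hε, mul_comm]
    exact h2

/-- A choice of the operators `(ι^* ι + 1 / (n + 1))⁻¹`. -/
def resolvent (ι : V →L[ℝ] H) (n : ℕ) : StrongDual ℝ V →L[ℝ] V :=
  (exists_resolvent ι (Nat.one_div_pos_of_nat (α := ℝ) (n := n))).choose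

theorem resolvent_spec (ι : V →L[ℝ] H) (n : ℕ) (F : StrongDual ℝ V) (v : V) :
    inner ℝ (ι (resolvent ι n F)) (ι v) + 1 / ((n : ℝ) + 1) * inner ℝ (resolvent ι n F) v = F v :=
  (exists_resolvent ι (Nat.one_div_pos_of_nat (α := ℝ) (n := n))).choose_spec F v

theorem resolvent_symm (ι : V →L[ℝ] H) (n : ℕ) (F G : StrongDual ℝ V) :
    F (resolvent ι n G) = G (resolvent ι n F) := by
  rw [← resolvent_spec ι n F, ← resolvent_spec ι n G, real_inner_comm, real_inner_comm
    (resolvent ι n F)]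

theorem norm_resolvent_le (ι : V →L[ℝ] H) (n : ℕ) (v : V) :
    ‖resolvent ι n (toDual ι (ι v))‖ ≤ ‖v‖ := by
  set w := resolvent ι n (toDual ι (ι v))
  have hε : (0 : ℝ) < 1 / ((n : ℝ) + 1) := Nat.one_div_pos_of_nat
  have h1 : inner ℝ (ι w) (ι (w - v)) + 1 / ((n : ℝ) + 1) * inner ℝ w (w - v) =
    inner ℝ (ι v) (ι (w - v)) := resolvent_spec ι n (toDual ι (ι v)) (w - v)
  have h2 : inner ℝ (ι (w - v)) (ι (w - v)) + 1 / ((n : ℝ) + 1) * inner ℝ w (w - v) = 0 := by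
    have h5 : inner ℝ (ι (w - v)) (ι (w - v)) =
        inner ℝ (ι w) (ι (w - v)) - inner ℝ (ι v) (ι (w - v)) := by
      rw [← inner_sub_left, ← map_sub]
    linarith
  have h3 : inner ℝ w (w - v) ≤ 0 := by
    have := real_inner_self_nonneg (x := ι (w - v))
    by_contra hc
    have := mul_pos hε (not_le.1 hc)
    linarith
  rw [inner_sub_right, real_inner_self_eq_norm_mul_norm] at h3
  have h4 := real_inner_le_norm w v
  rcases (norm_nonneg w).eq_or_lt with h0 | h0
  · rw [← h0]
    positivity
  · exact le_of_mul_le_mul_left (by linarith) h0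

/-- The energy of the regularization of `h ∈ H ⊂ V'` converges to `‖h‖²`. -/
theorem tendsto_apply_resolvent {ι : V →L[ℝ] H} (hd : DenseRange ι) (h : H) :
    Tendsto (fun n => toDual ι h (resolvent ι n (toDual ι h))) atTop (𝓝 (‖h‖ ^ 2)) := by
  have hlim : Tendsto (fun n => ι (resolvent ι n (toDual ι h))) atTop (𝓝 h) := by
    rw [tendsto_iff_norm_sub_tendsto_zero, Metric.tendsto_atTop]
    intro r hr
    -- approximate `h` by `ι v`
    obtain ⟨v, hv⟩ := hd.exists_dist_lt h (show 0 < r ^ 2 / (4 * (‖h‖ + 1)) by positivity)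
    have hlim0 : Tendsto (fun n : ℕ => 1 / ((n : ℝ) + 1) * ‖v‖ ^ 2) atTop (𝓝 0) := by
      simpa using (tendsto_one_div_add_atTop_nhds_zero_nat (𝕜 := ℝ)).mul_const (‖v‖ ^ 2)
    obtain ⟨N, hN⟩ := (hlim0.eventually_lt_const
      (show 0 < r ^ 2 / 2 by positivity)).exists_forall_of_atTop
    refine ⟨N, fun n hn => ?_⟩
    have hε : (0 : ℝ) < 1 / ((n : ℝ) + 1) := Nat.one_div_pos_of_nat
    set ε : ℝ := 1 / ((n : ℝ) + 1) with hεdef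
    set w := resolvent ι n (toDual ι h) with hw
    have h1 : inner ℝ (ι w) (ι w) + ε * inner ℝ w w = inner ℝ h (ι w) :=
      resolvent_spec ι n (toDual ι h) w
    have h2 : inner ℝ (ι w) (ι v) + ε * inner ℝ w v = inner ℝ h (ι v) :=
      resolvent_spec ι n (toDual ι h) v
    rw [real_inner_self_eq_norm_sq, real_inner_self_eq_norm_sq] at h1
    have h3 : ‖ι w‖ ≤ ‖h‖ := by
      have h4 := real_inner_le_norm h (ι w)
      rcases (norm_nonneg (ι w)).eq_or_lt with h0 | h0
      · rw [← h0]
        positivity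
      · refine le_of_mul_le_mul_right ?_ h0
        nlinarith [mul_nonneg hε.le (sq_nonneg ‖w‖)]
    -- the resolvent equation tested with `w` and with `v`
    have h5 : ‖ι w - h‖ ^ 2 = -(ε * ‖w‖ ^ 2) + ε * inner ℝ w v
        - inner ℝ (ι w - h) (h - ι v) := by
      rw [← real_inner_self_eq_norm_sq]
      simp only [inner_sub_left, inner_sub_right, real_inner_self_eq_norm_sq]
      rw [real_inner_comm (ι w) h] at *
      linarith
    have h6 : ε * inner ℝ w v ≤ ε * ‖w‖ ^ 2 + ε * ‖v‖ ^ 2 := by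
      rw [← mul_add]
      refine mul_le_mul_of_nonneg_left ?_ hε.le
      have := real_inner_le_norm w v
      nlinarith [sq_nonneg (‖w‖ - ‖v‖), sq_nonneg ‖w‖, sq_nonneg ‖v‖]
    have h7 : -inner ℝ (ι w - h) (h - ι v) ≤ r ^ 2 / 2 := by
      have h8 := neg_le_of_abs_le (abs_real_inner_le_norm (ι w - h) (h - ι v))
      have h9 : ‖ι w - h‖ ≤ 2 * ‖h‖ := (norm_sub_le _ _).trans (by linarith)
      rw [dist_eq_norm] at hv
      have h10 : ‖ι w - h‖ * ‖h - ι v‖ ≤ 2 * ‖h‖ * (r ^ 2 / (4 * (‖h‖ + 1))) := by gcongr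
      have h11 : 2 * ‖h‖ * (r ^ 2 / (4 * (‖h‖ + 1))) ≤ r ^ 2 / 2 := by
        rw [mul_div_assoc', div_le_div_iff₀ (by positivity) (by positivity)]
        nlinarith [norm_nonneg h, sq_nonneg r]
      linarith
    have h12 := hN n hn
    rw [dist_zero_right, norm_norm]
    refine lt_of_pow_lt_pow_left₀ 2 hr.le ?_
    linarith
  have h2 : Tendsto (fun n => inner ℝ h (ι (resolvent ι n (toDual ι h)))) atTop
      (𝓝 (inner ℝ h h)) :=
    tendsto_const_nhds.inner hlim
  rw [real_inner_self_eq_norm_sq] at h2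
  exact h2

/-- The regularization of `v ∈ V ⊂ V'` converges to `v` in `V`. -/
theorem tendsto_resolvent [CompleteSpace H] {ι : V →L[ℝ] H} (hι : Function.Injective ι) (v : V) :
    Tendsto (fun n => resolvent ι n (toDual ι (ι v))) atTop (𝓝 v) := by
  -- the range of the adjoint is dense because `ι` is injective; approximate `v` by `ι^* h`
  have hdense : DenseRange (ContinuousLinearMap.adjoint ι) := by
    have h1 : (ContinuousLinearMap.adjoint ι).range.topologicalClosure = ⊤ := by
      rw [Submodule.topologicalClosure_eq_top_iff, Submodule.eq_bot_iff]
      intro x hx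
      refine hι (ext_inner_left ℝ fun h => ?_)
      rw [map_zero, inner_zero_right, ← ContinuousLinearMap.adjoint_inner_left]
      exact hx _ ⟨h, rfl⟩
    intro x
    have h2 : x ∈ (ContinuousLinearMap.adjoint ι).range.topologicalClosure :=
      h1 ▸ Submodule.mem_top
    exact h2
  rw [tendsto_iff_norm_sub_tendsto_zero, Metric.tendsto_atTop]
  intro r hr
  obtain ⟨h, hh⟩ := hdense.exists_dist_lt v (show 0 < r ^ 2 / (4 * (‖v‖ + 1)) by positivity)
  have hlim0 : Tendsto (fun n : ℕ => 1 / ((n : ℝ) + 1) * (2 * ‖v‖ ^ 2 * ‖h‖ ^ 2)) atTop (𝓝 0) := by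
    simpa using (tendsto_one_div_add_atTop_nhds_zero_nat (𝕜 := ℝ)).mul_const
      (2 * ‖v‖ ^ 2 * ‖h‖ ^ 2)
  obtain ⟨N, hN⟩ := (hlim0.eventually_lt_const
    (show 0 < (r ^ 2 / 2) ^ 2 by positivity)).exists_forall_of_atTop
  refine ⟨N, fun n hn => ?_⟩
  have hε : (0 : ℝ) < 1 / ((n : ℝ) + 1) := Nat.one_div_pos_of_nat
  have hwv := norm_resolvent_le ι n v
  set ε : ℝ := 1 / ((n : ℝ) + 1) with hεdef
  set w := resolvent ι n (toDual ι (ι v)) with hw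
  have h1 : inner ℝ (ι w) (ι (w - v)) + ε * inner ℝ w (w - v) = inner ℝ (ι v) (ι (w - v)) :=
    resolvent_spec ι n (toDual ι (ι v)) (w - v)
  have h2 : ‖ι (w - v)‖ ^ 2 ≤ ε * (2 * ‖v‖ ^ 2) := by
    have h5 : ‖ι (w - v)‖ ^ 2 = inner ℝ (ι w) (ι (w - v)) - inner ℝ (ι v) (ι (w - v)) := by
      rw [← inner_sub_left, ← map_sub, real_inner_self_eq_norm_sq]
    have h6 : ‖w - v‖ ≤ 2 * ‖v‖ := (norm_sub_le _ _).trans (by linarith)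
    have h7 := neg_le_of_abs_le (abs_real_inner_le_norm w (w - v))
    have h8 : ‖w‖ * ‖w - v‖ ≤ ‖v‖ * (2 * ‖v‖) := by gcongr
    have h9 : -inner ℝ w (w - v) ≤ 2 * ‖v‖ ^ 2 := by nlinarith
    nlinarith
  have h3 : inner ℝ h (ι (v - w)) ≤ r ^ 2 / 2 := by
    refine (real_inner_le_norm _ _).trans (abs_le_of_sq_le_sq' ?_ (by positivity)).2
    have h4 := hN n hn
    have h5 : ‖ι (v - w)‖ = ‖ι (w - v)‖ := by rw [← neg_sub, map_neg, norm_neg]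
    rw [mul_pow, h5]
    nlinarith [mul_le_mul_of_nonneg_left h2 (sq_nonneg ‖h‖)]
  have h4 : inner ℝ (v - ContinuousLinearMap.adjoint ι h) (v - w) < r ^ 2 / 2 := by
    rw [dist_eq_norm] at hh
    have h5 : ‖v - w‖ ≤ 2 * ‖v‖ := (norm_sub_le _ _).trans (by linarith)
    have h6 : ‖v - ContinuousLinearMap.adjoint ι h‖ * ‖v - w‖ ≤
        r ^ 2 / (4 * (‖v‖ + 1)) * (2 * ‖v‖) := by gcongr
    have h7 : r ^ 2 / (4 * (‖v‖ + 1)) * (2 * ‖v‖) < r ^ 2 / 2 := by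
      rw [div_mul_eq_mul_div, div_lt_div_iff₀ (by positivity) (by positivity)]
      have := norm_nonneg v
      have h8 : 0 < r ^ 2 := by positivity
      nlinarith
    exact ((real_inner_le_norm _ _).trans h6).trans_lt h7
  rw [dist_zero_right, norm_norm]
  refine lt_of_pow_lt_pow_left₀ 2 hr.le ?_
  have h5 : ‖w - v‖ ^ 2 = ‖w‖ ^ 2 - inner ℝ w v + inner ℝ v (v - w) := by
    rw [← real_inner_self_eq_norm_sq, ← real_inner_self_eq_norm_sq]
    simp only [inner_sub_left, inner_sub_right]
    rw [real_inner_comm w v]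
    ring
  have h6 : ‖w‖ ^ 2 - inner ℝ w v ≤ 0 := by
    have h8 : 0 ≤ -(ε * inner ℝ w (w - v)) := by
      have h5 : ‖ι (w - v)‖ ^ 2 = inner ℝ (ι w) (ι (w - v)) - inner ℝ (ι v) (ι (w - v)) := by
        rw [← inner_sub_left, ← map_sub, real_inner_self_eq_norm_sq]
      nlinarith [sq_nonneg ‖ι (w - v)‖]
    rw [inner_sub_right, real_inner_self_eq_norm_sq] at h8
    by_contra hc
    have := mul_pos hε (not_le.1 hc)
    linarith
  have h7 : inner ℝ v (v - w) = inner ℝ (v - ContinuousLinearMap.adjoint ι h) (v - w) +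
      inner ℝ h (ι (v - w)) := by
    rw [inner_sub_left, ContinuousLinearMap.adjoint_inner_left]
    ring
  linarith

/-- An element `F` of `V'` of finite energy belongs to `H`: the energy bound and the resolvent
equation give `|F v| ≤ c ‖ι v‖`. -/
theorem exists_eq_toDual_of_tendsto [CompleteSpace H] {ι : V →L[ℝ] H} {F : StrongDual ℝ V} {l : ℝ}
    (hl : Tendsto (fun n => F (resolvent ι n F)) atTop (𝓝 l)) : ∃ h : H, F = toDual ι h := by
  obtain ⟨M, hM⟩ := hl.bddAbove_range
  have hM' : ∀ n, F (resolvent ι n F) ≤ M := fun n => hM ⟨n, rfl⟩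
  have henergy : ∀ n : ℕ, ‖ι (resolvent ι n F)‖ ^ 2 +
      1 / ((n : ℝ) + 1) * ‖resolvent ι n F‖ ^ 2 ≤ M := fun n => by
    have := resolvent_spec ι n F (resolvent ι n F)
    rw [real_inner_self_eq_norm_sq, real_inner_self_eq_norm_sq] at this
    exact this.trans_le (hM' n)
  have hM0 : 0 ≤ M := le_trans (by positivity) (henergy 0)
  have hbound : ∀ v, |F v| ≤ √M * ‖ι v‖ := by
    intro v
    have h1 : ∀ n : ℕ, |F v| ≤ √M * ‖ι v‖ + √(1 / ((n : ℝ) + 1) * M) * ‖v‖ := by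
      intro n
      have hε : (0 : ℝ) < 1 / ((n : ℝ) + 1) := Nat.one_div_pos_of_nat
      have h2 := henergy n
      rw [← resolvent_spec ι n F v]
      set ε : ℝ := 1 / ((n : ℝ) + 1)
      set w := resolvent ι n F
      refine (abs_add_le _ _).trans (add_le_add ?_ ?_)
      · refine (abs_real_inner_le_norm _ _).trans ?_
        gcongr
        exact Real.le_sqrt_of_sq_le (by nlinarith [mul_nonneg hε.le (sq_nonneg ‖w‖)])
      · rw [abs_mul, abs_of_pos hε]
        have h3 : ε * ‖w‖ ≤ √(ε * M) := by
          refine Real.le_sqrt_of_sq_le ?_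
          nlinarith [sq_nonneg ‖ι w‖]
        calc ε * |inner ℝ w v| ≤ ε * (‖w‖ * ‖v‖) := by
              gcongr
              exact abs_real_inner_le_norm _ _
          _ = ε * ‖w‖ * ‖v‖ := by ring
          _ ≤ _ := by gcongr
    refine ge_of_tendsto' (f := fun n : ℕ => √M * ‖ι v‖ + √(1 / ((n : ℝ) + 1) * M) * ‖v‖)
      (x := atTop) ?_ h1
    have h2 : Tendsto (fun n : ℕ => √(1 / ((n : ℝ) + 1) * M)) atTop (𝓝 0) := by
      have := ((tendsto_one_div_add_atTop_nhds_zero_nat (𝕜 := ℝ)).mul_const M).sqrt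
      simpa using this
    simpa using (h2.mul_const ‖v‖).const_add (√M * ‖ι v‖)
  obtain ⟨g, hg⟩ := exists_dual_comp_eq_of_abs_le (ι : V →ₗ[ℝ] H) (F : V →ₗ[ℝ] ℝ) (√M) hbound
  refine ⟨(InnerProductSpace.toDual ℝ H).symm g, ContinuousLinearMap.ext fun v => ?_⟩
  rw [toDual_apply, InnerProductSpace.toDual_symm_apply]
  exact (hg v).symm

end Triple

/-! ### The energy equality -/

section Energy

variable {T : ℝ} {V H : Type*} [NormedAddCommGroup V] [InnerProductSpace ℝ V]
  [NormedAddCommGroup H] [InnerProductSpace ℝ H] {ι : V →L[ℝ] H}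

/-- `y` is the `H`-valued path with initial value `h₀` and derivative `φ ∈ L_2((0,T); V')`, and
`u ∈ L_2((0,T); V)` is its `V`-valued version. -/
structure IsPath (T : ℝ) (ι : V →L[ℝ] H) (h₀ : H) (φ : ℝ → StrongDual ℝ V) (u : ℝ → V)
    (y : ℝ → H) : Prop where
  memLp_deriv : MemLp φ 2 (timeMeasure T)
  memLp : MemLp u 2 (timeMeasure T)
  eq_add_integral : ∀ t ∈ Icc 0 T, toDual ι (y t) = toDual ι h₀ + ∫ s in (0 : ℝ)..t, φ s
  ae_eq : ∀ᵐ t ∂(timeMeasure T), y t = ι (u t)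

theorem toDual_injective (hd : DenseRange ι) : Function.Injective (toDual ι) := by
  intro x y hxy
  exact hd.eq_of_inner_left ℝ fun v => congrArg (fun F : StrongDual ℝ V => F v) hxy

theorem intervalIntegrable_of_memLp {E : Type*} [NormedAddCommGroup E] {φ : ℝ → E}
    (hφ : MemLp φ 2 (timeMeasure T)) {a b : ℝ} (ha : a ∈ Icc 0 T) (hb : b ∈ Icc 0 T) :
    IntervalIntegrable φ volume a b :=
  Integrable.intervalIntegrable_of_mem (hφ.integrable (by norm_num)) ha hb

theorem IsPath.add {h₀ h₀' : H} {φ φ' : ℝ → StrongDual ℝ V} {u u' : ℝ → V} {y y' : ℝ → H}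
    (hy : IsPath T ι h₀ φ u y) (hy' : IsPath T ι h₀' φ' u' y') :
    IsPath T ι (h₀ + h₀') (fun t => φ t + φ' t) (fun t => u t + u' t) (fun t => y t + y' t) where
  memLp_deriv := memLp_fun_add hy.memLp_deriv hy'.memLp_deriv
  memLp := memLp_fun_add hy.memLp hy'.memLp
  eq_add_integral := fun t ht => by
    have h0 : (0 : ℝ) ∈ Icc 0 T := ⟨le_rfl, ht.1.trans ht.2⟩
    rw [intervalIntegral.integral_add (intervalIntegrable_of_memLp hy.memLp_deriv h0 ht)
      (intervalIntegrable_of_memLp hy'.memLp_deriv h0 ht)]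
    have e : ∀ a b : H, toDual ι (a + b) = toDual ι a + toDual ι b := (toDualL ι).map_add
    rw [e, e, hy.eq_add_integral t ht, hy'.eq_add_integral t ht]
    abel
  ae_eq := by
    filter_upwards [hy.ae_eq, hy'.ae_eq] with t h1 h2
    rw [h1, h2, map_add]

theorem IsPath.const_smul {h₀ : H} {φ : ℝ → StrongDual ℝ V} {u : ℝ → V} {y : ℝ → H}
    (hy : IsPath T ι h₀ φ u y) (c : ℝ) :
    IsPath T ι (c • h₀) (fun t => c • φ t) (fun t => c • u t) (fun t => c • y t) where
  memLp_deriv := hy.memLp_deriv.const_smul c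
  memLp := hy.memLp.const_smul c
  eq_add_integral := fun t ht => by
    have e : ∀ a : H, toDual ι (c • a) = c • toDual ι a := (toDualL ι).map_smul c
    rw [intervalIntegral.integral_smul, e, e, hy.eq_add_integral t ht, smul_add]
  ae_eq := by
    filter_upwards [hy.ae_eq] with t h1
    rw [h1, map_smul]

theorem IsPath.zero : IsPath T ι (0 : H) (fun _ => 0) (fun _ => 0) (fun _ => 0) where
  memLp_deriv := memLp_const (0 : StrongDual ℝ V)
  memLp := memLp_const (0 : V)
  eq_add_integral := fun t _ => by
    rw [intervalIntegral.integral_zero, add_zero]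
  ae_eq := Eventually.of_forall fun t => (map_zero ι).symm

theorem IsPath.sum {κ : Type*} (s : Finset κ) {h₀ : κ → H} {φ : κ → ℝ → StrongDual ℝ V}
    {u : κ → ℝ → V} {y : κ → ℝ → H} (hy : ∀ i ∈ s, IsPath T ι (h₀ i) (φ i) (u i) (y i)) :
    IsPath T ι (∑ i ∈ s, h₀ i) (fun t => ∑ i ∈ s, φ i t) (fun t => ∑ i ∈ s, u i t)
      (fun t => ∑ i ∈ s, y i t) := by
  classical
  induction s using Finset.induction_on with
  | empty => simpa using IsPath.zero
  | insert a s ha ih =>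
    simp only [Finset.sum_insert ha]
    exact (hy a (Finset.mem_insert_self a s)).add
      (ih fun i hi => hy i (Finset.mem_insert_of_mem hi))

theorem IsPath.sub {h₀ h₀' : H} {φ φ' : ℝ → StrongDual ℝ V} {u u' : ℝ → V} {y y' : ℝ → H}
    (hy : IsPath T ι h₀ φ u y) (hy' : IsPath T ι h₀' φ' u' y') :
    IsPath T ι (h₀ - h₀') (fun t => φ t - φ' t) (fun t => u t - u' t) (fun t => y t - y' t) := by
  have e : ∀ F G : StrongDual ℝ V, F + (-1 : ℝ) • G = F - G := fun F G => by
    ext v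
    simp [sub_eq_add_neg]
  simpa only [e, neg_one_smul, ← sub_eq_add_neg] using hy.add (hy'.const_smul (-1))

theorem IsPath.congr {h₀ : H} {φ φ' : ℝ → StrongDual ℝ V} {u u' : ℝ → V} {y : ℝ → H}
    (hy : IsPath T ι h₀ φ u y) (hφ : φ =ᵐ[timeMeasure T] φ') (hu : u =ᵐ[timeMeasure T] u') :
    IsPath T ι h₀ φ' u' y where
  memLp_deriv := hy.memLp_deriv.ae_eq hφ
  memLp := hy.memLp.ae_eq hu
  eq_add_integral := fun t ht => by
    rw [hy.eq_add_integral t ht]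
    congr 1
    refine intervalIntegral.integral_congr_ae_restrict ?_
    rw [uIoc_of_le ht.1]
    rw [timeMeasure_eq_restrict_Ioc] at hφ
    exact ae_restrict_of_ae_restrict_of_subset (Ioc_subset_Ioc_right ht.2) hφ
  ae_eq := by
    filter_upwards [hy.ae_eq, hu] with t h1 h2
    rw [h1, h2]

theorem IsPath.apply_zero (hd : DenseRange ι) (hT : 0 ≤ T) {h₀ : H} {φ : ℝ → StrongDual ℝ V}
    {u : ℝ → V} {y : ℝ → H} (hy : IsPath T ι h₀ φ u y) : y 0 = h₀ := by
  refine toDual_injective hd ?_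
  rw [hy.eq_add_integral 0 ⟨le_rfl, hT⟩, intervalIntegral.integral_same, add_zero]

variable [CompleteSpace V]

/-- The increment of the bounded symmetric quadratic form `F ↦ F (R F)`, where `R` is a resolvent,
along an absolutely continuous path. -/
theorem apply_resolvent_eq_add_integral {U φ : ℝ → StrongDual ℝ V} {x₀ : StrongDual ℝ V} {t : ℝ}
    (hφ : IntervalIntegrable φ volume 0 t) (hU : ∀ s, U s = x₀ + ∫ r in (0 : ℝ)..s, φ r) (n : ℕ) :
    U t (resolvent ι n (U t)) = x₀ (resolvent ι n x₀) +
      2 * ∫ s in (0 : ℝ)..t, φ s (resolvent ι n (U s)) := by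
  set R := resolvent ι n
  have hac : AbsolutelyContinuousOnInterval U 0 t := by
    refine absolutelyContinuousOnInterval_of_dist_le (C := 1)
      (absolutelyContinuousOnInterval_integral hφ) fun x _ y _ => ?_
    rw [hU, hU, dist_add_left, one_mul]
  obtain ⟨M, hM⟩ := hac.exists_bound
  have hb : AbsolutelyContinuousOnInterval (fun s => U s (R (U s))) 0 t := by
    refine absolutelyContinuousOnInterval_of_dist_le (C := M * ‖R‖ + M * ‖R‖) hac
      fun x hx y hy => ?_
    have e : U x (R (U x)) - U y (R (U y)) = (U x - U y) (R (U x)) + U y (R (U x - U y)) := by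
      rw [map_sub, map_sub, _root_.sub_apply]
      ring
    have hM0 : 0 ≤ M := (norm_nonneg _).trans (hM x hx)
    rw [Real.dist_eq, e, dist_eq_norm, add_mul]
    refine (abs_add_le _ _).trans (add_le_add ?_ ?_)
    · calc |(U x - U y) (R (U x))| ≤ ‖U x - U y‖ * (‖R‖ * ‖U x‖) :=
            ((U x - U y).le_opNorm _).trans (by gcongr; exact R.le_opNorm _)
        _ ≤ ‖U x - U y‖ * (‖R‖ * M) := by gcongr; exact hM x hx
        _ = _ := by ring
    · calc |U y (R (U x - U y))| ≤ ‖U y‖ * (‖R‖ * ‖U x - U y‖) :=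
            ((U y).le_opNorm _).trans (by gcongr; exact R.le_opNorm _)
        _ ≤ M * (‖R‖ * ‖U x - U y‖) := by gcongr; exact hM y hy
        _ = _ := by ring
  have h := integral_eq_sub_of_ae_hasDerivAt hb (f' := fun s => 2 * φ s (R (U s))) ?_
  · have hU0 : U 0 = x₀ := by rw [hU, intervalIntegral.integral_same, add_zero]
    rw [intervalIntegral.integral_const_mul, hU0] at h
    linarith
  · filter_upwards [hφ.ae_hasDerivAt_integral] with s hs hst
    have h1 : HasDerivAt U (φ s) s := by
      have h2 := (hs hst 0 left_mem_uIcc).const_add x₀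
      exact h2.congr_of_eventuallyEq (Eventually.of_forall hU)
    have h2 : HasDerivAt (fun s => R (U s)) (R (φ s)) s := R.hasFDerivAt.comp_hasDerivAt s h1
    refine (h1.clm_apply h2).congr_deriv ?_
    rw [resolvent_symm]
    ring

variable [CompleteSpace H]

/-- The energy of the regularized path has the limit that the energy equality predicts; the
integrands converge since the resolvents are contractions of `V` that converge strongly to the
identity. -/
theorem tendsto_energy (hι : Function.Injective ι) (hd : DenseRange ι) {h₀ : H}
    {φ : ℝ → StrongDual ℝ V} {u : ℝ → V} (hφ : MemLp φ 2 (timeMeasure T))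
    (hu : MemLp u 2 (timeMeasure T))
    (h : ∀ᵐ t ∂(timeMeasure T), toDual ι (ι (u t)) = toDual ι h₀ + ∫ s in (0 : ℝ)..t, φ s)
    {t : ℝ} (ht : t ∈ Icc 0 T) {F : StrongDual ℝ V}
    (hF : F = toDual ι h₀ + ∫ s in (0 : ℝ)..t, φ s) :
    Tendsto (fun n => F (resolvent ι n F)) atTop
      (𝓝 (‖h₀‖ ^ 2 + 2 * ∫ s in (0 : ℝ)..t, φ s (u s))) := by
  have h0 : (0 : ℝ) ∈ Icc 0 T := ⟨le_rfl, ht.1.trans ht.2⟩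
  have hi := intervalIntegrable_of_memLp hφ h0 ht
  set U : ℝ → StrongDual ℝ V := fun s => toDual ι h₀ + ∫ r in (0 : ℝ)..s, φ r with hU
  have e : ∀ n, F (resolvent ι n F) = toDual ι h₀ (resolvent ι n (toDual ι h₀)) +
      2 * ∫ s in (0 : ℝ)..t, φ s (resolvent ι n (U s)) := fun n => by
    rw [hF]
    exact apply_resolvent_eq_add_integral hi (fun _ => rfl) n
  simp only [e]
  refine (tendsto_apply_resolvent hd h₀).add (Tendsto.const_mul 2 ?_)
  have hae : ∀ᵐ s ∂(volume.restrict (uIoc 0 t)), U s = toDual ι (ι (u s)) := by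
    rw [uIoc_of_le ht.1]
    have h1 : ∀ᵐ s ∂(volume.restrict (Ioc 0 T)), U s = toDual ι (ι (u s)) := by
      rw [← timeMeasure_eq_restrict_Ioc]
      filter_upwards [h] with s hs using hs.symm
    exact ae_restrict_of_ae_restrict_of_subset (Ioc_subset_Ioc_right ht.2) h1
  have hint := integrable_dual_apply hφ hu
  have hprod : Integrable (fun s => ‖φ s‖ * ‖u s‖) (timeMeasure T) :=
    hφ.norm.integrable_mul hu.norm
  refine intervalIntegral.tendsto_integral_filter_of_dominated_convergence
    (fun s => ‖φ s‖ * ‖u s‖) (Eventually.of_forall fun n => ?_) (Eventually.of_forall fun n => ?_)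
    (Integrable.intervalIntegrable_of_mem hprod h0 ht) ?_
  · have h1 : ContinuousOn U (uIcc 0 t) :=
      continuousOn_const.add (intervalIntegral.continuousOn_primitive_interval' hi left_mem_uIcc)
    have h2 : AEStronglyMeasurable U (volume.restrict (uIoc 0 t)) :=
      (h1.mono uIoc_subset_uIcc).aestronglyMeasurable measurableSet_uIoc
    have h3 : AEStronglyMeasurable φ (volume.restrict (uIoc 0 t)) := by
      rw [uIoc_of_le ht.1]
      exact hi.1.1
    exact (isBoundedBilinearMap_apply (𝕜 := ℝ) (E := V) (F := ℝ)).continuous.comp_aestronglyMeasurable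
      (h3.prodMk ((resolvent ι n).continuous.comp_aestronglyMeasurable h2))
  · rw [ae_restrict_iff' measurableSet_uIoc] at hae
    filter_upwards [hae] with s hs hst
    rw [hs hst]
    refine ((φ s).le_opNorm _).trans ?_
    gcongr
    exact norm_resolvent_le ι n (u s)
  · rw [ae_restrict_iff' measurableSet_uIoc] at hae
    filter_upwards [hae] with s hs hst
    rw [hs hst]
    exact ((φ s).continuous.tendsto _).comp (tendsto_resolvent hι (u s))

/-- A function in `L_2((0,T); V)` whose weak derivative is in `L_2((0,T); V')` has a version with
values in `H` at every time. -/
theorem exists_isPath (hι : Function.Injective ι) (hd : DenseRange ι) {h₀ : H}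
    {φ : ℝ → StrongDual ℝ V} {u : ℝ → V} (hφ : MemLp φ 2 (timeMeasure T))
    (hu : MemLp u 2 (timeMeasure T))
    (h : ∀ᵐ t ∂(timeMeasure T), toDual ι (ι (u t)) = toDual ι h₀ + ∫ s in (0 : ℝ)..t, φ s) :
    ∃ y, IsPath T ι h₀ φ u y := by
  have hex : ∀ t, ∃ x : H, t ∈ Icc 0 T → toDual ι x = toDual ι h₀ + ∫ s in (0 : ℝ)..t, φ s := by
    intro t
    by_cases ht : t ∈ Icc 0 T
    · obtain ⟨x, hx⟩ := exists_eq_toDual_of_tendsto (tendsto_energy hι hd hφ hu h ht rfl)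
      exact ⟨x, fun _ => hx.symm⟩
    · exact ⟨0, fun h => absurd h ht⟩
  choose y hy using hex
  refine ⟨y, hφ, hu, hy, ?_⟩
  filter_upwards [h, ae_timeMeasure_mem T] with t h1 h2
  exact toDual_injective hd ((hy t (Ioo_subset_Icc_self h2)).trans h1.symm)

/-- The energy equality. -/
theorem IsPath.norm_sq (hι : Function.Injective ι) (hd : DenseRange ι) {h₀ : H}
    {φ : ℝ → StrongDual ℝ V} {u : ℝ → V} {y : ℝ → H} (hy : IsPath T ι h₀ φ u y) {t : ℝ}
    (ht : t ∈ Icc 0 T) : ‖y t‖ ^ 2 = ‖h₀‖ ^ 2 + 2 * ∫ s in (0 : ℝ)..t, φ s (u s) := by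
  refine tendsto_nhds_unique (tendsto_apply_resolvent hd (y t))
    (tendsto_energy hι hd hy.memLp_deriv hy.memLp ?_ ht (hy.eq_add_integral t ht))
  filter_upwards [hy.ae_eq, ae_timeMeasure_mem T] with s h1 h2
  rw [← h1]
  exact hy.eq_add_integral s (Ioo_subset_Icc_self h2)

end Energy

/-! ### Gronwall's inequality for absolutely continuous functions -/

section AC

variable {T : ℝ}

/-- `f` is absolutely continuous on `[0, T]` and its derivative is a.e. equal to `f'`. -/
structure HasACDeriv (T : ℝ) (f f' : ℝ → ℝ) : Prop where
  ac : AbsolutelyContinuousOnInterval f 0 T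
  hasDerivAt : ∀ᵐ t ∂(timeMeasure T), HasDerivAt f (f' t) t

theorem HasACDeriv.add {f f' g g' : ℝ → ℝ} (hf : HasACDeriv T f f') (hg : HasACDeriv T g g') :
    HasACDeriv T (fun t => f t + g t) (fun t => f' t + g' t) where
  ac := hf.ac.add hg.ac
  hasDerivAt := by
    filter_upwards [hf.hasDerivAt, hg.hasDerivAt] with t h1 h2 using h1.add h2

theorem HasACDeriv.mul {f f' g g' : ℝ → ℝ} (hf : HasACDeriv T f f') (hg : HasACDeriv T g g') :
    HasACDeriv T (fun t => f t * g t) (fun t => f' t * g t + f t * g' t) where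
  ac := hf.ac.mul hg.ac
  hasDerivAt := by
    filter_upwards [hf.hasDerivAt, hg.hasDerivAt] with t h1 h2 using h1.mul h2

theorem HasACDeriv.const (c : ℝ) : HasACDeriv T (fun _ => c) (fun _ => 0) where
  ac := (LipschitzWith.const c).lipschitzOnWith.absolutelyContinuousOnInterval
  hasDerivAt := Eventually.of_forall fun t => hasDerivAt_const t c

theorem HasACDeriv.const_mul {f f' : ℝ → ℝ} (c : ℝ) (hf : HasACDeriv T f f') :
    HasACDeriv T (fun t => c * f t) (fun t => c * f' t) := by
  simpa using (HasACDeriv.const c).mul hf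

theorem HasACDeriv.sum {κ : Type*} (s : Finset κ) {f f' : κ → ℝ → ℝ}
    (hf : ∀ i ∈ s, HasACDeriv T (f i) (f' i)) :
    HasACDeriv T (fun t => ∑ i ∈ s, f i t) (fun t => ∑ i ∈ s, f' i t) := by
  classical
  induction s using Finset.induction_on with
  | empty => simpa using HasACDeriv.const 0
  | insert a s ha ih =>
    simp only [Finset.sum_insert ha]
    exact (hf a (Finset.mem_insert_self a s)).add
      (ih fun i hi => hf i (Finset.mem_insert_of_mem hi))

theorem HasACDeriv.prod {κ : Type*} [DecidableEq κ] (s : Finset κ) {f f' : κ → ℝ → ℝ}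
    (hf : ∀ i ∈ s, HasACDeriv T (f i) (f' i)) :
    HasACDeriv T (fun t => ∏ i ∈ s, f i t)
      (fun t => ∑ i ∈ s, f' i t * ∏ j ∈ s.erase i, f j t) := by
  have hac : AbsolutelyContinuousOnInterval (fun t => ∏ i ∈ s, f i t) 0 T := by
    induction s using Finset.induction_on with
    | empty => simpa using (HasACDeriv.const (T := T) 1).ac
    | insert a s ha ih =>
      simp only [Finset.prod_insert ha]
      exact (hf a (Finset.mem_insert_self a s)).ac.mul
        (ih fun i hi => hf i (Finset.mem_insert_of_mem hi))
  refine ⟨hac, ?_⟩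
  filter_upwards [(ae_ball_iff s.countable_toSet).2 fun i hi => (hf i hi).hasDerivAt] with t ht
  refine (HasDerivAt.fun_finsetProd fun i hi => ht i hi).congr_deriv ?_
  exact Finset.sum_congr rfl fun i _ => by rw [smul_eq_mul, mul_comm]

theorem HasACDeriv.congr {f f' g : ℝ → ℝ} (hT : 0 ≤ T) (hf : HasACDeriv T f f')
    (h : ∀ t ∈ Icc 0 T, g t = f t) : HasACDeriv T g f' where
  ac := by
    refine absolutelyContinuousOnInterval_of_dist_le (C := 1) hf.ac fun x hx y hy => ?_
    rw [uIcc_of_le hT] at hx hy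
    rw [h x hx, h y hy, one_mul]
  hasDerivAt := by
    filter_upwards [hf.hasDerivAt, ae_timeMeasure_mem T] with t h1 h2
    refine h1.congr_of_eventuallyEq ?_
    filter_upwards [Ioo_mem_nhds h2.1 h2.2] with s hs using h s (Ioo_subset_Icc_self hs)

theorem HasACDeriv.congr_deriv {f f' g : ℝ → ℝ} (hf : HasACDeriv T f f')
    (h : f' =ᵐ[timeMeasure T] g) : HasACDeriv T f g where
  ac := hf.ac
  hasDerivAt := by
    filter_upwards [hf.hasDerivAt, h] with t h1 h2
    rwa [← h2]

theorem hasACDeriv_integral {f : ℝ → ℝ} (hT : 0 ≤ T) (hf : Integrable f (timeMeasure T)) (c : ℝ) :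
    HasACDeriv T (fun t => c + ∫ s in (0 : ℝ)..t, f s) f where
  ac := (HasACDeriv.const c).ac.add
    (absolutelyContinuousOnInterval_integral ((intervalIntegrable_iff_timeMeasure hT).2 hf))
  hasDerivAt := by
    have h := ((intervalIntegrable_iff_timeMeasure hT).2 hf).ae_hasDerivAt_integral
    filter_upwards [ae_restrict_of_ae h, ae_timeMeasure_mem T] with t h1 h2
    have h3 : t ∈ uIcc 0 T := by
      rw [uIcc_of_le hT]
      exact Ioo_subset_Icc_self h2
    exact (h1 h3 0 left_mem_uIcc).const_add c

theorem HasACDeriv.integral_eq_sub {f f' : ℝ → ℝ} (hf : HasACDeriv T f f') {t : ℝ}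
    (ht : t ∈ Icc 0 T) :
    IntervalIntegrable f' volume 0 t ∧ ∫ s in (0 : ℝ)..t, f' s = f t - f 0 := by
  have hac : AbsolutelyContinuousOnInterval f 0 t :=
    hf.ac.mono (by
      rw [uIcc_of_le ht.1, uIcc_of_le (ht.1.trans ht.2)]
      exact Icc_subset_Icc_right ht.2)
  have hd : deriv f =ᵐ[volume.restrict (uIoc 0 t)] f' := by
    have h := hf.hasDerivAt
    rw [timeMeasure_eq_restrict_Ioc] at h
    rw [uIoc_of_le ht.1]
    filter_upwards [ae_restrict_of_ae_restrict_of_subset (Ioc_subset_Ioc_right ht.2) h] with s hs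
      using hs.deriv
  exact ⟨hac.intervalIntegrable_deriv.congr_ae hd,
    (intervalIntegral.integral_congr_ae_restrict hd).symm.trans hac.integral_deriv_eq_sub⟩

/-- Gronwall's inequality. -/
theorem HasACDeriv.le_exp_mul {q q' G : ℝ → ℝ} (hT : 0 ≤ T) (hq : HasACDeriv T q q') {c : ℝ}
    (hc : 0 ≤ c) (hG : Integrable G (timeMeasure T)) (hG0 : ∀ᵐ t ∂(timeMeasure T), 0 ≤ G t)
    (h : ∀ᵐ t ∂(timeMeasure T), q' t ≤ c * q t + G t) {t : ℝ} (ht : t ∈ Icc 0 T) :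
    q t ≤ Real.exp (c * t) * (q 0 + ∫ s in (0 : ℝ)..t, G s) := by
  have he : HasACDeriv T (fun t => Real.exp (-c * t)) (fun t => Real.exp (-c * t) * -c) := by
    have h1 : ContDiffOn ℝ 1 (fun t => Real.exp (-c * t)) (uIcc 0 T) := by fun_prop
    refine ⟨h1.absolutelyContinuousOnInterval, Eventually.of_forall fun t => ?_⟩
    simpa using ((hasDerivAt_id t).const_mul (-c)).exp
  obtain ⟨h1, h2⟩ := (he.mul hq).integral_eq_sub ht
  have hGi := Integrable.intervalIntegrable_of_mem hG ⟨le_rfl, hT⟩ ht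
  have h3 := intervalIntegral.integral_mono_ae_restrict ht.1 h1 hGi ?_
  · rw [h2, mul_zero, Real.exp_zero, one_mul] at h3
    have h4 : Real.exp (c * t) * Real.exp (-c * t) = 1 := by
      rw [← Real.exp_add]
      simp
    calc q t = Real.exp (c * t) * (Real.exp (-c * t) * q t) := by rw [← mul_assoc, h4, one_mul]
      _ ≤ _ := by
        gcongr
        linarith
  · rw [restrict_Ioc_eq_restrict_Icc.symm]
    have h5 : ∀ᵐ s ∂(timeMeasure T), Real.exp (-c * s) * -c * q s + Real.exp (-c * s) * q' s
        ≤ G s := by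
      filter_upwards [hG0, h, ae_timeMeasure_mem T] with s h5 h6 h7
      have h8 : Real.exp (-c * s) ≤ 1 := by
        rw [Real.exp_le_one_iff]
        nlinarith [h7.1]
      calc _ = Real.exp (-c * s) * (q' s - c * q s) := by ring
        _ ≤ Real.exp (-c * s) * G s := by
          gcongr
          linarith
        _ ≤ 1 * G s := by gcongr
        _ = G s := one_mul _
    rw [timeMeasure_eq_restrict_Ioc] at h5
    exact ae_restrict_of_ae_restrict_of_subset (Ioc_subset_Ioc_right ht.2) h5

end AC

/-! ### A priori estimates and uniqueness for the deterministic equation -/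

section Energy

variable {T : ℝ} {V H : Type*} [NormedAddCommGroup V] [InnerProductSpace ℝ V]
  [NormedAddCommGroup H] [InnerProductSpace ℝ H] {ι : V →L[ℝ] H} [CompleteSpace V] [CompleteSpace H]
  {h₀ h₀' : H} {φ φ' : ℝ → StrongDual ℝ V} {u u' : ℝ → V} {y y' : ℝ → H}

theorem IsPath.hasACDeriv_norm_sq (hT : 0 ≤ T) (hι : Function.Injective ι) (hd : DenseRange ι)
    (hy : IsPath T ι h₀ φ u y) : HasACDeriv T (fun t => ‖y t‖ ^ 2) (fun t => 2 * φ t (u t)) := by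
  refine (hasACDeriv_integral hT ((integrable_dual_apply hy.memLp_deriv hy.memLp).const_mul 2)
    (‖h₀‖ ^ 2)).congr hT fun t ht => ?_
  rw [hy.norm_sq hι hd ht, intervalIntegral.integral_const_mul]

/-- The energy equality in polarized form. -/
theorem IsPath.hasACDeriv_inner (hT : 0 ≤ T) (hι : Function.Injective ι) (hd : DenseRange ι)
    (hy : IsPath T ι h₀ φ u y) (hy' : IsPath T ι h₀' φ' u' y') :
    HasACDeriv T (fun t => inner ℝ (y t) (y' t)) (fun t => φ t (u' t) + φ' t (u t)) := by
  have h := (((hy.add hy').hasACDeriv_norm_sq hT hι hd).add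
    ((hy.sub hy').hasACDeriv_norm_sq hT hι hd |>.const_mul (-1))).const_mul (1 / 4)
  refine (h.congr hT fun t _ => ?_).congr_deriv (Eventually.of_forall fun t => ?_)
  · rw [norm_add_sq_real, norm_sub_sq_real]
    ring
  · simp only [map_add, map_sub, _root_.add_apply, _root_.sub_apply]
    ring

/-- The path is weakly continuous and its norm is continuous, so it is strongly continuous. -/
theorem IsPath.continuousOn (hT : 0 ≤ T) (hι : Function.Injective ι) (hd : DenseRange ι)
    (hy : IsPath T ι h₀ φ u y) : ContinuousOn y (Icc 0 T) := by
  have hn : ContinuousOn (fun t => ‖y t‖ ^ 2) (Icc 0 T) := by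
    simpa [uIcc_of_le hT] using (hy.hasACDeriv_norm_sq hT hι hd).ac.continuousOn
  have hw : ∀ v, ContinuousOn (fun t => inner ℝ (y t) (ι v)) (Icc 0 T) := fun v => by
    have h1 : ContinuousOn (fun t => (toDual ι h₀ + ∫ s in (0 : ℝ)..t, φ s) v) (Icc 0 T) := by
      have hi := intervalIntegrable_of_memLp hy.memLp_deriv (left_mem_Icc.2 hT) (right_mem_Icc.2 hT)
      have h2 := intervalIntegral.continuousOn_primitive_interval' hi left_mem_uIcc
      rw [uIcc_of_le hT] at h2
      exact (ContinuousLinearMap.apply ℝ ℝ v).continuous.comp_continuousOn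
        (continuousOn_const.add h2)
    refine h1.congr fun t ht => ?_
    simp only [← hy.eq_add_integral t ht]
    rfl
  -- the distance of `y` to each vector of the dense subspace is continuous
  have hdist : ∀ v, ContinuousOn (fun t => dist (y t) (ι v)) (Icc 0 T) := fun v => by
    have h1 : ContinuousOn (fun t => √(‖y t‖ ^ 2 - 2 * inner ℝ (y t) (ι v) + ‖ι v‖ ^ 2))
        (Icc 0 T) :=
      ((hn.sub ((hw v).const_mul 2)).add continuousOn_const).sqrt
    refine h1.congr fun t _ => ?_
    simp only [← norm_sub_sq_real, Real.sqrt_sq (norm_nonneg _), dist_eq_norm]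
  intro t ht
  refine Metric.tendsto_nhds.2 fun ε hε => ?_
  obtain ⟨v, hv⟩ := hd.exists_dist_lt (y t) (half_pos hε)
  filter_upwards [(hdist v t ht).eventually_lt_const hv] with s hs
  calc dist (y s) (y t) ≤ dist (y s) (ι v) + dist (y t) (ι v) := dist_triangle_right _ _ _
    _ < ε / 2 + ε / 2 := add_lt_add hs hv
    _ = ε := add_halves ε

/-- The basic a priori estimate. -/
theorem IsPath.norm_sq_le (hT : 0 ≤ T) (hι : Function.Injective ι) (hd : DenseRange ι)
    (hy : IsPath T ι h₀ φ u y) {c : ℝ} (hc : 0 ≤ c) {G : ℝ → ℝ} (hG : Integrable G (timeMeasure T))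
    (hG0 : ∀ᵐ t ∂(timeMeasure T), 0 ≤ G t)
    (h : ∀ᵐ t ∂(timeMeasure T), 2 * φ t (u t) ≤ c * ‖ι (u t)‖ ^ 2 + G t) {t : ℝ}
    (ht : t ∈ Icc 0 T) :
    ‖y t‖ ^ 2 ≤ Real.exp (c * t) * (‖h₀‖ ^ 2 + ∫ s in (0 : ℝ)..t, G s) := by
  rw [← hy.apply_zero hd hT]
  refine (hy.hasACDeriv_norm_sq hT hι hd).le_exp_mul hT hc hG hG0 ?_ ht
  filter_upwards [h, hy.ae_eq] with s h1 h2
  rwa [h2]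

/-- Uniqueness for the deterministic equation. -/
theorem IsPath.eq_of_coercive (hT : 0 ≤ T) (hι : Function.Injective ι) (hd : DenseRange ι)
    {A : ℝ → V →L[ℝ] StrongDual ℝ V} {δ C₁ : ℝ} (hδ : 0 ≤ δ) (hC₁ : 0 ≤ C₁)
    (hcoer : ∀ t ∈ Icc 0 T, ∀ v, A t v v + δ * ‖v‖ ^ 2 ≤ C₁ * ‖ι v‖ ^ 2)
    {F : ℝ → StrongDual ℝ V} (hy : IsPath T ι h₀ (fun t => A t (u t) + F t) u y)
    (hy' : IsPath T ι h₀ (fun t => A t (u' t) + F t) u' y') :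
    (∀ t ∈ Icc 0 T, y t = y' t) ∧ u =ᵐ[timeMeasure T] u' := by
  have h := hy.sub hy'
  have h1 : ∀ t ∈ Icc 0 T, y t = y' t := fun t ht => by
    have h2 := h.norm_sq_le hT hι hd (mul_nonneg zero_le_two hC₁) (G := fun _ => 0)
      (integrable_zero _ _ _) (Eventually.of_forall fun _ => le_rfl) ?_ ht
    · rw [sub_self, intervalIntegral.integral_zero, norm_zero, zero_pow two_ne_zero, add_zero,
        mul_zero] at h2
      exact sub_eq_zero.1 (norm_eq_zero.1 (pow_eq_zero_iff two_ne_zero |>.1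
        (le_antisymm h2 (sq_nonneg _))))
    · filter_upwards [ae_timeMeasure_mem T] with s hs
      have h3 := hcoer s (Ioo_subset_Icc_self hs) (u s - u' s)
      have h4 : (A s (u s) + F s - (A s (u' s) + F s)) = A s (u s - u' s) := by
        rw [map_sub]
        abel
      rw [h4]
      nlinarith [mul_nonneg hδ (sq_nonneg ‖u s - u' s‖)]
  refine ⟨h1, ?_⟩
  filter_upwards [hy.ae_eq, hy'.ae_eq, ae_timeMeasure_mem T] with t h2 h3 h4
  exact hι (h2.symm.trans ((h1 t (Ioo_subset_Icc_self h4)).trans h3))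

end Energy

/-! ### Tensor powers of quadratic forms -/

section TensorForm

variable {I X : Type*} [Fintype I] {n : ℕ}

/-- The form `∑_{p,q} ∏_j b(p_j, q_j) B(S_p, T_q)` on families indexed by words of length `n`: the
`n`-th tensor power of the matrix `b`, coupled with `B`. -/
def tensorForm (b : I → I → ℝ) (B : X → X → ℝ) (S T : (Fin n → I) → X) : ℝ :=
  ∑ p, ∑ q, (∏ j, b (p j) (q j)) * B (S p) (T q)

theorem tensorForm_comm {b : I → I → ℝ} (hb : ∀ x y, b x y = b y x) {B : X → X → ℝ}
    (S T : (Fin n → I) → X) :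
    tensorForm b B S T = tensorForm b (fun v w => B w v) T S := by
  unfold tensorForm
  rw [Finset.sum_comm]
  simp only [hb]

/-- If `b = U diag(l) Uᵀ`, the tensor form is diagonal in the variables `U^{⊗n} T`. -/
theorem tensorForm_of_sum [AddCommGroup X] [Module ℝ X] [DecidableEq I] (l : I → ℝ)
    (U : I → I → ℝ) (B : X →ₗ[ℝ] X →ₗ[ℝ] ℝ) (T : (Fin n → I) → X) :
    tensorForm (fun x y => ∑ r, l r * U x r * U y r) (fun v w => B v w) T T =
      ∑ r : Fin n → I, (∏ j, l (r j)) *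
        B (∑ p, (∏ j, U (p j) (r j)) • T p) (∑ p, (∏ j, U (p j) (r j)) • T p) := by
  unfold tensorForm
  simp only [map_sum, LinearMap.sum_apply, map_smul, LinearMap.smul_apply, smul_eq_mul,
    Finset.prod_univ_sum, Fintype.piFinset_univ, Finset.prod_mul_distrib, Finset.sum_mul,
    Finset.mul_sum]
  rw [Finset.sum_comm' (t' := Finset.univ) (s' := fun _ => Finset.univ) (by simp)]
  rw [Finset.sum_congr rfl fun q _ => Finset.sum_comm, Finset.sum_comm]
  exact Finset.sum_congr rfl fun r _ => Finset.sum_congr rfl fun p _ =>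
    Finset.sum_congr rfl fun q _ => by ring

/-- The spectral theorem in coordinates. The last conjunct is written as a sum with weights `1` so
that it has the shape of the preceding one with `l = 1`. -/
theorem exists_diagonalization [DecidableEq I] (b : Matrix I I ℝ) (hb : ∀ x y, b x y = b y x)
    {c : ℝ} (h : ∀ v : I → ℝ, c * ∑ x, v x ^ 2 ≤ ∑ x, ∑ y, b x y * v x * v y) :
    ∃ (l : I → ℝ) (U : I → I → ℝ), (∀ r, c ≤ l r) ∧
      (∀ x y, b x y = ∑ r, l r * U x r * U y r) ∧
      ∀ x y, ∑ r, 1 * U x r * U y r = if x = y then 1 else 0 := by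
  have hH : b.IsHermitian := by
    ext x y
    simpa using hb y x
  let U := (hH.eigenvectorUnitary : Matrix I I ℝ)
  have hU : U * star U = 1 := Unitary.coe_mul_star_self _
  have hU' : star U * U = 1 := Unitary.coe_star_mul_self _
  have hs : ∀ x y, b x y = ∑ r, hH.eigenvalues r * U x r * U y r := fun x y => by
    have h1 := congrFun (congrFun hH.spectral_theorem x) y
    rw [Unitary.conjStarAlgAut_apply] at h1
    rw [h1, Matrix.mul_apply]
    refine Finset.sum_congr rfl fun r _ => ?_
    rw [Matrix.mul_diagonal]
    simp only [Function.comp_apply, RCLike.ofReal_real_eq_id, id_eq, Matrix.star_apply,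
      star_trivial, U]
    ring
  refine ⟨hH.eigenvalues, U, fun r => ?_, hs, fun x y => ?_⟩
  · have h1 := h fun x => U x r
    have h2 : ∀ s, ∑ x, U x r * U x s = if r = s then 1 else 0 := fun s => by
      have := congrFun (congrFun hU' r) s
      rw [Matrix.mul_apply, Matrix.one_apply] at this
      simpa [Matrix.star_apply] using this
    have h3 : ∑ x, ∑ y, b x y * U x r * U y r = ∑ s, hH.eigenvalues s *
        ((∑ x, U x r * U x s) * (∑ x, U x r * U x s)) := by
      simp only [hs, Finset.sum_mul, Finset.mul_sum]
      rw [Finset.sum_congr rfl fun q _ => Finset.sum_comm, Finset.sum_comm]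
      refine Finset.sum_congr rfl fun r _ => Finset.sum_comm.trans ?_
      exact Finset.sum_congr rfl fun p _ => Finset.sum_congr rfl fun q _ => by ring
    have h4 : ∑ x, U x r ^ 2 = 1 := by simpa [sq] using h2 r
    rw [h3, h4] at h1
    simpa [h2] using h1
  · have := congrFun (congrFun hU x) y
    rw [Matrix.mul_apply, Matrix.one_apply] at this
    simpa [Matrix.star_apply] using this

/-- If `b ≥ c ≥ 0`, then the `n`-th tensor power of `b` is at least `c ^ n`. -/
theorem pow_mul_sum_le_tensorForm [DecidableEq I] [AddCommGroup X] [Module ℝ X] {b : I → I → ℝ}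
    (hb : ∀ x y, b x y = b y x) {c : ℝ} (hc : 0 ≤ c)
    (h : ∀ v : I → ℝ, c * ∑ x, v x ^ 2 ≤ ∑ x, ∑ y, b x y * v x * v y)
    (B : X →ₗ[ℝ] X →ₗ[ℝ] ℝ) (hB : ∀ v, 0 ≤ B v v) (T : (Fin n → I) → X) :
    c ^ n * ∑ p, B (T p) (T p) ≤ tensorForm b (fun v w => B v w) T T := by
  obtain ⟨l, U, hl, hbU, hU⟩ := exists_diagonalization b hb h
  have h1 := tensorForm_of_sum (fun _ => 1) U B T
  have h2 := tensorForm_of_sum l U B T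
  have h3 : (fun x y => ∑ r, l r * U x r * U y r) = b := by
    funext x y
    exact (hbU x y).symm
  have h4 : tensorForm (fun x y => ∑ r, 1 * U x r * U y r) (fun v w => B v w) T T =
      ∑ p, B (T p) (T p) := by
    unfold tensorForm
    refine Finset.sum_congr rfl fun p _ => ?_
    simp only [hU]
    rw [Finset.sum_eq_single p]
    · simp
    · intro q _ hq
      obtain ⟨j, hj⟩ := Function.ne_iff.1 hq
      rw [Finset.prod_eq_zero (Finset.mem_univ j) (if_neg (Ne.symm hj)), zero_mul]
    · simp
  rw [← h4, h1, ← h3, h2, Finset.mul_sum]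
  refine Finset.sum_le_sum fun r _ => ?_
  rw [Finset.prod_const_one, one_mul]
  refine mul_le_mul_of_nonneg_right ?_ (hB _)
  calc c ^ n = ∏ _j : Fin n, c := by simp
    _ ≤ ∏ j, l (r j) := Finset.prod_le_prod (fun _ _ => hc) fun j _ => hl _

theorem tensorForm_self_nonneg [DecidableEq I] [AddCommGroup X] [Module ℝ X] {b : I → I → ℝ}
    (hb : ∀ x y, b x y = b y x) (h : ∀ v : I → ℝ, 0 ≤ ∑ x, ∑ y, b x y * v x * v y)
    (B : X →ₗ[ℝ] X →ₗ[ℝ] ℝ) (hB : ∀ v, 0 ≤ B v v) (T : (Fin n → I) → X) :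
    0 ≤ tensorForm b (fun v w => B v w) T T := by
  refine le_trans ?_ (pow_mul_sum_le_tensorForm hb le_rfl (by simpa using h) B hB T)
  exact mul_nonneg (pow_nonneg le_rfl n) (Finset.sum_nonneg fun p _ => hB _)

theorem sum_eq_sum_insertNth {M : Type*} [AddCommMonoid M] (j : Fin (n + 1))
    (F : (Fin (n + 1) → I) → M) :
    ∑ p, F p = ∑ p' : Fin n → I, ∑ x, F (j.insertNth x p') := by
  rw [← (Fin.insertNthEquiv (fun _ => I) j).sum_comp, Fintype.sum_prod_type_right]
  rfl

theorem prod_erase_eq_prod_succAbove (j : Fin (n + 1)) (f : Fin (n + 1) → ℝ) :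
    ∏ i ∈ Finset.univ.erase j, f i = ∏ i, f (j.succAbove i) := by
  rw [← Finset.compl_singleton, ← Fin.image_succAbove_univ,
    Finset.prod_image fun x _ y _ h => Fin.succAbove_right_injective h]

variable [NormedAddCommGroup X] [InnerProductSpace ℝ X]

/-- Completing the square in one slot `j` of the words: when the matrix `b` moves with velocity
`-∑_k (b a_k) (b a_k)ᵀ` and `T` is driven in the slot `j` by `∑_k a_k ψ_k`, the derivative of the
form is at most the form of the `ψ_k`. -/
theorem slot_le [DecidableEq I] {κ : Type*} [Fintype κ] {b : I → I → ℝ}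
    (hb : ∀ x y, b x y = b y x)
    (h : ∀ v : I → ℝ, 0 ≤ ∑ x, ∑ y, b x y * v x * v y) (a : κ → I → ℝ)
    (T : (Fin (n + 1) → I) → X) (ψ : κ → (Fin n → I) → X) (j : Fin (n + 1)) :
    ∑ p, ∑ q, ((-∑ k, (∑ x, b (p j) x * a k x) * (∑ x, b (q j) x * a k x)) *
        (∏ i ∈ Finset.univ.erase j, b (p i) (q i)) * inner ℝ (T p) (T q) +
      2 * ((∏ i, b (p i) (q i)) * ∑ k, a k (p j) * inner ℝ (ψ k (j.removeNth p)) (T q))) ≤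
    ∑ k, tensorForm b (fun v w => inner ℝ v w) (ψ k) (ψ k) := by
  -- `W k` is `T` contracted with `b a_k` in the slot `j`; the left-hand side is
  -- `∑_k (-⟨W_k, W_k⟩ + 2 ⟨ψ_k, W_k⟩)` for the form of order `n`
  set c : κ → I → ℝ := fun k x => ∑ z, b x z * a k z with hc
  set W : κ → (Fin n → I) → X := fun k p' => ∑ x, c k x • T (j.insertNth x p') with hW
  have hba : ∀ k y, ∑ x, b x y * a k x = c k y := fun k y =>
    Finset.sum_congr rfl fun x _ => by rw [hb]
  have hca : ∀ k y, ∑ x, b y x * a k x = c k y := fun k y => rfl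
  simp only [hca]
  have key : ∑ p, ∑ q, ((-∑ k, c k (p j) * c k (q j)) *
        (∏ i ∈ Finset.univ.erase j, b (p i) (q i)) * inner ℝ (T p) (T q) +
      2 * ((∏ i, b (p i) (q i)) * ∑ k, a k (p j) * inner ℝ (ψ k (j.removeNth p)) (T q))) =
      ∑ k, (-tensorForm b (fun v w => inner ℝ v w) (W k) (W k) +
        2 * tensorForm b (fun v w => inner ℝ v w) (ψ k) (W k)) := by
    rw [sum_eq_sum_insertNth j]
    simp only [sum_eq_sum_insertNth j (fun q => _ + _)]
    simp only [prod_erase_eq_prod_succAbove, Fin.prod_univ_succAbove _ j, Fin.insertNth_apply_same,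
      Fin.insertNth_apply_succAbove, Fin.removeNth_insertNth]
    have e1 : ∀ k, tensorForm b (fun v w => inner ℝ v w) (W k) (W k) =
        ∑ p' : Fin n → I, ∑ x, ∑ q' : Fin n → I, ∑ y, (∏ i, b (p' i) (q' i)) *
          (c k x * c k y *
            inner ℝ (T (j.insertNth x p')) (T (j.insertNth y q'))) := fun k => by
      unfold tensorForm
      refine Finset.sum_congr rfl fun p' _ => ?_
      rw [Finset.sum_comm]
      refine Finset.sum_congr rfl fun q' _ => ?_
      simp only [hW, sum_inner, inner_sum, real_inner_smul_left, real_inner_smul_right,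
        Finset.mul_sum]
      rw [Finset.sum_comm]
      exact Finset.sum_congr rfl fun x _ => Finset.sum_congr rfl fun y _ => by ring
    have e2 : ∀ k, tensorForm b (fun v w => inner ℝ v w) (ψ k) (W k) =
        ∑ p' : Fin n → I, ∑ x, ∑ q' : Fin n → I, ∑ y, (∏ i, b (p' i) (q' i)) *
          (b x y * a k x * inner ℝ (ψ k p') (T (j.insertNth y q'))) := fun k => by
      unfold tensorForm
      refine Finset.sum_congr rfl fun p' _ => ?_
      rw [Finset.sum_comm]
      refine Finset.sum_congr rfl fun q' _ => ?_
      simp only [hW, inner_sum, real_inner_smul_right]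
      rw [Finset.sum_comm, Finset.mul_sum]
      refine Finset.sum_congr rfl fun y _ => ?_
      rw [← hba, Finset.sum_mul, Finset.mul_sum]
    simp only [e1, e2, Finset.mul_sum, ← Finset.sum_neg_distrib, ← Finset.sum_add_distrib]
    refine Eq.symm (Finset.sum_comm.trans (Finset.sum_congr rfl fun p' _ =>
      Finset.sum_comm.trans (Finset.sum_congr rfl fun x _ =>
      Finset.sum_comm.trans (Finset.sum_congr rfl fun q' _ =>
      Finset.sum_comm.trans (Finset.sum_congr rfl fun y _ => ?_)))))
    rw [Finset.sum_add_distrib, Finset.sum_neg_distrib]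
    rw [Finset.sum_neg_distrib]
    simp only [← Finset.mul_sum, mul_assoc]
    simp only [← mul_assoc (c _ _), ← Finset.sum_mul]
    ring
  rw [key]
  refine Finset.sum_le_sum fun k _ => ?_
  -- the form is nonnegative at `ψ_k - W_k`
  have h1 := tensorForm_self_nonneg hb h (innerₗ X) (fun v => real_inner_self_nonneg)
    (fun p => ψ k p - W k p)
  have h2 := tensorForm_comm hb (B := fun v w => inner ℝ v w) (W k) (ψ k)
  simp only [real_inner_comm] at h2
  have h3 : tensorForm b (fun v w => innerₗ X v w) (fun p => ψ k p - W k p)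
      (fun p => ψ k p - W k p) = tensorForm b (fun v w => inner ℝ v w) (ψ k) (ψ k) -
      tensorForm b (fun v w => inner ℝ v w) (ψ k) (W k) -
      tensorForm b (fun v w => inner ℝ v w) (W k) (ψ k) +
      tensorForm b (fun v w => inner ℝ v w) (W k) (W k) := by
    simp only [tensorForm, innerₗ_apply_apply, inner_sub_left, inner_sub_right, mul_sub,
      Finset.sum_sub_distrib]
    ring
  linarith

end TensorForm

/-! ### The inverse of the Gram matrix -/

theorem absolutelyContinuousOnInterval_of_abs_sub_le_sum {ι : Type*} (s : Finset ι) {f : ℝ → ℝ}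
    {g : ι → ℝ → ℝ} {a b C : ℝ} (hg : ∀ i ∈ s, AbsolutelyContinuousOnInterval (g i) a b)
    (h : ∀ x ∈ uIcc a b, ∀ y ∈ uIcc a b, |f x - f y| ≤ C * ∑ i ∈ s, |g i x - g i y|) :
    AbsolutelyContinuousOnInterval f a b := by
  have h1 := (tendsto_finsetSum s fun i hi => hg i hi).const_mul C
  rw [Finset.sum_const_zero, mul_zero] at h1
  refine squeeze_zero' (Eventually.of_forall fun E => Finset.sum_nonneg fun _ _ => dist_nonneg) ?_ h1
  filter_upwards [mem_inf_of_right (mem_principal_self _)] with E hE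
  rw [Finset.sum_comm, Finset.mul_sum]
  exact Finset.sum_le_sum fun i hi => h _ (hE.1 i hi).1 _ (hE.1 i hi).2

section GramInverse

variable {I κ : Type*} [DecidableEq I] [Fintype κ] {T : ℝ}

/-- The matrix `S(t) = ε + ∑_k ∫_0^t a_k a_kᵀ`. -/
def gramMatrix (ε : ℝ) (a : κ → I → ℝ → ℝ) (t : ℝ) : Matrix I I ℝ :=
  Matrix.of fun x y => (if x = y then ε else 0) + ∫ s in (0 : ℝ)..t, ∑ k, a k x s * a k y s

theorem integrable_mul_of_memLp {f g : ℝ → ℝ} (hf : MemLp f 2 (timeMeasure T))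
    (hg : MemLp g 2 (timeMeasure T)) : Integrable (fun t => f t * g t) (timeMeasure T) :=
  hf.integrable_mul hg

theorem gramMatrix_symm (ε : ℝ) (a : κ → I → ℝ → ℝ) (t : ℝ) :
    (gramMatrix ε a t).transpose = gramMatrix ε a t := by
  ext x y
  simp only [gramMatrix, Matrix.transpose_apply, Matrix.of_apply, mul_comm, eq_comm]

theorem dotProduct_mulVec_eq_sum {I : Type*} [Fintype I] (S : Matrix I I ℝ) (v w : I → ℝ) :
    v ⬝ᵥ S.mulVec w = ∑ x, ∑ y, S x y * v x * w y := by
  simp only [dotProduct, Matrix.mulVec, Finset.mul_sum]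
  exact Finset.sum_congr rfl fun x _ => Finset.sum_congr rfl fun y _ => by ring

variable [Fintype I]

theorem gramMatrix_quadratic {ε : ℝ} {a : κ → I → ℝ → ℝ}
    (ha : ∀ k x, MemLp (a k x) 2 (timeMeasure T)) {t : ℝ} (ht : t ∈ Icc 0 T) (v : I → ℝ) :
    ∑ x, ∑ y, gramMatrix ε a t x y * v x * v y =
      ε * ∑ x, v x ^ 2 + ∑ k, ∫ s in (0 : ℝ)..t, (∑ x, a k x s * v x) ^ 2 := by
  have h0 : (0 : ℝ) ∈ Icc 0 T := ⟨le_rfl, ht.1.trans ht.2⟩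
  have hi : ∀ k x y, IntervalIntegrable (fun s => a k x s * a k y s) volume 0 t := fun k x y =>
    Integrable.intervalIntegrable_of_mem (integrable_mul_of_memLp (ha k x) (ha k y)) h0 ht
  have e1 : ∀ k, ∫ s in (0 : ℝ)..t, (∑ x, a k x s * v x) ^ 2 =
      ∑ x, ∑ y, (∫ s in (0 : ℝ)..t, a k x s * a k y s) * (v x * v y) := fun k => by
    simp only [← intervalIntegral.integral_mul_const]
    have e2 : ∀ x, ∑ y, ∫ s in (0 : ℝ)..t, a k x s * a k y s * (v x * v y) =
        ∫ s in (0 : ℝ)..t, ∑ y, a k x s * a k y s * (v x * v y) := fun x =>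
      (intervalIntegral.integral_finsetSum fun y _ => (hi k x y).mul_const _).symm
    simp only [e2]
    have e4 : ∀ x, IntervalIntegrable (fun s => ∑ y, a k x s * a k y s * (v x * v y)) volume 0 t :=
      fun x => by
        simpa only [Finset.sum_fn] using IntervalIntegrable.sum Finset.univ fun y _ =>
          (hi k x y).mul_const (v x * v y)
    rw [← intervalIntegral.integral_finsetSum fun x _ => e4 x]
    refine intervalIntegral.integral_congr fun s _ => ?_
    simp only [sq, Finset.sum_mul_sum]
    exact Finset.sum_congr rfl fun x _ => Finset.sum_congr rfl fun y _ => by ring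
  have e3 : ∀ x y, gramMatrix ε a t x y =
      (if x = y then ε else 0) + ∑ k, ∫ s in (0 : ℝ)..t, a k x s * a k y s := fun x y => by
    rw [gramMatrix, Matrix.of_apply, intervalIntegral.integral_finsetSum fun k _ => hi k x y]
  simp only [e1, e3, add_mul, Finset.sum_add_distrib, Finset.mul_sum]
  congr 1
  · refine Finset.sum_congr rfl fun x _ => ?_
    rw [Finset.sum_eq_single x (fun y _ hy => by simp [Ne.symm hy]) (by simp)]
    simp [sq, mul_assoc]
  · rw [Finset.sum_comm' (t' := Finset.univ) (s' := fun _ => Finset.univ) (by simp)]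
    refine Finset.sum_comm.trans ?_
    simp only [Finset.sum_mul]
    refine (Finset.sum_congr rfl fun x _ => Finset.sum_comm).trans (Finset.sum_comm.trans ?_)
    exact Finset.sum_congr rfl fun k _ => Finset.sum_congr rfl fun x _ =>
      Finset.sum_congr rfl fun y _ => by ring

theorem le_gramMatrix_quadratic {ε : ℝ} {a : κ → I → ℝ → ℝ}
    (ha : ∀ k x, MemLp (a k x) 2 (timeMeasure T)) {t : ℝ} (ht : t ∈ Icc 0 T) (v : I → ℝ) :
    ε * ∑ x, v x ^ 2 ≤ ∑ x, ∑ y, gramMatrix ε a t x y * v x * v y := by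
  rw [gramMatrix_quadratic ha ht, le_add_iff_nonneg_right]
  exact Finset.sum_nonneg fun k _ => intervalIntegral.integral_nonneg ht.1 fun s _ => sq_nonneg _

theorem isUnit_det_gramMatrix {ε : ℝ} (hε : 0 < ε) {a : κ → I → ℝ → ℝ}
    (ha : ∀ k x, MemLp (a k x) 2 (timeMeasure T)) {t : ℝ} (ht : t ∈ Icc 0 T) :
    IsUnit (gramMatrix ε a t).det := by
  rw [isUnit_iff_ne_zero]
  intro h
  obtain ⟨v, hv, hv0⟩ := Matrix.exists_mulVec_eq_zero_iff.2 h
  have h1 := le_gramMatrix_quadratic (ε := ε) ha ht v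
  rw [← dotProduct_mulVec_eq_sum, hv0, dotProduct_zero] at h1
  have h2 : ∑ x, v x ^ 2 = 0 :=
    le_antisymm (by nlinarith) (Finset.sum_nonneg fun x _ => sq_nonneg _)
  refine hv (funext fun x => ?_)
  exact pow_eq_zero_iff two_ne_zero |>.1
    ((Finset.sum_eq_zero_iff_of_nonneg fun x _ => sq_nonneg _).1 h2 x (Finset.mem_univ x))

/-- By Bessel's inequality `S(t) ≤ 1 + ε`, so that `S(t)⁻¹ ≥ (1 + ε)⁻¹`. The proof evaluates the
form of `S` at `S⁻¹ v - (1 + ε)⁻¹ v`. -/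
theorem le_inv_gramMatrix_quadratic {ε : ℝ} (hε : 0 < ε) {a : κ → I → ℝ → ℝ}
    (ha : ∀ k x, MemLp (a k x) 2 (timeMeasure T)) {t : ℝ} (ht : t ∈ Icc 0 T)
    (hle : ∀ v : I → ℝ, ∑ k, ∫ s in (0 : ℝ)..t, (∑ x, a k x s * v x) ^ 2 ≤ ∑ x, v x ^ 2)
    (v : I → ℝ) :
    (1 + ε)⁻¹ * ∑ x, v x ^ 2 ≤ ∑ x, ∑ y, (gramMatrix ε a t)⁻¹ x y * v x * v y := by
  set S := gramMatrix ε a t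
  have hu := isUnit_det_gramMatrix hε ha ht
  set w := S⁻¹.mulVec v
  have hSw : S.mulVec w = v := by
    rw [Matrix.mulVec_mulVec, Matrix.mul_nonsing_inv _ hu, Matrix.one_mulVec]
  have hvS : ∀ z, z ⬝ᵥ S.mulVec v = v ⬝ᵥ S.mulVec z := fun z => by
    rw [Matrix.dotProduct_mulVec, ← Matrix.mulVec_transpose, gramMatrix_symm, dotProduct_comm]
  have hvv : v ⬝ᵥ v = ∑ x, v x ^ 2 := by simp [dotProduct, sq]
  have h1 := le_gramMatrix_quadratic (ε := ε) ha ht (w - (1 + ε)⁻¹ • v)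
  have h2 : v ⬝ᵥ S.mulVec v ≤ (1 + ε) * ∑ x, v x ^ 2 := by
    rw [dotProduct_mulVec_eq_sum, gramMatrix_quadratic ha ht]
    linarith [hle v]
  rw [← dotProduct_mulVec_eq_sum, Matrix.mulVec_sub, Matrix.mulVec_smul, hSw, sub_dotProduct,
    dotProduct_sub, dotProduct_sub, smul_dotProduct, smul_dotProduct, dotProduct_smul,
    dotProduct_smul, hvS w, hSw, hvv] at h1
  rw [← dotProduct_mulVec_eq_sum]
  have h3 : 0 ≤ ε * ∑ x, (w - (1 + ε)⁻¹ • v) x ^ 2 :=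
    mul_nonneg hε.le (Finset.sum_nonneg fun x _ => sq_nonneg _)
  have h4 : (1 + ε)⁻¹ * ((1 + ε)⁻¹ * (v ⬝ᵥ S.mulVec v)) ≤ (1 + ε)⁻¹ * ∑ x, v x ^ 2 := by
    have h5 : (1 + ε)⁻¹ * (v ⬝ᵥ S.mulVec v) ≤ ∑ x, v x ^ 2 := by
      rw [inv_mul_le_iff₀ (by positivity)]
      exact h2
    gcongr
  simp only [smul_eq_mul] at h1
  rw [dotProduct_comm w v] at h1
  linarith

theorem inv_sub_inv_apply {S R : Matrix I I ℝ} (hS : IsUnit S.det) (hR : IsUnit R.det) (x y : I) :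
    S⁻¹ x y - R⁻¹ x y = -∑ w, ∑ z, S⁻¹ x z * (S z w - R z w) * R⁻¹ w y := by
  have h : S⁻¹ - R⁻¹ = -(S⁻¹ * (S - R) * R⁻¹) := by
    rw [Matrix.mul_sub, Matrix.sub_mul, Matrix.nonsing_inv_mul _ hS, Matrix.one_mul,
      Matrix.mul_assoc, Matrix.mul_nonsing_inv _ hR, Matrix.mul_one, neg_sub]
  have h1 := congrFun (congrFun h x) y
  rw [Matrix.sub_apply, Matrix.neg_apply, Matrix.mul_apply] at h1
  simpa only [Matrix.mul_apply, Matrix.sub_apply, Finset.sum_mul] using h1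

/-- The inverse `b = S⁻¹` of the Gram matrix moves with velocity `-b S' b = -∑_k (b a_k) (b a_k)ᵀ`.
-/
theorem hasACDeriv_inv_gramMatrix (hT : 0 ≤ T) {ε : ℝ} (hε : 0 < ε) {a : κ → I → ℝ → ℝ}
    (ha : ∀ k x, MemLp (a k x) 2 (timeMeasure T)) (x y : I) :
    HasACDeriv T (fun t => (gramMatrix ε a t)⁻¹ x y)
      (fun t => -∑ k, (∑ z, (gramMatrix ε a t)⁻¹ x z * a k z t) *
        (∑ z, (gramMatrix ε a t)⁻¹ y z * a k z t)) := by
  set S := gramMatrix ε a with hS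
  have hu : ∀ t ∈ Icc 0 T, IsUnit (S t).det := fun t ht => isUnit_det_gramMatrix hε ha ht
  have hSac : ∀ z w, HasACDeriv T (fun t => S t z w) (fun t => ∑ k, a k z t * a k w t) :=
    fun z w => hasACDeriv_integral hT
      (integrable_finsetSum _ fun k _ => integrable_mul_of_memLp (ha k z) (ha k w)) _
  have hcont : ∀ z w, ContinuousOn (fun t => (S t)⁻¹ z w) (Icc 0 T) := fun z w => by
    have h1 : ContinuousOn S (Icc 0 T) := continuousOn_pi.2 fun z => continuousOn_pi.2 fun w => by
      simpa [uIcc_of_le hT] using (hSac z w).ac.continuousOn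
    have h2 : ContinuousOn (fun t => (S t).det⁻¹ * (S t).adjugate z w) (Icc 0 T) := by
      refine ContinuousOn.mul (ContinuousOn.inv₀ ?_ fun t ht => (hu t ht).ne_zero) ?_
      · exact (continuous_id.matrix_det).comp_continuousOn h1
      · exact ((continuous_id.matrix_adjugate).matrix_elem z w).comp_continuousOn h1
    refine h2.congr fun t _ => ?_
    simp only [Matrix.inv_def, Ring.inverse_eq_inv', Matrix.smul_apply, smul_eq_mul]
  constructor
  · have hbd : ∀ z w, ∃ C, ∀ t ∈ Icc 0 T, ‖(S t)⁻¹ z w‖ ≤ C := fun z w =>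
      isCompact_Icc.exists_bound_of_continuousOn (hcont z w)
    choose C hC using hbd
    have hC0 : ∀ z w, 0 ≤ C z w := fun z w => (norm_nonneg _).trans (hC z w 0 ⟨le_rfl, hT⟩)
    refine absolutelyContinuousOnInterval_of_abs_sub_le_sum Finset.univ (C := ∑ w, ∑ z, C x z * C w y)
      (g := fun (p : I × I) t => S t p.1 p.2) (fun p _ => (hSac p.1 p.2).ac) fun t ht s hs => ?_
    rw [uIcc_of_le hT] at ht hs
    rw [inv_sub_inv_apply (hu t ht) (hu s hs), abs_neg, Finset.sum_mul]
    refine (Finset.abs_sum_le_sum_abs _ _).trans (Finset.sum_le_sum fun w _ => ?_)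
    rw [Finset.sum_mul]
    refine (Finset.abs_sum_le_sum_abs _ _).trans (Finset.sum_le_sum fun z _ => ?_)
    have h1 : |S t z w - S s z w| ≤ ∑ p : I × I, |S t p.1 p.2 - S s p.1 p.2| :=
      Finset.single_le_sum (f := fun p : I × I => |S t p.1 p.2 - S s p.1 p.2|)
        (fun p _ => abs_nonneg _) (Finset.mem_univ (z, w))
    rw [abs_mul, abs_mul]
    calc _ ≤ C x z * (∑ p : I × I, |S t p.1 p.2 - S s p.1 p.2|) * C w y := by
          gcongr
          · exact mul_nonneg (hC0 x z) (Finset.sum_nonneg fun p _ => abs_nonneg _)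
          · exact hC0 x z
          · exact hC x z t ht
          · exact hC w y s hs
      _ = _ := by ring
  · filter_upwards [ae_timeMeasure_mem T, ae_all_iff.2 fun z => ae_all_iff.2 fun w =>
      (hSac z w).hasDerivAt] with t ht hd
    have ht' := Ioo_subset_Icc_self ht
    rw [hasDerivAt_iff_tendsto_slope]
    have h1 : Tendsto (fun s => -∑ w, ∑ z, (S s)⁻¹ x z * slope (fun r => S r z w) t s * (S t)⁻¹ w y)
        (𝓝[≠] t) (𝓝 (-∑ w, ∑ z, (S t)⁻¹ x z * (∑ k, a k z t * a k w t) * (S t)⁻¹ w y)) := by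
      refine Tendsto.neg (tendsto_finsetSum _ fun w _ => tendsto_finsetSum _ fun z _ => ?_)
      refine Tendsto.mul_const _ (Tendsto.mul ?_ (hasDerivAt_iff_tendsto_slope.1 (hd z w)))
      exact ((hcont x z).continuousAt (Icc_mem_nhds ht.1 ht.2)).tendsto.mono_left
        nhdsWithin_le_nhds
    have h2 : -∑ w, ∑ z, (S t)⁻¹ x z * (∑ k, a k z t * a k w t) * (S t)⁻¹ w y =
        -∑ k, (∑ z, (S t)⁻¹ x z * a k z t) * (∑ z, (S t)⁻¹ y z * a k z t) := by
      have hsym : ∀ w, (S t)⁻¹ w y = (S t)⁻¹ y w := fun w => by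
        have h3 : ((S t)⁻¹).transpose = (S t)⁻¹ := by
          rw [Matrix.transpose_nonsing_inv, gramMatrix_symm]
        exact congrFun (congrFun h3 y) w
      simp only [hsym, Finset.mul_sum, Finset.sum_mul]
      congr 1
      refine (Finset.sum_congr rfl fun w _ => Finset.sum_comm).trans (Finset.sum_comm.trans ?_)
      exact Finset.sum_congr rfl fun k _ => Finset.sum_congr rfl fun w _ =>
        Finset.sum_congr rfl fun z _ => by ring
    rw [← h2]
    refine h1.congr' ?_
    filter_upwards [nhdsWithin_le_nhds (Icc_mem_nhds ht.1 ht.2)] with s hs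
    simp only [slope_def_field]
    rw [inv_sub_inv_apply (hu s hs) (hu t ht'), neg_div, Finset.sum_div]
    congr 1
    refine Finset.sum_congr rfl fun w _ => ?_
    rw [Finset.sum_div]
    exact Finset.sum_congr rfl fun z _ => by ring

end GramInverse

/-! ### Source terms produced by the deterministic equation -/

section WordEstimate

variable {T : ℝ} {V H : Type*} [NormedAddCommGroup V] [InnerProductSpace ℝ V]
  [NormedAddCommGroup H] [InnerProductSpace ℝ H] {ι : V →L[ℝ] H}

theorem integrable_norm_sq_of_memLp {E : Type*} [NormedAddCommGroup E] {f : ℝ → E}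
    (hf : MemLp f 2 (timeMeasure T)) : Integrable (fun t => ‖f t‖ ^ 2) (timeMeasure T) :=
  hf.integrable_norm_pow two_ne_zero

theorem integrable_norm_mul_norm_of_memLp {E F : Type*} [NormedAddCommGroup E]
    [NormedAddCommGroup F] {f : ℝ → E} {g : ℝ → F} (hf : MemLp f 2 (timeMeasure T))
    (hg : MemLp g 2 (timeMeasure T)) : Integrable (fun t => ‖f t‖ * ‖g t‖) (timeMeasure T) :=
  hf.norm.integrable_mul hg.norm

theorem integral_le_of_ae_le {f g : ℝ → ℝ} (hf : Integrable f (timeMeasure T))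
    (hg : Integrable g (timeMeasure T)) (h : ∀ᵐ s ∂(timeMeasure T), f s ≤ g s) {t : ℝ}
    (ht : t ∈ Icc 0 T) : ∫ s in (0 : ℝ)..t, f s ≤ ∫ s in (0 : ℝ)..t, g s := by
  have h0 : (0 : ℝ) ∈ Icc 0 T := ⟨le_rfl, ht.1.trans ht.2⟩
  refine intervalIntegral.integral_mono_ae_restrict ht.1
    (Integrable.intervalIntegrable_of_mem hf h0 ht) (Integrable.intervalIntegrable_of_mem hg h0 ht) ?_
  rw [timeMeasure_eq_restrict_Ioc] at h
  rw [← restrict_Ioc_eq_restrict_Icc]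
  exact ae_restrict_of_ae_restrict_of_subset (Ioc_subset_Ioc_right ht.2) h

theorem integral_add_of_mem {f g : ℝ → ℝ} (hf : Integrable f (timeMeasure T))
    (hg : Integrable g (timeMeasure T)) {t : ℝ} (ht : t ∈ Icc 0 T) :
    ∫ s in (0 : ℝ)..t, (f s + g s) = (∫ s in (0 : ℝ)..t, f s) + ∫ s in (0 : ℝ)..t, g s := by
  have h0 : (0 : ℝ) ∈ Icc 0 T := ⟨le_rfl, ht.1.trans ht.2⟩
  exact intervalIntegral.integral_add (Integrable.intervalIntegrable_of_mem hf h0 ht)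
    (Integrable.intervalIntegrable_of_mem hg h0 ht)

variable [CompleteSpace V] [CompleteSpace H]

/-- The constant in the energy estimate of the deterministic equation. -/
def sourceConst (T C₁ C₂ : ℝ) : ℝ :=
  3 + 2 * (1 + 2 * C₁ * T * Real.exp (2 * C₁ * T)) + |C₂| * T * Real.exp (2 * C₁ * T)

/-- The coercivity of `A` controls the source terms that the solution of the deterministic
equation produces in the equations of higher order. -/
theorem IsPath.integral_source_le {κ : Type*} [Fintype κ] (hT : 0 ≤ T) (hι : Function.Injective ι)
    (hd : DenseRange ι) {A : ℝ → V →L[ℝ] StrongDual ℝ V} {M : κ → ℝ → V →L[ℝ] H} {δ C₁ C₂ : ℝ}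
    (hδ : 0 < δ) (hC₁ : 0 ≤ C₁)
    (hcoer : ∀ t ∈ Icc 0 T, ∀ v, A t v v + δ * ‖v‖ ^ 2 ≤ C₁ * ‖ι v‖ ^ 2)
    (hpar : ∀ t ∈ Icc 0 T, ∀ v, 2 * A t v v + ∑ k, ‖M k t v‖ ^ 2 ≤ C₂ * ‖ι v‖ ^ 2)
    {f : ℝ → StrongDual ℝ V} {h₀ : H} {u : ℝ → V} {y : ℝ → H}
    (hy : IsPath T ι h₀ (fun t => A t (u t) + f t) u y) (hf : MemLp f 2 (timeMeasure T))
    (hMu : ∀ k, MemLp (fun t => M k t (u t)) 2 (timeMeasure T)) {t : ℝ} (ht : t ∈ Icc 0 T) :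
    ∫ s in (0 : ℝ)..t, (2 * (‖f s‖ * ‖u s‖) + ∑ k, ‖M k s (u s)‖ ^ 2) ≤
      sourceConst T C₁ C₂ * (‖h₀‖ ^ 2 + δ⁻¹ * ∫ s in (0 : ℝ)..t, ‖f s‖ ^ 2) := by
  have hu := hy.memLp
  have hfi := integrable_norm_sq_of_memLp hf
  have hui := integrable_norm_sq_of_memLp hu
  have hfu := integrable_norm_mul_norm_of_memLp hf hu
  have hιu : Integrable (fun s => ‖ι (u s)‖ ^ 2) (timeMeasure T) :=
    integrable_norm_sq_of_memLp (ι.comp_memLp' hu)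
  have hMi := integrable_finsetSum Finset.univ fun k _ => integrable_norm_sq_of_memLp (hMu k)
  have hφu := (integrable_dual_apply hy.memLp_deriv hu).const_mul 2
  set E := Real.exp (2 * C₁ * T)
  set D := ‖h₀‖ ^ 2 + δ⁻¹ * ∫ s in (0 : ℝ)..t, ‖f s‖ ^ 2 with hD
  have hE : 1 ≤ E := Real.one_le_exp (by positivity)
  have hsq : ∀ {F : ℝ → ℝ} {r}, 0 ≤ r → (∀ s, 0 ≤ F s) → 0 ≤ ∫ s in (0 : ℝ)..r, F s :=
    fun hr hF => intervalIntegral.integral_nonneg hr fun s _ => hF s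
  have hD0 : 0 ≤ D := add_nonneg (sq_nonneg _)
    (mul_nonneg (inv_nonneg.2 hδ.le) (hsq ht.1 fun s => sq_nonneg _))
  have hyoung : ∀ s, 2 * (‖f s‖ * ‖u s‖) ≤ δ⁻¹ * ‖f s‖ ^ 2 + δ * ‖u s‖ ^ 2 := fun s => by
    have h1 : 0 ≤ δ⁻¹ * (‖f s‖ - δ * ‖u s‖) ^ 2 := by positivity
    have h2 : δ⁻¹ * (‖f s‖ - δ * ‖u s‖) ^ 2 = δ⁻¹ * ‖f s‖ ^ 2 - 2 * (‖f s‖ * ‖u s‖) +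
        δ * ‖u s‖ ^ 2 := by
      field_simp
      ring
    linarith
  have hfle : ∀ s, f s (u s) ≤ ‖f s‖ * ‖u s‖ := fun s =>
    (le_abs_self _).trans ((f s).le_opNorm (u s))
  have hcoer' : ∀ᵐ s ∂(timeMeasure T), 2 * (A s (u s) + f s) (u s) ≤
      2 * C₁ * ‖ι (u s)‖ ^ 2 + δ⁻¹ * ‖f s‖ ^ 2 - δ * ‖u s‖ ^ 2 := by
    filter_upwards [ae_timeMeasure_mem T] with s hs
    have h1 := hcoer s (Ioo_subset_Icc_self hs) (u s)
    rw [_root_.add_apply]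
    linarith [hyoung s, hfle s]
  have hyle : ∀ r ∈ Icc 0 t, ‖y r‖ ^ 2 ≤ E * D := fun r hr => by
    have hr' : r ∈ Icc 0 T := ⟨hr.1, hr.2.trans ht.2⟩
    refine (hy.norm_sq_le hT hι hd (c := 2 * C₁) (by positivity) (hfi.const_mul δ⁻¹)
      (Eventually.of_forall fun s => by positivity) ?_ hr').trans ?_
    · filter_upwards [hcoer'] with s hs
      nlinarith [mul_nonneg hδ.le (sq_nonneg ‖u s‖)]
    · rw [intervalIntegral.integral_const_mul]
      have h1 : ∫ s in (0 : ℝ)..r, ‖f s‖ ^ 2 ≤ ∫ s in (0 : ℝ)..t, ‖f s‖ ^ 2 :=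
        intervalIntegral.integral_mono_interval le_rfl hr.1 hr.2
          (Eventually.of_forall fun s => sq_nonneg _)
          (Integrable.intervalIntegrable_of_mem hfi ⟨le_rfl, hT⟩ ht)
      have h2 : 0 ≤ ∫ s in (0 : ℝ)..r, ‖f s‖ ^ 2 := hsq hr.1 fun s => sq_nonneg _
      refine mul_le_mul ?_ ?_ (by positivity) (by positivity)
      · exact Real.exp_le_exp.2 (mul_le_mul_of_nonneg_left hr'.2 (by positivity))
      · exact add_le_add le_rfl (mul_le_mul_of_nonneg_left h1 (inv_nonneg.2 hδ.le))
  have hιint : ∫ s in (0 : ℝ)..t, ‖ι (u s)‖ ^ 2 ≤ T * (E * D) := by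
    have h1 : ∫ s in (0 : ℝ)..t, ‖ι (u s)‖ ^ 2 ≤ ∫ _ in (0 : ℝ)..t, E * D := by
      refine intervalIntegral.integral_mono_ae_restrict ht.1
        (Integrable.intervalIntegrable_of_mem hιu ⟨le_rfl, hT⟩ ht) intervalIntegrable_const ?_
      rw [← restrict_Ioc_eq_restrict_Icc]
      have h2 := hy.ae_eq
      rw [timeMeasure_eq_restrict_Ioc] at h2
      filter_upwards [ae_restrict_of_ae_restrict_of_subset (Ioc_subset_Ioc_right ht.2) h2,
        ae_restrict_mem measurableSet_Ioc] with s h3 h4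
      rw [← h3]
      exact hyle s (Ioc_subset_Icc_self h4)
    rw [intervalIntegral.integral_const, sub_zero, smul_eq_mul] at h1
    have := ht.2
    exact h1.trans (by gcongr)
  have henergy := hy.norm_sq hι hd ht
  rw [← intervalIntegral.integral_const_mul] at henergy
  have hδu : δ * ∫ s in (0 : ℝ)..t, ‖u s‖ ^ 2 ≤ (1 + 2 * C₁ * T * E) * D := by
    have h1 := integral_le_of_ae_le (hφu.add (hui.const_mul δ))
      ((hιu.const_mul (2 * C₁)).add (hfi.const_mul δ⁻¹)) (by
        filter_upwards [hcoer'] with s hs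
        simp only [Pi.add_apply]
        linarith) ht
    simp only [Pi.add_apply] at h1
    rw [integral_add_of_mem hφu (hui.const_mul δ) ht,
      integral_add_of_mem (hιu.const_mul (2 * C₁)) (hfi.const_mul δ⁻¹) ht,
      intervalIntegral.integral_const_mul δ, intervalIntegral.integral_const_mul (2 * C₁),
      intervalIntegral.integral_const_mul δ⁻¹] at h1
    have h2 := mul_le_mul_of_nonneg_left hιint (by positivity : 0 ≤ 2 * C₁)
    nlinarith [sq_nonneg ‖y t‖]
  have hfuint : ∫ s in (0 : ℝ)..t, 2 * (‖f s‖ * ‖u s‖) ≤ (2 + 2 * C₁ * T * E) * D := by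
    have h1 := integral_le_of_ae_le (hfu.const_mul 2) ((hfi.const_mul δ⁻¹).add (hui.const_mul δ))
      (Eventually.of_forall hyoung) ht
    simp only [Pi.add_apply] at h1
    rw [integral_add_of_mem (hfi.const_mul δ⁻¹) (hui.const_mul δ) ht,
      intervalIntegral.integral_const_mul δ, intervalIntegral.integral_const_mul δ⁻¹] at h1
    nlinarith [sq_nonneg ‖h₀‖]
  have hMint : ∫ s in (0 : ℝ)..t, ∑ k, ‖M k s (u s)‖ ^ 2 ≤
      (3 + 2 * C₁ * T * E + |C₂| * T * E) * D := by
    have h1 := integral_le_of_ae_le (hφu.add hMi)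
      ((hιu.const_mul |C₂|).add (hfu.const_mul 2)) (by
        filter_upwards [ae_timeMeasure_mem T] with s hs
        have h1 := hpar s (Ioo_subset_Icc_self hs) (u s)
        have h2 : C₂ * ‖ι (u s)‖ ^ 2 ≤ |C₂| * ‖ι (u s)‖ ^ 2 := by
          gcongr
          exact le_abs_self _
        simp only [Pi.add_apply, _root_.add_apply]
        linarith [hfle s]) ht
    simp only [Pi.add_apply] at h1
    rw [integral_add_of_mem hφu hMi ht,
      integral_add_of_mem (hιu.const_mul |C₂|) (hfu.const_mul 2) ht,
      intervalIntegral.integral_const_mul |C₂|] at h1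
    have h2 := mul_le_mul_of_nonneg_left hιint (abs_nonneg C₂)
    have h3 : 0 ≤ δ⁻¹ * ∫ s in (0 : ℝ)..t, ‖f s‖ ^ 2 :=
      mul_nonneg (inv_nonneg.2 hδ.le) (hsq ht.1 fun s => sq_nonneg _)
    nlinarith [sq_nonneg ‖y t‖]
  rw [integral_add_of_mem (hfu.const_mul 2) hMi ht]
  refine (add_le_add hfuint hMint).trans (le_of_eq ?_)
  simp only [sourceConst]
  ring

end WordEstimate

/-! ### Energy of a system indexed by words -/

section WordEnergy

variable {T : ℝ} {V H : Type*} [NormedAddCommGroup V] [InnerProductSpace ℝ V]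
  [NormedAddCommGroup H] [InnerProductSpace ℝ H] {ι : V →L[ℝ] H}
  {I κ : Type*} [Fintype I] [Fintype κ] {n : ℕ}

theorem sum_rotate {α β γ : Type*} [Fintype α] [Fintype β] [Fintype γ] (F : α → β → γ → ℝ) :
    ∑ a, ∑ b, ∑ c, F a b c = ∑ b, ∑ c, ∑ a, F a b c :=
  Finset.sum_comm.trans (Finset.sum_congr rfl fun _ _ => Finset.sum_comm)

/-- The derivative of the tensor form of a family of paths, the matrix depending on time. -/
theorem hasACDeriv_tensorForm [CompleteSpace V] [CompleteSpace H] (hT : 0 ≤ T)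
    (hι : Function.Injective ι) (hd : DenseRange ι) {b b' : I → I → ℝ → ℝ}
    (hb : ∀ x y, HasACDeriv T (b x y) (b' x y)) {h₀ : (Fin n → I) → H}
    {φ : (Fin n → I) → ℝ → StrongDual ℝ V} {u : (Fin n → I) → ℝ → V} {y : (Fin n → I) → ℝ → H}
    (hy : ∀ p, IsPath T ι (h₀ p) (φ p) (u p) (y p)) :
    HasACDeriv T (fun t => tensorForm (fun x z => b x z t) (fun v w => inner ℝ v w)
        (fun p => y p t) (fun p => y p t))
      (fun t => ∑ p, ∑ q, ((∑ j, b' (p j) (q j) t * ∏ i ∈ Finset.univ.erase j, b (p i) (q i) t) *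
        inner ℝ (y p t) (y q t) +
        (∏ j, b (p j) (q j) t) * (φ p t (u q t) + φ q t (u p t)))) :=
  HasACDeriv.sum _ fun p _ => HasACDeriv.sum _ fun q _ =>
    (HasACDeriv.prod _ fun j _ => hb (p j) (q j)).mul ((hy p).hasACDeriv_inner hT hι hd (hy q))

theorem sum_sum_symm {b : I → I → ℝ} (hb : ∀ x y, b x y = b y x)
    (F : (Fin n → I) → (Fin n → I) → ℝ) :
    ∑ p, ∑ q, (∏ j, b (p j) (q j)) * (F p q + F q p) =
      ∑ p, ∑ q, 2 * ((∏ j, b (p j) (q j)) * F p q) := by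
  have h : ∑ p : Fin n → I, ∑ q : Fin n → I, (∏ j, b (p j) (q j)) * F q p =
      ∑ p, ∑ q, (∏ j, b (p j) (q j)) * F p q := by
    rw [Finset.sum_comm]
    simp only [hb]
  simp only [mul_add, Finset.sum_add_distrib, h, two_mul]

variable [DecidableEq I]

/-- The derivative of the tensor form at a fixed time, for the equation of order `n + 1`. Each of
the `n + 1` slots contributes one form of the sources `ψ`. -/
theorem tensorForm_deriv_le {b : I → I → ℝ} (hb : ∀ x y, b x y = b y x)
    (hpos : ∀ v : I → ℝ, 0 ≤ ∑ x, ∑ y, b x y * v x * v y) (a : κ → I → ℝ)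
    (A : V →L[ℝ] StrongDual ℝ V) (u : (Fin (n + 1) → I) → V) (ψ : κ → (Fin n → I) → H) :
    ∑ p, ∑ q, ((∑ j, (-∑ k, (∑ x, b (p j) x * a k x) * (∑ x, b (q j) x * a k x)) *
          ∏ i ∈ Finset.univ.erase j, b (p i) (q i)) * inner ℝ (ι (u p)) (ι (u q)) +
        (∏ j, b (p j) (q j)) *
          ((A (u p) + ∑ j, ∑ k, a k (p j) • toDual ι (ψ k (j.removeNth p))) (u q) +
           (A (u q) + ∑ j, ∑ k, a k (q j) • toDual ι (ψ k (j.removeNth q))) (u p))) ≤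
      2 * tensorForm b (fun v w => A v w) u u +
        (n + 1) * ∑ k, tensorForm b (fun v w => inner ℝ v w) (ψ k) (ψ k) := by
  have h1 : ∀ p q, (A (u p) + ∑ j, ∑ k, a k (p j) • toDual ι (ψ k (j.removeNth p))) (u q) =
      A (u p) (u q) + ∑ j, ∑ k, a k (p j) * inner ℝ (ψ k (j.removeNth p)) (ι (u q)) :=
    fun p q => by
      rw [_root_.add_apply, _root_.sum_apply]
      simp only [_root_.sum_apply, _root_.smul_apply, smul_eq_mul, toDual_apply]
  simp only [Finset.sum_add_distrib]
  rw [sum_sum_symm hb fun p q =>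
    (A (u p) + ∑ j, ∑ k, a k (p j) • toDual ι (ψ k (j.removeNth p))) (u q)]
  have h2 : ∑ p : Fin (n + 1) → I, ∑ q : Fin (n + 1) → I, 2 * ((∏ j, b (p j) (q j)) *
      (A (u p) + ∑ j, ∑ k, a k (p j) • toDual ι (ψ k (j.removeNth p))) (u q)) =
      2 * tensorForm b (fun v w => A v w) u u +
        ∑ j : Fin (n + 1), ∑ p : Fin (n + 1) → I, ∑ q : Fin (n + 1) → I, 2 * ((∏ j, b (p j) (q j)) *
        ∑ k, a k (p j) * inner ℝ (ψ k (j.removeNth p)) (ι (u q))) := by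
    unfold tensorForm
    rw [sum_rotate (α := Fin (n + 1)), Finset.mul_sum, ← Finset.sum_add_distrib]
    refine Finset.sum_congr rfl fun p _ => ?_
    rw [Finset.mul_sum, ← Finset.sum_add_distrib]
    refine Finset.sum_congr rfl fun q _ => ?_
    rw [h1, mul_add, mul_add, Finset.mul_sum, Finset.mul_sum]
  have h3 : ∑ p, ∑ q, (∑ j, (-∑ k, (∑ x, b (p j) x * a k x) * (∑ x, b (q j) x * a k x)) *
      ∏ i ∈ Finset.univ.erase j, b (p i) (q i)) * inner ℝ (ι (u p)) (ι (u q)) =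
      ∑ j, ∑ p, ∑ q, (-∑ k, (∑ x, b (p j) x * a k x) * (∑ x, b (q j) x * a k x)) *
      (∏ i ∈ Finset.univ.erase j, b (p i) (q i)) * inner ℝ (ι (u p)) (ι (u q)) := by
    rw [sum_rotate (α := Fin (n + 1))]
    refine Finset.sum_congr rfl fun p _ => Finset.sum_congr rfl fun q _ => ?_
    rw [Finset.sum_mul]
  rw [h2, h3, add_left_comm, ← Finset.sum_add_distrib]
  gcongr
  have h4 := Finset.sum_le_sum fun (j : Fin (n + 1)) (_ : j ∈ Finset.univ) =>
    slot_le hb hpos a (fun p => ι (u p)) ψ j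
  rw [Finset.sum_const, Finset.card_univ, Fintype.card_fin, nsmul_eq_mul, Nat.cast_succ] at h4
  simpa only [Finset.sum_add_distrib] using h4

/-- The parabolicity condition, tensorized. -/
theorem tensorForm_parabolic {b : I → I → ℝ} (hb : ∀ x y, b x y = b y x)
    (hpos : ∀ v : I → ℝ, 0 ≤ ∑ x, ∑ y, b x y * v x * v y) {A : V →L[ℝ] StrongDual ℝ V}
    {M : κ → V →L[ℝ] H} {C₂ : ℝ}
    (hpar : ∀ v, 2 * A v v + ∑ k, ‖M k v‖ ^ 2 ≤ C₂ * ‖ι v‖ ^ 2) (u : (Fin n → I) → V) :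
    2 * tensorForm b (fun v w => A v w) u u +
        ∑ k, tensorForm b (fun v w => inner ℝ v w) (fun p => M k (u p)) (fun p => M k (u p)) ≤
      C₂ * tensorForm b (fun v w => inner ℝ v w) (fun p => ι (u p)) (fun p => ι (u p)) := by
  let B : V →ₗ[ℝ] V →ₗ[ℝ] ℝ := LinearMap.mk₂ ℝ
    (fun v w => C₂ * inner ℝ (ι v) (ι w) - 2 * A v w - ∑ k, inner ℝ (M k v) (M k w))
    (fun v v' w => by
      simp only [map_add, _root_.add_apply, inner_add_left, Finset.sum_add_distrib]
      ring)
    (fun c v w => by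
      simp only [map_smul, _root_.smul_apply, real_inner_smul_left, smul_eq_mul, ← Finset.mul_sum]
      ring)
    (fun v w w' => by
      simp only [map_add, inner_add_right, Finset.sum_add_distrib]
      ring)
    (fun c v w => by
      simp only [map_smul, real_inner_smul_right, smul_eq_mul, ← Finset.mul_sum]
      ring)
  have hB : ∀ v w, B v w =
      C₂ * inner ℝ (ι v) (ι w) - 2 * A v w - ∑ k, inner ℝ (M k v) (M k w) := fun v w => rfl
  have h1 := tensorForm_self_nonneg hb hpos B (fun v => by
    rw [hB]
    simp only [real_inner_self_eq_norm_sq]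
    linarith [hpar v]) u
  have h2 : tensorForm b (fun v w => B v w) u u =
      C₂ * tensorForm b (fun v w => inner ℝ v w) (fun p => ι (u p)) (fun p => ι (u p)) -
        2 * tensorForm b (fun v w => A v w) u u -
        ∑ k, tensorForm b (fun v w => inner ℝ v w) (fun p => M k (u p)) (fun p => M k (u p)) := by
    unfold tensorForm
    rw [sum_rotate (α := κ), Finset.mul_sum, Finset.mul_sum, ← Finset.sum_sub_distrib,
      ← Finset.sum_sub_distrib]
    refine Finset.sum_congr rfl fun p _ => ?_
    rw [Finset.mul_sum, Finset.mul_sum, ← Finset.sum_sub_distrib, ← Finset.sum_sub_distrib]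
    refine Finset.sum_congr rfl fun q _ => ?_
    simp only [hB, ← Finset.mul_sum]
    ring
  linarith

end WordEnergy

/-! ### The estimate for systems indexed by words -/

section WordSum

variable {T : ℝ} {V H : Type*} [NormedAddCommGroup V] [InnerProductSpace ℝ V]
  [NormedAddCommGroup H] [InnerProductSpace ℝ H] {ι : V →L[ℝ] H}
  {I κ : Type*} [Fintype I] [Fintype κ]

theorem tensorForm_zero_words {X : Type*} (b : I → I → ℝ) (B : X → X → ℝ) (S : (Fin 0 → I) → X) :
    tensorForm b B S S = B (S default) (S default) := by
  simp [tensorForm]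

theorem tensorForm_zero {X : Type*} [NormedAddCommGroup X] [InnerProductSpace ℝ X] {n : ℕ}
    (b : I → I → ℝ) (T : (Fin n → I) → X) :
    tensorForm b (fun v w => inner ℝ v w) (fun _ => 0) T = 0 := by
  simp [tensorForm]

variable [DecidableEq I] [CompleteSpace V] [CompleteSpace H]

/-- The estimate for the families of words: the tensor forms `(n!)⁻¹ ⟨b^{⊗n} y_n, y_n⟩`, where `b`
is the inverse of `ε + ∑_k ∫_0^t a_k a_kᵀ`, satisfy together a Gronwall inequality, since the source
term that completing the square produces in the equation of order `n + 1` is absorbed by the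
parabolicity condition in the equation of order `n`. -/
theorem sum_norm_sq_words_le (hT : 0 ≤ T) (hι : Function.Injective ι) (hd : DenseRange ι)
    {A : ℝ → V →L[ℝ] StrongDual ℝ V} {M : κ → ℝ → V →L[ℝ] H} {C₂ : ℝ}
    (hpar : ∀ t ∈ Icc 0 T, ∀ v, 2 * A t v v + ∑ k, ‖M k t v‖ ^ 2 ≤ C₂ * ‖ι v‖ ^ 2)
    {a : κ → I → ℝ → ℝ} (ha : ∀ k x, MemLp (a k x) 2 (timeMeasure T))
    (hle : ∀ t ∈ Icc 0 T, ∀ v : I → ℝ,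
      ∑ k, ∫ s in (0 : ℝ)..t, (∑ x, a k x s * v x) ^ 2 ≤ ∑ x, v x ^ 2)
    {h₀ : H} {f : ℝ → StrongDual ℝ V} {g : κ → ℝ → H} (hf : MemLp f 2 (timeMeasure T))
    (hg : ∀ k, MemLp (g k) 2 (timeMeasure T)) {u : ∀ n, (Fin n → I) → ℝ → V}
    {y : ∀ n, (Fin n → I) → ℝ → H}
    (hMu : ∀ k p, MemLp (fun t => M k t (u 0 p t)) 2 (timeMeasure T))
    (hy0 : ∀ p, IsPath T ι h₀ (fun t => A t (u 0 p t) + f t) (u 0 p) (y 0 p))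
    (hy : ∀ n p, IsPath T ι 0 (fun t => A t (u (n + 1) p t) + ∑ j, ∑ k, a k (p j) t •
      toDual ι (M k t (u n (j.removeNth p) t) + if n = 0 then g k t else 0))
      (u (n + 1) p) (y (n + 1) p)) {ε : ℝ} (hε : 0 < ε) (N : ℕ) {t : ℝ} (ht : t ∈ Icc 0 T) :
    ∑ n ∈ Finset.range (N + 1), (1 + ε)⁻¹ ^ n * ((n.factorial : ℝ)⁻¹ * ∑ p, ‖y n p t‖ ^ 2) ≤
      Real.exp (|C₂| * t) * (‖h₀‖ ^ 2 + ∫ s in (0 : ℝ)..t, (2 * (‖f s‖ * ‖u 0 default s‖) +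
        ∑ k, ‖M k s (u 0 default s)‖ ^ 2 + 2 * ∑ k, ‖g k s‖ ^ 2)) := by
  set b : I → I → ℝ → ℝ := fun x z t => (gramMatrix ε a t)⁻¹ x z with hbdef
  have hsymm : ∀ t x z, b x z t = b z x t := fun t x z => by
    have h3 : ((gramMatrix ε a t)⁻¹).transpose = (gramMatrix ε a t)⁻¹ := by
      rw [Matrix.transpose_nonsing_inv, gramMatrix_symm]
    exact congrFun (congrFun h3 z) x
  have hlow : ∀ t ∈ Icc 0 T, ∀ v : I → ℝ,
      (1 + ε)⁻¹ * ∑ x, v x ^ 2 ≤ ∑ x, ∑ z, b x z t * v x * v z := fun t ht v =>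
    le_inv_gramMatrix_quadratic hε ha ht (hle t ht) v
  have hpos : ∀ t ∈ Icc 0 T, ∀ v : I → ℝ, 0 ≤ ∑ x, ∑ z, b x z t * v x * v z := fun t ht v =>
    le_trans (mul_nonneg (by positivity) (Finset.sum_nonneg fun x _ => sq_nonneg _)) (hlow t ht v)
  have hbac := hasACDeriv_inv_gramMatrix (ε := ε) (I := I) hT hε ha
  set R : ℕ → ℝ → ℝ := fun n t => (n.factorial : ℝ)⁻¹ * tensorForm (fun x z => b x z t)
    (fun v w => inner ℝ v w) (fun p => y n p t) (fun p => y n p t) with hR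
  have hlowR : ∀ n, ∀ t ∈ Icc 0 T,
      (1 + ε)⁻¹ ^ n * ((n.factorial : ℝ)⁻¹ * ∑ p, ‖y n p t‖ ^ 2) ≤ R n t := fun n t ht => by
    have h1 := pow_mul_sum_le_tensorForm (hsymm t) (by positivity) (hlow t ht) (innerₗ H)
      (fun v => real_inner_self_nonneg) (fun p => y n p t)
    simp only [innerₗ_apply_apply, real_inner_self_eq_norm_sq] at h1
    rw [mul_left_comm]
    exact mul_le_mul_of_nonneg_left h1 (by positivity)
  have hRpos : ∀ n, ∀ t ∈ Icc 0 T, 0 ≤ R n t := fun n t ht => le_trans (by positivity) (hlowR n t ht)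
  refine (Finset.sum_le_sum fun n _ => hlowR n t ht).trans ?_
  -- the derivatives of the forms
  set α : ℕ → ℝ → ℝ := fun n t => (n.factorial : ℝ)⁻¹ *
    (2 * tensorForm (fun x z => b x z t) (fun v w => A t v w) (fun p => u n p t) (fun p => u n p t))
    with hα
  set μ : ℕ → ℝ → ℝ := fun n t => (n.factorial : ℝ)⁻¹ * ∑ k, tensorForm (fun x z => b x z t)
    (fun v w => inner ℝ v w) (fun p => M k t (u n p t) + if n = 0 then g k t else 0)
    (fun p => M k t (u n p t) + if n = 0 then g k t else 0) with hμ
  have hae : ∀ᵐ s ∂(timeMeasure T), ∀ n p, y n p s = ι (u n p s) := by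
    refine ae_all_iff.2 fun n => ae_all_iff.2 fun p => ?_
    cases n with
    | zero => exact (hy0 p).ae_eq
    | succ n => exact (hy n p).ae_eq
  have hderiv : ∀ n, ∃ R' : ℝ → ℝ, HasACDeriv T (R n) R' ∧ ∀ᵐ s ∂(timeMeasure T),
      R' s ≤ α n s + if n = 0 then 2 * (‖f s‖ * ‖u 0 default s‖) else μ (n - 1) s := by
    intro n
    cases n with
    | zero =>
      refine ⟨_, (hasACDeriv_tensorForm hT hι hd hbac hy0).const_mul _, ?_⟩
      filter_upwards with s
      have h1 : f s (u 0 default s) ≤ ‖f s‖ * ‖u 0 default s‖ :=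
        (le_abs_self _).trans ((f s).le_opNorm _)
      simp only [hα, tensorForm_zero_words]
      simp
      linarith
    | succ n =>
      refine ⟨_, (hasACDeriv_tensorForm hT hι hd hbac (hy n)).const_mul _, ?_⟩
      filter_upwards [hae, ae_timeMeasure_mem T] with s hs hsT
      have h1 := tensorForm_deriv_le (ι := ι) (hsymm s) (hpos s (Ioo_subset_Icc_self hsT))
        (fun k x => a k x s) (A s) (fun p => u (n + 1) p s)
        (fun k p => M k s (u n p s) + if n = 0 then g k s else 0)
      simp only [hs]
      refine (mul_le_mul_of_nonneg_left h1 (by positivity)).trans (le_of_eq ?_)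
      simp only [hα, hμ, Nat.succ_ne_zero, if_false, Nat.add_sub_cancel, Nat.factorial_succ]
      push_cast
      field_simp
  choose R' hR' hR'le using hderiv
  -- the parabolicity condition
  have hαμ : ∀ᵐ s ∂(timeMeasure T), ∀ n, α n s + μ n s ≤ C₂ * R n s +
      if n = 0 then ∑ k, ‖M k s (u 0 default s)‖ ^ 2 + 2 * ∑ k, ‖g k s‖ ^ 2 else 0 := by
    filter_upwards [hae, ae_timeMeasure_mem T] with s hs hsT n
    have hsT' := Ioo_subset_Icc_self hsT
    cases n with
    | zero =>
      have h1 := hpar s hsT' (u 0 default s)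
      have h2 : ∀ k, ‖M k s (u 0 default s) + g k s‖ ^ 2 ≤
          2 * ‖M k s (u 0 default s)‖ ^ 2 + 2 * ‖g k s‖ ^ 2 := fun k => by
        have h3 := norm_add_sq_real (M k s (u 0 default s)) (g k s)
        have h4 := norm_sub_sq_real (M k s (u 0 default s)) (g k s)
        nlinarith [sq_nonneg ‖M k s (u 0 default s) - g k s‖]
      have h3 := Finset.sum_le_sum fun k (_ : k ∈ Finset.univ) => h2 k
      rw [Finset.sum_add_distrib, ← Finset.mul_sum, ← Finset.mul_sum] at h3
      simp only [hα, hμ, hR, tensorForm_zero_words, hs, if_true, real_inner_self_eq_norm_sq,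
        Nat.factorial_zero, Nat.cast_one, inv_one, one_mul]
      linarith
    | succ n =>
      have h1 := tensorForm_parabolic (hsymm s) (hpos s hsT') (hpar s hsT')
        (fun p => u (n + 1) p s)
      simp only [hα, hμ, hR, hs, Nat.succ_ne_zero, if_false, add_zero]
      rw [← mul_add, mul_left_comm]
      exact mul_le_mul_of_nonneg_left h1 (by positivity)
  have hμpos : ∀ n, ∀ s ∈ Icc 0 T, 0 ≤ μ n s := fun n s hs => by
    refine mul_nonneg (by positivity) (Finset.sum_nonneg fun k _ => ?_)
    exact tensorForm_self_nonneg (hsymm s) (hpos s hs) (innerₗ H)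
      (fun v => real_inner_self_nonneg) _
  have hGi : Integrable (fun s => 2 * (‖f s‖ * ‖u 0 default s‖) +
      ∑ k, ‖M k s (u 0 default s)‖ ^ 2 + 2 * ∑ k, ‖g k s‖ ^ 2) (timeMeasure T) :=
    (((integrable_norm_mul_norm_of_memLp hf (hy0 default).memLp).const_mul 2).add
      (integrable_finsetSum _ fun k _ => integrable_norm_sq_of_memLp (hMu k default))).add
      ((integrable_finsetSum _ fun k _ => integrable_norm_sq_of_memLp (hg k)).const_mul 2)
  have hq := HasACDeriv.sum (Finset.range (N + 1)) fun n _ => hR' n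
  have h := hq.le_exp_mul hT (abs_nonneg C₂) hGi
    (Eventually.of_forall fun s => by positivity) ?_ ht
  · have h0 : ∑ n ∈ Finset.range (N + 1), R n 0 = ‖h₀‖ ^ 2 := by
      rw [Finset.sum_range_succ', Finset.sum_eq_zero, zero_add]
      · simp only [hR, tensorForm_zero_words]
        rw [(hy0 default).apply_zero hd hT]
        simp
      · intro n _
        simp only [hR]
        simp only [(hy n _).apply_zero hd hT, tensorForm_zero, mul_zero]
    rwa [h0] at h
  · filter_upwards [ae_all_iff.2 hR'le, hαμ, ae_timeMeasure_mem T] with s h1 h2 h3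
    have h3' := Ioo_subset_Icc_self h3
    -- the form `μ n` is a source in the equation of order `n + 1` and a dissipation in the
    -- parabolicity condition of order `n`
    calc ∑ n ∈ Finset.range (N + 1), R' n s
        ≤ ∑ n ∈ Finset.range (N + 1),
          (α n s + if n = 0 then 2 * (‖f s‖ * ‖u 0 default s‖) else μ (n - 1) s) :=
          Finset.sum_le_sum fun n _ => h1 n
      _ = ∑ n ∈ Finset.range (N + 1), α n s + ∑ n ∈ Finset.range N, μ n s +
          2 * (‖f s‖ * ‖u 0 default s‖) := by
          rw [Finset.sum_add_distrib, Finset.sum_range_succ' (fun n => ite _ _ _), add_assoc]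
          simp
      _ ≤ ∑ n ∈ Finset.range (N + 1), (α n s + μ n s) + 2 * (‖f s‖ * ‖u 0 default s‖) := by
          rw [Finset.sum_add_distrib, Finset.sum_range_succ (fun n => μ n s)]
          linarith [hμpos N s h3']
      _ ≤ ∑ n ∈ Finset.range (N + 1), (C₂ * R n s +
            if n = 0 then ∑ k, ‖M k s (u 0 default s)‖ ^ 2 + 2 * ∑ k, ‖g k s‖ ^ 2 else 0) +
          2 * (‖f s‖ * ‖u 0 default s‖) := by
          exact add_le_add (Finset.sum_le_sum fun n _ => h2 n) le_rfl
      _ = C₂ * ∑ n ∈ Finset.range (N + 1), R n s + (2 * (‖f s‖ * ‖u 0 default s‖) +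
          ∑ k, ‖M k s (u 0 default s)‖ ^ 2 + 2 * ∑ k, ‖g k s‖ ^ 2) := by
          rw [Finset.sum_add_distrib, Finset.sum_ite_eq', ← Finset.mul_sum,
            if_pos (Finset.mem_range.2 (Nat.succ_pos N))]
          ring
      _ ≤ _ := by
          gcongr
          · exact Finset.sum_nonneg fun n _ => hRpos n s h3'
          · exact le_abs_self _

end WordSum

/-! ### Words and multi-indices -/

section Words

theorem MultiIndex.fact_eq_mul_fact_pred {α : MultiIndex} {r : ℕ × ℕ} (hr : r ∈ α.support) :
    α.fact = α r * (α.pred r).fact := by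
  have hα : α r ≠ 0 := Finsupp.mem_support_iff.1 hr
  have hsub : (α.pred r).support ⊆ α.support := fun s hs => by
    rw [Finsupp.mem_support_iff] at hs ⊢
    rw [MultiIndex.pred, Finsupp.tsub_apply] at hs
    omega
  have h1 : (α.pred r).fact = ∏ p ∈ α.support, ((α.pred r) p).factorial :=
    Finset.prod_subset hsub fun s _ hs => by
      rw [Finsupp.notMem_support_iff.1 hs, Nat.factorial_zero]
  rw [h1, MultiIndex.fact, ← Finset.mul_prod_erase _ _ hr, ← Finset.mul_prod_erase _ _ hr,
    ← mul_assoc]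
  congr 1
  · rw [MultiIndex.pred, Finsupp.tsub_apply, Finsupp.single_eq_same, Nat.mul_factorial_pred hα]
  · refine Finset.prod_congr rfl fun s hs => ?_
    rw [MultiIndex.pred, Finsupp.tsub_apply,
      Finsupp.single_eq_of_ne (Finset.ne_of_mem_erase hs), Nat.sub_zero]

theorem MultiIndex.fact_zero : MultiIndex.fact 0 = 1 := by
  simp [MultiIndex.fact]

theorem MultiIndex.degree_pred {α : MultiIndex} {r : ℕ × ℕ} (hr : r ∈ α.support) :
    (α.pred r).degree + 1 = α.degree := by
  have hle : Finsupp.single r 1 ≤ α :=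
    Finsupp.single_le_iff.2 (Nat.one_le_iff_ne_zero.2 (Finsupp.mem_support_iff.1 hr))
  have h := congrArg Finsupp.degree (tsub_add_cancel_of_le hle)
  rwa [map_add, Finsupp.degree_single] at h

theorem MultiIndex.pred_add_single {α : MultiIndex} {r : ℕ × ℕ} (hr : r ∈ α.support) :
    α.pred r + Finsupp.single r 1 = α :=
  tsub_add_cancel_of_le
    (Finsupp.single_le_iff.2 (Nat.one_le_iff_ne_zero.2 (Finsupp.mem_support_iff.1 hr)))

variable {I : Type*} {n : ℕ}

/-- The multi-index that counts the letters of the word `p`. -/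
def wordIndex (e : I → ℕ × ℕ) (p : Fin n → I) : MultiIndex := ∑ j, Finsupp.single (e (p j)) 1

theorem degree_wordIndex (e : I → ℕ × ℕ) (p : Fin n → I) : (wordIndex e p).degree = n := by
  simp [wordIndex]

theorem sum_apply_word {M : Type*} [AddCommMonoid M] (e : I → ℕ × ℕ) (p : Fin n → I)
    (G : ℕ × ℕ → M) :
    ∑ j, G (e (p j)) = ∑ r ∈ (wordIndex e p).support, (wordIndex e p) r • G r := by
  have h : ∀ α : MultiIndex, Finsupp.liftAddHom (fun r => multiplesHom M (G r)) α =
      ∑ r ∈ α.support, α r • G r := fun α => rfl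
  rw [← h, wordIndex, map_sum]
  exact Finset.sum_congr rfl fun j _ => by simp

theorem wordIndex_insertNth (e : I → ℕ × ℕ) (j : Fin (n + 1)) (x : I) (p : Fin n → I) :
    wordIndex e (j.insertNth x p : Fin (n + 1) → I) =
      Finsupp.single (e x) 1 + wordIndex e p := by
  simp [wordIndex, Fin.sum_univ_succAbove _ j]

theorem mem_support_wordIndex (e : I → ℕ × ℕ) (p : Fin n → I) (j : Fin n) :
    e (p j) ∈ (wordIndex e p).support := by
  rw [Finsupp.mem_support_iff, wordIndex, Finsupp.finsetSum_apply]
  have h := Finset.single_le_sum (f := fun i => (Finsupp.single (e (p i)) 1) (e (p j)))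
    (fun i _ => Nat.zero_le _) (Finset.mem_univ j)
  simp only [Finsupp.single_eq_same] at h
  omega

theorem wordIndex_removeNth (e : I → ℕ × ℕ) (p : Fin (n + 1) → I) (j : Fin (n + 1)) :
    wordIndex e (j.removeNth p) = (wordIndex e p).pred (e (p j)) := by
  have h := wordIndex_insertNth e j (p j) (j.removeNth p)
  rw [Fin.insertNth_self_removeNth] at h
  rw [h, MultiIndex.pred, add_tsub_cancel_left]

/-- A multi-index `β` of degree `n` counts the letters of exactly `n! / β!` words. -/
theorem card_wordIndex_mul_fact [Fintype I] {e : I → ℕ × ℕ} (he : Function.Injective e) (n : ℕ) :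
    ∀ β : MultiIndex, β.degree = n → (∀ r ∈ β.support, r ∈ range e) →
      (∑ p : Fin n → I, if wordIndex e p = β then 1 else 0) * β.fact = n.factorial := by
  classical
  induction n with
  | zero =>
    intro β hβ _
    have h0 : β = 0 := (Finsupp.degree_eq_zero_iff β).1 hβ
    subst h0
    simp [wordIndex, MultiIndex.fact_zero]
  | succ n ih =>
    intro β hβ hs
    have h1 : ∀ x : I, (∑ p : Fin n → I,
        if wordIndex e (Fin.insertNth 0 x p : Fin (n + 1) → I) = β then 1 else 0) * β.fact =
        β (e x) * n.factorial := fun x => by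
      by_cases hx : e x ∈ β.support
      · rw [MultiIndex.fact_eq_mul_fact_pred hx, mul_left_comm,
          ← ih (β.pred (e x)) (by have := MultiIndex.degree_pred hx; omega) fun r hr => ?_]
        · congr 2
          refine Finset.sum_congr rfl fun p _ => ?_
          congr 1
          rw [wordIndex_insertNth, eq_iff_iff]
          constructor
          · rintro rfl
            rw [MultiIndex.pred, add_tsub_cancel_left]
          · intro h
            rw [h, add_comm, MultiIndex.pred_add_single hx]
        · refine hs r ?_
          rw [Finsupp.mem_support_iff] at hr ⊢
          rw [MultiIndex.pred, Finsupp.tsub_apply] at hr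
          omega
      · rw [Finsupp.notMem_support_iff.1 hx, zero_mul, Finset.sum_eq_zero, zero_mul]
        intro p _
        rw [if_neg]
        rintro rfl
        refine hx ?_
        have := mem_support_wordIndex e (Fin.insertNth 0 x p : Fin (n + 1) → I) 0
        rwa [Fin.insertNth_apply_same] at this
    rw [sum_eq_sum_insertNth 0, Finset.sum_comm, Finset.sum_mul]
    simp only [h1]
    rw [← Finset.sum_mul, Nat.factorial_succ, ← hβ]
    congr 1
    rw [Finsupp.degree_apply]
    refine (Finset.sum_subset (Finset.subset_univ (β.support.preimage e he.injOn)) ?_).symm.trans ?_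
    · intro x _ hx
      rw [Finset.mem_preimage] at hx
      exact Finsupp.notMem_support_iff.1 hx
    · exact Finset.sum_preimage e β.support he.injOn β fun r hr hr' => absurd (hs r hr) hr'

/-- Sums over multi-indices are dominated by weighted sums over words: there are `n! / β!` words
with the index `β`, and the weight `β!²` makes up for the division. -/
theorem sum_le_sum_words [Fintype I] {e : I → ℕ × ℕ} (he : Function.Injective e) (n : ℕ)
    (F : Finset MultiIndex) (hF : ∀ β ∈ F, β.degree = n ∧ ∀ r ∈ β.support, r ∈ range e)
    {G : MultiIndex → ℝ} (hG : ∀ β, 0 ≤ G β) :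
    ∑ β ∈ F, G β ≤ (n.factorial : ℝ)⁻¹ * ∑ p : Fin n → I, (wordIndex e p).fact ^ 2 *
      G (wordIndex e p) := by
  classical
  have h1 : ∀ β ∈ F, (n.factorial : ℝ) * G β ≤
      ∑ p : Fin n → I, if wordIndex e p = β then ((β.fact : ℝ) ^ 2 * G β) else 0 := fun β hβ => by
    have h2 := card_wordIndex_mul_fact he n β (hF β hβ).1 (hF β hβ).2
    have h3 : (1 : ℝ) ≤ β.fact := by exact_mod_cast β.fact_pos
    have h4 : ∑ p : Fin n → I, (if wordIndex e p = β then ((β.fact : ℝ) ^ 2 * G β) else 0) =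
        ((∑ p : Fin n → I, if wordIndex e p = β then 1 else 0 : ℕ) : ℝ) *
          ((β.fact : ℝ) ^ 2 * G β) := by
      push_cast
      rw [Finset.sum_mul]
      exact Finset.sum_congr rfl fun p _ => by split_ifs <;> simp
    rw [h4, ← h2]
    rw [Nat.cast_mul, mul_assoc]
    refine mul_le_mul_of_nonneg_left ?_ (Nat.cast_nonneg _)
    have h5 := mul_nonneg (Nat.cast_nonneg (α := ℝ) β.fact) (mul_nonneg (sub_nonneg.2 h3) (hG β))
    linarith
  rw [le_inv_mul_iff₀ (by positivity), Finset.mul_sum]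
  refine (Finset.sum_le_sum h1).trans ?_
  rw [Finset.sum_comm]
  refine Finset.sum_le_sum fun p _ => ?_
  rw [Finset.sum_ite_eq]
  split_ifs
  · exact le_rfl
  · exact mul_nonneg (sq_nonneg _) (hG _)

end Words

/-! ### The normalized system -/

section ChaosFamily

variable {T : ℝ} {V H : Type*} [NormedAddCommGroup V] [InnerProductSpace ℝ V]
  [NormedAddCommGroup H] [InnerProductSpace ℝ H]

/-- The system of equations of the normalized coefficients `u_α / √(α!)`: the normalization removes
the factors `√(α_i^k)`, so that the system is invariant under translations of `α`. -/
def IsChaosFamily (T : ℝ) (ι : V →L[ℝ] H) (A : ℝ → V →L[ℝ] StrongDual ℝ V)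
    (M : ℕ → ℝ → V →L[ℝ] H) (m : ℕ → ℝ → ℝ) (h : MultiIndex → H)
    (f : MultiIndex → ℝ → StrongDual ℝ V) (g : ℕ → MultiIndex → ℝ → H)
    (c : MultiIndex → ℝ → V) (y : MultiIndex → ℝ → H) : Prop :=
  ∀ α, IsPath T ι (h α) (fun t => A t (c α t) + (f α t + ∑ r ∈ α.support,
    m r.1 t • toDual ι (M r.2 t (c (α.pred r) t) + g r.2 (α.pred r) t))) (c α) (y α)

end ChaosFamily

/-! ### The estimate for deterministic data -/

section DeterministicData

variable {T : ℝ}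

/-- A form of Bessel's inequality: the integral over `(0, T)` is the squared norm of `∑ v_i m_i`. -/
theorem integral_sum_mul_sq_le {L : Type*} [Fintype L] {m : L → Lp ℝ 2 (timeMeasure T)}
    (hm : Orthonormal ℝ m) (v : L → ℝ) {t : ℝ} (ht : t ∈ Icc 0 T) :
    ∫ s in (0 : ℝ)..t, (∑ i, m i s * v i) ^ 2 ≤ ∑ i, v i ^ 2 := by
  have hT : 0 ≤ T := ht.1.trans ht.2
  have hi : Integrable (fun s => (∑ i, m i s * v i) ^ 2) (timeMeasure T) := by
    have h1 : MemLp (fun s => ∑ i, m i s * v i) 2 (timeMeasure T) :=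
      memLp_finsetSum _ fun i _ => (Lp.memLp (m i)).mul_const (v i)
    exact h1.integrable_sq
  have h1 : ∫ s in (0 : ℝ)..t, (∑ i, m i s * v i) ^ 2 ≤
      ∫ s in (0 : ℝ)..T, (∑ i, m i s * v i) ^ 2 :=
    intervalIntegral.integral_mono_interval le_rfl ht.1 ht.2
      (Eventually.of_forall fun s => sq_nonneg _) ((intervalIntegrable_iff_timeMeasure hT).2 hi)
  refine h1.trans (le_of_eq ?_)
  have h2 : ‖∑ i, v i • m i‖ ^ 2 = ∑ i, v i ^ 2 := by
    rw [← real_inner_self_eq_norm_sq, hm.inner_sum]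
    exact Finset.sum_congr rfl fun i _ => by simp [sq]
  rw [← h2, norm_sq_Lp_two, ← integral_timeMeasure hT]
  refine integral_congr_ae ?_
  filter_upwards [Lp.coeFn_finsetSum Finset.univ fun i => v i • m i,
    ae_all_iff.2 fun i => Lp.coeFn_smul (v i) (m i)] with s h3 h4
  rw [h3, Finset.sum_apply, Real.norm_eq_abs, sq_abs]
  congr 1
  exact Finset.sum_congr rfl fun i _ => by rw [h4 i, Pi.smul_apply, smul_eq_mul, mul_comm]

variable {V H : Type*} [NormedAddCommGroup V] [InnerProductSpace ℝ V]
  [NormedAddCommGroup H] [InnerProductSpace ℝ H] {ι : V →L[ℝ] H}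

theorem toDual_smul (ι : V →L[ℝ] H) (c : ℝ) (a : H) : toDual ι (c • a) = c • toDual ι a :=
  (toDualL ι).map_smul c a

/-- In a family with deterministic data, the coefficients `α(p)! c_{α(p)}` solve the system indexed
by the words `p`. -/
theorem IsChaosFamily.isPath_word {A : ℝ → V →L[ℝ] StrongDual ℝ V} {M : ℕ → ℝ → V →L[ℝ] H}
    {m : ℕ → ℝ → ℝ} {h₀ : H} {f : ℝ → StrongDual ℝ V} {g : ℕ → ℝ → H} {c : MultiIndex → ℝ → V}
    {y : MultiIndex → ℝ → H}
    (hc : IsChaosFamily T ι A M m (fun α => if α = 0 then h₀ else 0)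
      (fun α t => if α = 0 then f t else 0) (fun k α t => if α = 0 then g k t else 0) c y)
    {I : Type*} {L n : ℕ} (e : I → ℕ × ℕ) (he : ∀ x, (e x).2 < L) (p : Fin (n + 1) → I) :
    IsPath T ι 0 (fun t => A t (((wordIndex e p).fact : ℝ) • c (wordIndex e p) t) +
      ∑ j, ∑ k : Fin L, (if (e (p j)).2 = k then m (e (p j)).1 t else 0) •
        toDual ι (M k t (((wordIndex e (j.removeNth p)).fact : ℝ) •
          c (wordIndex e (j.removeNth p)) t) + if n = 0 then g k t else 0))
      (fun t => ((wordIndex e p).fact : ℝ) • c (wordIndex e p) t)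
      (fun t => ((wordIndex e p).fact : ℝ) • y (wordIndex e p) t) := by
  set α := wordIndex e p with hα
  have hα0 : α ≠ 0 := fun h => by
    have h1 := degree_wordIndex e p
    rw [← hα, h, map_zero] at h1
    omega
  have h := (hc α).const_smul (α.fact : ℝ)
  simp only [if_neg hα0, smul_zero, zero_add] at h
  convert h using 1
  funext t
  have h1 : ∀ j, ∑ k : Fin L, (if (e (p j)).2 = k then m (e (p j)).1 t else 0) •
        toDual ι (M k t (((wordIndex e (j.removeNth p)).fact : ℝ) •
          c (wordIndex e (j.removeNth p)) t) + if n = 0 then g k t else 0) =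
      m (e (p j)).1 t • toDual ι (M (e (p j)).2 t (((α.pred (e (p j))).fact : ℝ) •
          c (α.pred (e (p j))) t) + if n = 0 then g (e (p j)).2 t else 0) := fun j => by
    rw [Finset.sum_eq_single (⟨(e (p j)).2, he _⟩ : Fin L)]
    · rw [if_pos rfl, wordIndex_removeNth]
    · intro k _ hk
      rw [if_neg fun h => hk (Fin.ext h.symm), zero_smul]
    · simp
  simp only [h1]
  rw [sum_apply_word e p fun r => m r.1 t • toDual ι (M r.2 t (((α.pred r).fact : ℝ) •
          c (α.pred r) t) + if n = 0 then g r.2 t else 0), ← hα, map_smul, smul_add,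
    Finset.smul_sum]
  congr 1
  refine Finset.sum_congr rfl fun r hr => ?_
  have h2 : (if n = 0 then g r.2 t else 0) =
      ((α.pred r).fact : ℝ) • (if α.pred r = 0 then g r.2 t else 0) := by
    have h3 : (α.pred r).degree = n := by
      have h4 := MultiIndex.degree_pred hr
      rw [hα, degree_wordIndex e p] at h4
      exact Nat.succ_injective h4
    by_cases hn : n = 0
    · have h5 : α.pred r = 0 := (Finsupp.degree_eq_zero_iff _).1 (h3.trans hn)
      rw [if_pos hn, if_pos h5, h5, MultiIndex.fact_zero, Nat.cast_one, one_smul]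
    · have h5 : α.pred r ≠ 0 := fun h => hn (by rw [← h3, h, map_zero])
      rw [if_neg hn, if_neg h5, smul_zero]
  rw [h2, map_smul, ← smul_add, toDual_smul, MultiIndex.fact_eq_mul_fact_pred hr, Nat.cast_mul,
    ← Nat.cast_smul_eq_nsmul ℝ, smul_smul, smul_smul, smul_smul]
  congr 1
  ring

variable [CompleteSpace V] [CompleteSpace H]

/-- The square of the constant in the estimates. -/
def chaosConst (T δ C₁ C₂ : ℝ) : ℝ :=
  3 * (Real.exp (|C₂| * T) * ((1 + sourceConst T C₁ C₂) * (1 + δ⁻¹) + 2))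

/-- The estimate in the chaos space for deterministic data. Only finitely many multi-indices are
considered, so that the words can be formed from a finite alphabet; the constant does not depend on
the alphabet. -/
theorem IsChaosFamily.sum_norm_sq_le (hT : 0 ≤ T) (hι : Function.Injective ι) (hd : DenseRange ι)
    {A : ℝ → V →L[ℝ] StrongDual ℝ V} {M : ℕ → ℝ → V →L[ℝ] H} {δ C₁ C₂ : ℝ} (hδ : 0 < δ)
    (hC₁ : 0 ≤ C₁) (hcoer : ∀ t ∈ Icc 0 T, ∀ v, A t v v + δ * ‖v‖ ^ 2 ≤ C₁ * ‖ι v‖ ^ 2)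
    (hpar : ∀ t ∈ Icc 0 T, ∀ v, Summable (fun k => ‖M k t v‖ ^ 2) ∧
      2 * A t v v + ∑' k, ‖M k t v‖ ^ 2 ≤ C₂ * ‖ι v‖ ^ 2)
    {m : ℕ → Lp ℝ 2 (timeMeasure T)} (hm : Orthonormal ℝ m) {h₀ : H}
    {f : ℝ → StrongDual ℝ V} {g : ℕ → ℝ → H} (hf : MemLp f 2 (timeMeasure T))
    (hg : ∀ k, MemLp (g k) 2 (timeMeasure T)) {c : MultiIndex → ℝ → V} {y : MultiIndex → ℝ → H}
    (hMc : ∀ k, MemLp (fun t => M k t (c 0 t)) 2 (timeMeasure T))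
    (hc : IsChaosFamily T ι A M (fun i => m i) (fun α => if α = 0 then h₀ else 0)
      (fun α t => if α = 0 then f t else 0) (fun k α t => if α = 0 then g k t else 0) c y)
    (F : Finset MultiIndex) {t : ℝ} (ht : t ∈ Icc 0 T) :
    ∃ L : ℕ, ∑ β ∈ F, ‖y β t‖ ^ 2 ≤ chaosConst T δ C₁ C₂ * (‖h₀‖ ^ 2 +
      (∫ s in (0 : ℝ)..t, ‖f s‖ ^ 2) + ∑ k : Fin L, ∫ s in (0 : ℝ)..t, ‖g k s‖ ^ 2) := by
  classical
  set L := (F.biUnion fun β => β.support).sup (fun r => max r.1 r.2) + 1 with hL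
  have hLlt : ∀ β ∈ F, ∀ r ∈ β.support, r.1 < L ∧ r.2 < L := fun β hβ r hr => by
    have h1 := Finset.le_sup (f := fun r : ℕ × ℕ => max r.1 r.2)
      (Finset.mem_biUnion.2 ⟨β, hβ, hr⟩)
    exact ⟨Nat.lt_succ_of_le ((le_max_left _ _).trans h1),
      Nat.lt_succ_of_le ((le_max_right _ _).trans h1)⟩
  set N := F.sup fun β => β.degree with hN
  refine ⟨L, ?_⟩
  set e : Fin L × Fin L → ℕ × ℕ := fun x => (x.1, x.2) with he
  have hinj : Function.Injective e := fun x z h => by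
    simp only [he, Prod.mk.injEq] at h
    exact Prod.ext (Fin.ext h.1) (Fin.ext h.2)
  have hwords : ∑ β ∈ F, ‖y β t‖ ^ 2 ≤ ∑ n ∈ Finset.range (N + 1),
      (n.factorial : ℝ)⁻¹ * ∑ p : Fin n → Fin L × Fin L,
        ‖((wordIndex e p).fact : ℝ) • y (wordIndex e p) t‖ ^ 2 := by
    have h1 : ∀ β ∈ F, β.degree ∈ Finset.range (N + 1) := fun β hβ =>
      Finset.mem_range.2 (Nat.lt_succ_of_le (Finset.le_sup (f := fun β : MultiIndex => β.degree) hβ))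
    rw [← Finset.sum_fiberwise_of_maps_to h1]
    refine Finset.sum_le_sum fun n _ => ?_
    refine (sum_le_sum_words hinj n _ (fun β hβ => ?_) (fun β => sq_nonneg ‖y β t‖)).trans
      (le_of_eq ?_)
    · rw [Finset.mem_filter] at hβ
      refine ⟨hβ.2, fun r hr => ?_⟩
      obtain ⟨hr1, hr2⟩ := hLlt β hβ.1 r hr
      exact ⟨(⟨r.1, hr1⟩, ⟨r.2, hr2⟩), rfl⟩
    · congr 1
      refine Finset.sum_congr rfl fun p _ => ?_
      rw [norm_smul, mul_pow, Real.norm_natCast]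
  -- with this `ε`, the factors `(1 + ε)⁻ⁿ` stay above `1 / 3`
  set ε : ℝ := ((N : ℝ) + 1)⁻¹ with hε
  have hε0 : 0 < ε := by positivity
  have hεn : ∀ n ∈ Finset.range (N + 1), (1 : ℝ) ≤ 3 * (1 + ε)⁻¹ ^ n := fun n hn => by
    have h1 : (1 + ε) ^ n ≤ 3 := by
      calc (1 + ε) ^ n ≤ Real.exp ε ^ n := by
            gcongr
            rw [add_comm]
            exact Real.add_one_le_exp ε
        _ = Real.exp (n * ε) := (Real.exp_nat_mul ε n).symm
        _ ≤ Real.exp 1 := by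
            refine Real.exp_le_exp.2 ?_
            rw [hε, ← div_eq_mul_inv, div_le_one (by positivity)]
            exact_mod_cast (Finset.mem_range.1 hn).le
        _ ≤ 3 := Real.exp_one_lt_three.le
    rw [inv_pow, ← div_eq_mul_inv, le_div_iff₀ (by positivity)]
    linarith
  have hpar' : ∀ t ∈ Icc 0 T, ∀ v, 2 * A t v v + ∑ k : Fin L, ‖M k t v‖ ^ 2 ≤ C₂ * ‖ι v‖ ^ 2 :=
    fun t ht v => by
      have h1 := (hpar t ht v).1.sum_le_tsum (Finset.range L) fun k _ => sq_nonneg _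
      rw [Finset.sum_range] at h1
      linarith [(hpar t ht v).2]
  have hw0 : ∀ p : Fin 0 → Fin L × Fin L, wordIndex e p = 0 := fun p => by simp [wordIndex]
  have hc0 : IsPath T ι h₀ (fun t => A t (c 0 t) + f t) (c 0) (y 0) := by
    simpa using hc 0
  have key := sum_norm_sq_words_le (I := Fin L × Fin L) (κ := Fin L) hT hι hd hpar'
    (M := fun k => M k)
    (a := fun k x t => if (e x).2 = k then m (e x).1 t else 0) (fun k x => ?_) ?_ (h₀ := h₀) hf
    (g := fun k => g k) (fun k => hg k)
    (u := fun n p t => ((wordIndex e p).fact : ℝ) • c (wordIndex e p) t)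
    (y := fun n p t => ((wordIndex e p).fact : ℝ) • y (wordIndex e p) t)
    (fun k p => ?_) (fun p => ?_) (fun n p => hc.isPath_word e (fun x => x.2.2) p) hε0 N ht
  · simp only [hw0, MultiIndex.fact_zero, Nat.cast_one, one_smul] at key
    have hsrc := hc0.integral_source_le (κ := Fin L) hT hι hd hδ hC₁ hcoer hpar' hf
      (fun k => hMc k) ht
    have hi1 : Integrable (fun s => 2 * (‖f s‖ * ‖c 0 s‖) + ∑ k : Fin L, ‖M k s (c 0 s)‖ ^ 2)
        (timeMeasure T) :=
      ((integrable_norm_mul_norm_of_memLp hf hc0.memLp).const_mul 2).add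
        (integrable_finsetSum _ fun k _ => integrable_norm_sq_of_memLp (hMc k))
    have hi2 := (integrable_finsetSum Finset.univ fun (k : Fin L) _ =>
      integrable_norm_sq_of_memLp (hg k)).const_mul 2
    have h0 : (0 : ℝ) ∈ Icc 0 T := ⟨le_rfl, hT⟩
    have hsum : ∫ s in (0 : ℝ)..t, ∑ k : Fin L, ‖g k s‖ ^ 2 =
        ∑ k : Fin L, ∫ s in (0 : ℝ)..t, ‖g k s‖ ^ 2 :=
      intervalIntegral.integral_finsetSum fun k _ =>
        Integrable.intervalIntegrable_of_mem (integrable_norm_sq_of_memLp (hg k)) h0 ht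
    rw [integral_add_of_mem hi1 hi2 ht, intervalIntegral.integral_const_mul, hsum] at key
    set Φ := ∫ s in (0 : ℝ)..t, ‖f s‖ ^ 2
    set Γ := ∑ k : Fin L, ∫ s in (0 : ℝ)..t, ‖g k s‖ ^ 2
    have hΦ : 0 ≤ Φ := intervalIntegral.integral_nonneg ht.1 fun s _ => sq_nonneg _
    have hΓ : 0 ≤ Γ := Finset.sum_nonneg fun k _ =>
      intervalIntegral.integral_nonneg ht.1 fun s _ => sq_nonneg _
    have hS : 0 ≤ sourceConst T C₁ C₂ := by
      unfold sourceConst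
      positivity
    calc ∑ β ∈ F, ‖y β t‖ ^ 2 ≤ ∑ n ∈ Finset.range (N + 1), (3 * (1 + ε)⁻¹ ^ n) *
          ((n.factorial : ℝ)⁻¹ * ∑ p : Fin n → Fin L × Fin L,
            ‖((wordIndex e p).fact : ℝ) • y (wordIndex e p) t‖ ^ 2) :=
          hwords.trans (Finset.sum_le_sum fun n hn =>
            le_mul_of_one_le_left (by positivity) (hεn n hn))
      _ ≤ 3 * (Real.exp (|C₂| * t) *
          (‖h₀‖ ^ 2 + (sourceConst T C₁ C₂ * (‖h₀‖ ^ 2 + δ⁻¹ * Φ) + 2 * Γ))) := by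
          simp only [mul_assoc, ← Finset.mul_sum]
          gcongr
          refine (Finset.sum_congr rfl fun n _ => rfl).trans_le (key.trans ?_)
          gcongr
      _ ≤ 3 * (Real.exp (|C₂| * T) *
          (((1 + sourceConst T C₁ C₂) * (1 + δ⁻¹) + 2) * (‖h₀‖ ^ 2 + Φ + Γ))) := by
          gcongr
          · exact ht.2
          · have h1 : 0 ≤ δ⁻¹ := inv_nonneg.2 hδ.le
            have h2 := sq_nonneg ‖h₀‖
            have h3 := mul_nonneg hS h1
            nlinarith [mul_nonneg h3 h2, mul_nonneg h3 hΓ, mul_nonneg hS hΓ, mul_nonneg hS hΦ,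
              mul_nonneg h1 h2, mul_nonneg h1 hΓ, mul_nonneg h1 hΦ]
      _ = _ := by
          unfold chaosConst
          ring
  · by_cases h : (e x).2 = k
    · simpa only [h, if_true] using Lp.memLp (m (e x).1)
    · simpa only [h, if_false] using memLp_const (0 : ℝ)
  · intro r hr v
    have h1 : ∀ (k : Fin L) s, ∑ x, (if (e x).2 = k then m (e x).1 s else 0) * v x =
        ∑ i : Fin L, m i s * v (i, k) := fun k s => by
      rw [Fintype.sum_prod_type]
      refine Finset.sum_congr rfl fun i _ => ?_
      rw [Finset.sum_eq_single k]
      · simp [he]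
      · intro k' _ hk'
        rw [if_neg fun h => hk' (Fin.ext h), zero_mul]
      · simp
    simp only [h1]
    rw [Fintype.sum_prod_type_right]
    exact Finset.sum_le_sum fun k _ => integral_sum_mul_sq_le
      (hm.comp (fun i : Fin L => (i : ℕ)) Fin.val_injective) (fun i => v (i, k)) hr
  · simpa only [hw0, MultiIndex.fact_zero, Nat.cast_one, one_smul] using hMc k
  · simpa only [hw0, MultiIndex.fact_zero, Nat.cast_one, one_smul] using hc0

end DeterministicData

/-! ### Solving the normalized system -/

section Families

theorem memLp_fun_smul {α E : Type*} [MeasurableSpace α] {μ : Measure α} [NormedAddCommGroup E]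
    [NormedSpace ℝ E] {a : α → ℝ} {f : α → E} (ha : MemLp a ∞ μ) (hf : MemLp f 2 μ) :
    MemLp (fun t => a t • f t) 2 μ := MemLp.smul hf ha

theorem memLp_fun_sum {α E κ : Type*} [MeasurableSpace α] {μ : Measure α} [NormedAddCommGroup E]
    (s : Finset κ) {f : κ → α → E} (hf : ∀ i ∈ s, MemLp (f i) 2 μ) :
    MemLp (fun t => ∑ i ∈ s, f i t) 2 μ := memLp_finsetSum s hf

variable {T : ℝ} {V H : Type*} [NormedAddCommGroup V] [InnerProductSpace ℝ V]
  [NormedAddCommGroup H] [InnerProductSpace ℝ H]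

/-- The hypotheses on the normal triple and on the operators. -/
structure IsParabolic (T : ℝ) (ι : V →L[ℝ] H) (A : ℝ → V →L[ℝ] StrongDual ℝ V)
    (M : ℕ → ℝ → V →L[ℝ] H) (δ C₁ C₂ : ℝ) : Prop where
  T_pos : 0 < T
  injective : Function.Injective ι
  denseRange : DenseRange ι
  measurable_A : ∀ v, AEStronglyMeasurable (fun t => A t v) (timeMeasure T)
  measurable_M : ∀ k v, AEStronglyMeasurable (fun t => M k t v) (timeMeasure T)
  bounded : ∃ K : ℝ, ∀ t ∈ Icc 0 T, ‖A t‖ ≤ K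
  δ_pos : 0 < δ
  C₁_pos : 0 < C₁
  coercive : ∀ t ∈ Icc 0 T, ∀ v, A t v v + δ * ‖v‖ ^ 2 ≤ C₁ * ‖ι v‖ ^ 2
  parabolic : ∀ t ∈ Icc 0 T, ∀ v, Summable (fun k => ‖M k t v‖ ^ 2) ∧
    2 * A t v v + ∑' k, ‖M k t v‖ ^ 2 ≤ C₂ * ‖ι v‖ ^ 2

variable {ι : V →L[ℝ] H} {A : ℝ → V →L[ℝ] StrongDual ℝ V} {M : ℕ → ℝ → V →L[ℝ] H} {δ C₁ C₂ : ℝ}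

theorem IsParabolic.memLp_A (hP : IsParabolic T ι A M δ C₁ C₂) {u : ℝ → V}
    (hu : MemLp u 2 (timeMeasure T)) : MemLp (fun t => A t (u t)) 2 (timeMeasure T) := by
  obtain ⟨K, hK⟩ := hP.bounded
  refine memLp_clm_apply hP.measurable_A (K := K) ?_ hu
  filter_upwards [ae_timeMeasure_mem T] with t ht v
  exact (A t).le_of_opNorm_le (hK t (Ioo_subset_Icc_self ht)) v

theorem IsParabolic.memLp_M (hP : IsParabolic T ι A M δ C₁ C₂) (k : ℕ) {u : ℝ → V}
    (hu : MemLp u 2 (timeMeasure T)) : MemLp (fun t => M k t (u t)) 2 (timeMeasure T) := by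
  obtain ⟨K, hK⟩ := hP.bounded
  have hK0 : 0 ≤ K := (norm_nonneg (A 0)).trans (hK 0 ⟨le_rfl, hP.T_pos.le⟩)
  refine memLp_clm_apply (hP.measurable_M k) (K := √(|C₂| * ‖ι‖ ^ 2 + 2 * K)) ?_ hu
  filter_upwards [ae_timeMeasure_mem T] with t ht v
  have ht' := Ioo_subset_Icc_self ht
  obtain ⟨h1, h2⟩ := hP.parabolic t ht' v
  have h3 : ‖M k t v‖ ^ 2 ≤ ∑' k, ‖M k t v‖ ^ 2 := h1.le_tsum k fun _ _ => sq_nonneg _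
  have h4 : |A t v v| ≤ K * ‖v‖ * ‖v‖ :=
    ((A t v).le_opNorm v).trans (by
      gcongr
      exact (A t).le_of_opNorm_le (hK t ht') v)
  have h5 : C₂ * ‖ι v‖ ^ 2 ≤ |C₂| * (‖ι‖ * ‖v‖) ^ 2 :=
    (mul_le_mul_of_nonneg_right (le_abs_self _) (sq_nonneg _)).trans (by
      gcongr
      exact ι.le_opNorm v)
  refine abs_le_of_sq_le_sq' ?_ (by positivity) |>.2
  rw [mul_pow, Real.sq_sqrt (by positivity)]
  nlinarith [neg_abs_le (A t v v)]

theorem IsParabolic.memLp_lower (hP : IsParabolic T ι A M δ C₁ C₂) {m : ℕ → ℝ → ℝ}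
    (hm : ∀ i, MemLp (m i) ∞ (timeMeasure T)) (s : Finset (ℕ × ℕ)) {a : ℕ × ℕ → ℝ}
    {v : ℕ × ℕ → ℝ → V} {w : ℕ × ℕ → ℝ → H} (hv : ∀ r ∈ s, MemLp (v r) 2 (timeMeasure T))
    (hw : ∀ r ∈ s, MemLp (w r) 2 (timeMeasure T)) :
    MemLp (fun t => ∑ r ∈ s, (a r * m r.1 t) • toDual ι (M r.2 t (v r t) + w r t)) 2
      (timeMeasure T) :=
  memLp_fun_sum s fun r hr => memLp_fun_smul ((hm r.1).const_mul (a r))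
    ((toDualL ι).comp_memLp' (memLp_fun_add (hP.memLp_M r.2 (hv r hr)) (hw r hr)))

variable [CompleteSpace V] [CompleteSpace H]

theorem IsParabolic.exists_isPath (hP : IsParabolic T ι A M δ C₁ C₂) (h₀ : H)
    {F : ℝ → StrongDual ℝ V} (hF : MemLp F 2 (timeMeasure T)) :
    ∃ u y, IsPath T ι h₀ (fun t => A t (u t) + F t) u y := by
  obtain ⟨K, hK⟩ := hP.bounded
  obtain ⟨u, hu, h⟩ := exists_weakSolution hP.T_pos ι hP.measurable_A hK hP.δ_pos hP.C₁_pos.le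
    hP.coercive h₀ hF
  obtain ⟨y, hy⟩ := WienerChaos.exists_isPath hP.injective hP.denseRange
    (memLp_fun_add (hP.memLp_A hu) hF) hu h
  exact ⟨u, y, hy⟩

/-- Recursive choice: a family can be chosen along a well-founded relation when the condition on
each member involves only the preceding ones. -/
theorem exists_forall_of_wellFounded {α S : Type*} [Nonempty S] {r : α → α → Prop}
    (wf : WellFounded r) (P : α → (α → S) → S → Prop)
    (hcongr : ∀ a f f' s, (∀ b, r b a → f b = f' b) → P a f s → P a f' s)
    (hex : ∀ a f, (∀ b, r b a → P b f (f b)) → ∃ s, P a f s) : ∃ f : α → S, ∀ a, P a f (f a) := by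
  classical
  let F : ∀ a, (∀ b, r b a → S) → S := fun a prev =>
    Classical.epsilon fun s => P a (fun b => if h : r b a then prev b h else Classical.arbitrary S) s
  let f : α → S := wf.fix F
  refine ⟨f, fun a => ?_⟩
  induction a using wf.induction with
  | _ a ih =>
    obtain ⟨s, hs⟩ := hex a f ih
    have h1 : f a = Classical.epsilon fun s =>
        P a (fun b => if r b a then f b else Classical.arbitrary S) s := by
      refine (wf.fix_eq F a).trans ?_
      simp only [F, f, dite_eq_ite]
    have h2 : P a (fun b => if r b a then f b else Classical.arbitrary S) (f a) := by
      rw [h1]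
      exact Classical.epsilon_spec (p := fun s =>
        P a (fun b => if r b a then f b else Classical.arbitrary S) s)
        ⟨s, hcongr a f _ s (fun b hb => by rw [if_pos hb]) hs⟩
    exact hcongr a _ f _ (fun b hb => by rw [if_pos hb]) h2

/-- The system for the coefficients is lower triangular, so it is solved recursively. -/
theorem IsParabolic.exists_isChaosFamily (hP : IsParabolic T ι A M δ C₁ C₂) {m : ℕ → ℝ → ℝ}
    (hm : ∀ i, MemLp (m i) ∞ (timeMeasure T)) (h : MultiIndex → H)
    {f : MultiIndex → ℝ → StrongDual ℝ V} (hf : ∀ α, MemLp (f α) 2 (timeMeasure T))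
    {g : ℕ → MultiIndex → ℝ → H} (hg : ∀ k α, MemLp (g k α) 2 (timeMeasure T)) :
    ∃ c y, IsChaosFamily T ι A M m h f g c y := by
  suffices hs : ∃ s : MultiIndex → (ℝ → V) × (ℝ → H), ∀ α,
      IsPath T ι (h α) (fun t => A t ((s α).1 t) + (f α t + ∑ r ∈ α.support,
        m r.1 t • toDual ι (M r.2 t ((s (α.pred r)).1 t) + g r.2 (α.pred r) t))) (s α).1 (s α).2 by
    obtain ⟨s, hs⟩ := hs
    exact ⟨fun α => (s α).1, fun α => (s α).2, hs⟩
  refine exists_forall_of_wellFounded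
    (InvImage.wf (fun α : MultiIndex => α.degree) wellFounded_lt)
    (fun α (s : MultiIndex → (ℝ → V) × (ℝ → H)) p => IsPath T ι (h α)
      (fun t => A t (p.1 t) + (f α t + ∑ r ∈ α.support,
        m r.1 t • toDual ι (M r.2 t ((s (α.pred r)).1 t) + g r.2 (α.pred r) t))) p.1 p.2)
    (fun α s s' p hss' hp => ?_) (fun α s hs => ?_)
  · have e : ∀ t, ∑ r ∈ α.support,
          m r.1 t • toDual ι (M r.2 t ((s' (α.pred r)).1 t) + g r.2 (α.pred r) t) =
        ∑ r ∈ α.support,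
          m r.1 t • toDual ι (M r.2 t ((s (α.pred r)).1 t) + g r.2 (α.pred r) t) := fun t =>
      Finset.sum_congr rfl fun r hr => by
        rw [hss' (α.pred r) (by
          have := MultiIndex.degree_pred hr
          simp only [InvImage]
          omega)]
    simpa only [e] using hp
  · have h1 := hP.memLp_lower hm α.support (a := fun _ => 1) (v := fun r => (s (α.pred r)).1)
      (w := fun r => g r.2 (α.pred r))
      (fun r hr => (hs (α.pred r) (by
        have := MultiIndex.degree_pred hr
        simp only [InvImage]
        omega)).memLp) (fun r _ => hg _ _)
    simp only [one_mul] at h1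
    obtain ⟨u, y, hy⟩ := hP.exists_isPath (h α) (memLp_fun_add (hf α) h1)
    exact ⟨(u, y), hy⟩

theorem IsChaosFamily.unique (hP : IsParabolic T ι A M δ C₁ C₂) {m : ℕ → ℝ → ℝ} {h : MultiIndex → H}
    {f : MultiIndex → ℝ → StrongDual ℝ V} {g : ℕ → MultiIndex → ℝ → H}
    {c c' : MultiIndex → ℝ → V} {y y' : MultiIndex → ℝ → H}
    (hc : IsChaosFamily T ι A M m h f g c y) (hc' : IsChaosFamily T ι A M m h f g c' y')
    (α : MultiIndex) : (∀ t ∈ Icc 0 T, y α t = y' α t) ∧ c α =ᵐ[timeMeasure T] c' α := by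
  induction α using (InvImage.wf (fun α : MultiIndex => α.degree) wellFounded_lt).induction with
  | _ α ih =>
    refine (hc α).eq_of_coercive hP.T_pos.le hP.injective hP.denseRange hP.δ_pos.le hP.C₁_pos.le
      hP.coercive ((hc' α).congr ?_ Filter.EventuallyEq.rfl)
    have h1 : ∀ᵐ t ∂(timeMeasure T), ∀ r ∈ α.support, c (α.pred r) t = c' (α.pred r) t :=
      (ae_ball_iff α.support.countable_toSet).2 fun r hr => (ih (α.pred r) (by
        have := MultiIndex.degree_pred hr
        simp only [InvImage]
        omega)).2
    filter_upwards [h1] with t ht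
    rw [Finset.sum_congr rfl fun r hr => by rw [← ht r hr]]

end Families

/-! ### Superposition -/

section Superposition

variable {T : ℝ} {V H : Type*} [NormedAddCommGroup V] [InnerProductSpace ℝ V]
  [NormedAddCommGroup H] [InnerProductSpace ℝ H]
  {ι : V →L[ℝ] H} {A : ℝ → V →L[ℝ] StrongDual ℝ V} {M : ℕ → ℝ → V →L[ℝ] H}

theorem sum_antidiagonal_ite {X : Type*} [AddCommMonoid X] (α : MultiIndex) (G : MultiIndex → X) :
    ∑ x ∈ Finset.HasAntidiagonal.antidiagonal α, (if x.2 = 0 then G x.1 else 0) = G α := by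
  rw [Finset.sum_eq_single (α, 0)]
  · simp
  · rintro ⟨γ, β⟩ hx hne
    rw [Finset.HasAntidiagonal.mem_antidiagonal] at hx
    refine if_neg fun h => hne ?_
    simp only at h hx
    rw [h, add_zero] at hx
    rw [h, hx]
  · simp

theorem sum_antidiagonal_pred {X : Type*} [AddCommMonoid X] (α : MultiIndex)
    (G : ℕ × ℕ → MultiIndex → MultiIndex → X) :
    ∑ x ∈ Finset.HasAntidiagonal.antidiagonal α, ∑ r ∈ x.2.support, G r x.1 (x.2.pred r) =
      ∑ r ∈ α.support, ∑ x ∈ Finset.HasAntidiagonal.antidiagonal (α.pred r), G r x.1 x.2 := by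
  rw [Finset.sum_sigma', Finset.sum_sigma']
  refine Finset.sum_bij' (fun x _ => ⟨x.2, (x.1.1, x.1.2.pred x.2)⟩)
    (fun x _ => ⟨(x.2.1, x.2.2 + Finsupp.single x.1 1), x.1⟩) ?_ ?_ ?_ ?_ ?_
  · rintro ⟨⟨γ, β⟩, r⟩ hx
    simp only [Finset.mem_sigma, Finset.HasAntidiagonal.mem_antidiagonal] at hx ⊢
    obtain ⟨rfl, hr⟩ := hx
    rw [Finsupp.mem_support_iff] at hr
    constructor
    · rw [Finsupp.mem_support_iff, Finsupp.add_apply]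
      omega
    · ext s
      by_cases hs : s = r
      · subst hs
        simp only [MultiIndex.pred, Finsupp.add_apply, Finsupp.tsub_apply, Finsupp.single_eq_same]
        omega
      · simp [MultiIndex.pred, Finsupp.single_eq_of_ne hs]
  · rintro ⟨r, ⟨γ, β⟩⟩ hx
    simp only [Finset.mem_sigma, Finset.HasAntidiagonal.mem_antidiagonal] at hx ⊢
    refine ⟨?_, ?_⟩
    · rw [← add_assoc, hx.2, MultiIndex.pred_add_single hx.1]
    · rw [Finsupp.mem_support_iff, Finsupp.add_apply, Finsupp.single_eq_same]
      omega
  · rintro ⟨⟨γ, β⟩, r⟩ hx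
    simp only [Finset.mem_sigma] at hx
    simp only [MultiIndex.pred_add_single hx.2]
  · rintro ⟨r, ⟨γ, β⟩⟩ _
    simp only [MultiIndex.pred, add_tsub_cancel_right]
  · rintro ⟨⟨γ, β⟩, r⟩ _
    rfl

/-- Superposition: the system is linear and invariant under translations of the multi-index, so a
solution is the sum over `γ` of the translates by `γ` of solutions with deterministic data. -/
theorem IsChaosFamily.superposition {m : ℕ → ℝ → ℝ} {h : MultiIndex → H}
    {f : MultiIndex → ℝ → StrongDual ℝ V} {g : ℕ → MultiIndex → ℝ → H}
    {d : MultiIndex → MultiIndex → ℝ → V} {z : MultiIndex → MultiIndex → ℝ → H}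
    (hd : ∀ γ, IsChaosFamily T ι A M m (fun α => if α = 0 then h γ else 0)
      (fun α t => if α = 0 then f γ t else 0) (fun k α t => if α = 0 then g k γ t else 0)
      (d γ) (z γ)) :
    IsChaosFamily T ι A M m h f g (fun α t => ∑ x ∈ Finset.HasAntidiagonal.antidiagonal α, d x.1 x.2 t)
      (fun α t => ∑ x ∈ Finset.HasAntidiagonal.antidiagonal α, z x.1 x.2 t) := by
  intro α
  have h1 := IsPath.sum (Finset.HasAntidiagonal.antidiagonal α) fun x _ => hd x.1 x.2
  rw [sum_antidiagonal_ite α h] at h1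
  convert h1 using 1
  funext t
  rw [Finset.sum_add_distrib, Finset.sum_add_distrib, sum_antidiagonal_ite α fun γ => f γ t,
    map_sum, sum_antidiagonal_pred α fun r γ β => m r.1 t •
      toDual ι (M r.2 t (d γ β t) + if β = 0 then g r.2 γ t else 0)]
  congr 2
  refine Finset.sum_congr rfl fun r _ => ?_
  have e : ∀ s : Finset (MultiIndex × MultiIndex), ∀ w : MultiIndex × MultiIndex → H,
      toDual ι (∑ x ∈ s, w x) = ∑ x ∈ s, toDual ι (w x) := fun s w => map_sum (toDualL ι) w s
  rw [← Finset.smul_sum, ← e, Finset.sum_add_distrib, map_sum,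
    sum_antidiagonal_ite (α.pred r) fun γ => g r.2 γ t]

end Superposition

/-! ### Minkowski's inequality and the estimate for arbitrary data -/

section Minkowski

theorem rpow_half_le_iff {a b : ℝ≥0∞} : a ^ (1 / 2 : ℝ) ≤ b ↔ a ≤ b ^ 2 := by
  rw [one_div, ENNReal.rpow_inv_le_iff zero_lt_two, ENNReal.rpow_two]

theorem rpow_half_sq (a : ℝ≥0∞) : (a ^ (1 / 2 : ℝ)) ^ 2 = a := by
  rw [← ENNReal.rpow_two, ← ENNReal.rpow_mul]
  norm_num

/-- Minkowski's inequality in `ℓ_2`. -/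
theorem rpow_half_sum_sq_le {κ α : Type*} (s : Finset κ) (F : Finset α) (f : κ → α → ℝ≥0∞) :
    (∑ i ∈ F, (∑ j ∈ s, f j i) ^ 2) ^ (1 / 2 : ℝ) ≤
      ∑ j ∈ s, (∑ i ∈ F, f j i ^ 2) ^ (1 / 2 : ℝ) := by
  classical
  induction s using Finset.induction_on with
  | empty => simp
  | insert a s ha ih =>
    simp only [Finset.sum_insert ha]
    have h := ENNReal.Lp_add_le F (f a) (fun i => ∑ j ∈ s, f j i) (p := 2) one_le_two
    simp only [ENNReal.rpow_two] at h
    exact h.trans (add_le_add le_rfl ih)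

theorem lintegral_enorm_sq_eq {T : ℝ} {E : Type*} [NormedAddCommGroup E] {f : ℝ → E}
    (hf : MemLp f 2 (timeMeasure T)) {t : ℝ} (ht : t ∈ Icc 0 T) :
    ∫⁻ s in Ioo 0 t, ‖f s‖ₑ ^ 2 = ENNReal.ofReal (∫ s in (0 : ℝ)..t, ‖f s‖ ^ 2) := by
  rw [intervalIntegral.integral_of_le ht.1, ← restrict_Ioo_eq_restrict_Ioc,
    ofReal_integral_eq_lintegral_ofReal ?_ (Eventually.of_forall fun s => sq_nonneg _)]
  · refine lintegral_congr fun s => ?_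
    rw [ENNReal.ofReal_pow (norm_nonneg _), ofReal_norm]
  · exact (integrable_norm_sq_of_memLp hf).mono_measure
      (Measure.restrict_mono (Ioo_subset_Ioo_right ht.2) le_rfl)

end Minkowski

section FamilyEstimate

variable {T : ℝ} {V H : Type*} [NormedAddCommGroup V] [InnerProductSpace ℝ V]
  [NormedAddCommGroup H] [InnerProductSpace ℝ H] [CompleteSpace V] [CompleteSpace H]
  {ι : V →L[ℝ] H} {A : ℝ → V →L[ℝ] StrongDual ℝ V} {M : ℕ → ℝ → V →L[ℝ] H} {δ C₁ C₂ : ℝ}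

theorem chaosConst_pos (hT : 0 < T) (hδ : 0 < δ) (hC₁ : 0 < C₁) : 0 < chaosConst T δ C₁ C₂ := by
  unfold chaosConst sourceConst
  positivity

theorem IsChaosFamily.sum_enorm_sq_le (hP : IsParabolic T ι A M δ C₁ C₂)
    {m : ℕ → Lp ℝ 2 (timeMeasure T)} (hm : Orthonormal ℝ m) {h₀ : H}
    {f : ℝ → StrongDual ℝ V} {g : ℕ → ℝ → H} (hf : MemLp f 2 (timeMeasure T))
    (hg : ∀ k, MemLp (g k) 2 (timeMeasure T)) {c : MultiIndex → ℝ → V} {y : MultiIndex → ℝ → H}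
    (hc : IsChaosFamily T ι A M (fun i => m i) (fun α => if α = 0 then h₀ else 0)
      (fun α t => if α = 0 then f t else 0) (fun k α t => if α = 0 then g k t else 0) c y)
    (F : Finset MultiIndex) {t : ℝ} (ht : t ∈ Icc 0 T) :
    ∑ β ∈ F, ‖y β t‖ₑ ^ 2 ≤ (ENNReal.ofReal √(chaosConst T δ C₁ C₂) *
      (‖h₀‖ₑ + (∫⁻ s in Ioo 0 t, ‖f s‖ₑ ^ 2) ^ (1 / 2 : ℝ) +
        (∑' k, ∫⁻ s in Ioo 0 t, ‖g k s‖ₑ ^ 2) ^ (1 / 2 : ℝ))) ^ 2 := by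
  obtain ⟨L, hL⟩ := hc.sum_norm_sq_le hP.T_pos.le hP.injective hP.denseRange hP.δ_pos
    hP.C₁_pos.le hP.coercive hP.parabolic hm hf hg (fun k => hP.memLp_M k (hc 0).memLp) F ht
  have hK := (chaosConst_pos (C₂ := C₂) hP.T_pos hP.δ_pos hP.C₁_pos).le
  have h0 : ∀ v : ℝ → ℝ, 0 ≤ ∫ s in (0 : ℝ)..t, v s ^ 2 :=
    fun v => intervalIntegral.integral_nonneg ht.1 fun s _ => sq_nonneg _
  have h1 : ∑ β ∈ F, ‖y β t‖ₑ ^ 2 = ENNReal.ofReal (∑ β ∈ F, ‖y β t‖ ^ 2) := by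
    rw [ENNReal.ofReal_sum_of_nonneg fun _ _ => sq_nonneg _]
    exact Finset.sum_congr rfl fun β _ => by rw [ENNReal.ofReal_pow (norm_nonneg _), ofReal_norm]
  have h2 : ∑ k : Fin L, ENNReal.ofReal (∫ s in (0 : ℝ)..t, ‖g k s‖ ^ 2) ≤
      ∑' k, ∫⁻ s in Ioo 0 t, ‖g k s‖ₑ ^ 2 := by
    simp only [lintegral_enorm_sq_eq (hg _) ht]
    rw [← Finset.sum_range fun k => ENNReal.ofReal (∫ s in (0 : ℝ)..t, ‖g k s‖ ^ 2)]
    exact ENNReal.sum_le_tsum _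
  have h3 : ∀ a b c : ℝ≥0∞, a ^ 2 + b + c ≤ (a + b ^ (1 / 2 : ℝ) + c ^ (1 / 2 : ℝ)) ^ 2 :=
    fun a b c => by
      nth_rw 1 [← rpow_half_sq b, ← rpow_half_sq c]
      have h4 : ∀ x y : ℝ≥0∞, x ^ 2 + y ^ 2 ≤ (x + y) ^ 2 := fun x y => by
        rw [add_sq]
        gcongr
        exact le_self_add
      exact (add_le_add (h4 _ _) le_rfl).trans (h4 _ _)
  rw [h1, mul_pow, ← ENNReal.ofReal_pow (Real.sqrt_nonneg _), Real.sq_sqrt hK]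
  refine (ENNReal.ofReal_le_ofReal hL).trans ?_
  rw [ENNReal.ofReal_mul hK]
  refine mul_le_mul_right ?_ _
  refine le_trans ?_ (h3 _ _ _)
  rw [ENNReal.ofReal_add (add_nonneg (sq_nonneg _) (h0 _)) (Finset.sum_nonneg fun k _ => h0 _),
    ENNReal.ofReal_add (sq_nonneg _) (h0 _), ENNReal.ofReal_sum_of_nonneg fun k _ => h0 _,
    ENNReal.ofReal_pow (norm_nonneg _), ofReal_norm, lintegral_enorm_sq_eq hf ht]
  exact add_le_add le_rfl h2

/-- The estimate for arbitrary data: superposition of deterministic data and Minkowski's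
inequality. -/
theorem IsChaosFamily.tsum_enorm_sq_le (hP : IsParabolic T ι A M δ C₁ C₂)
    {m : ℕ → Lp ℝ 2 (timeMeasure T)} (hm : Orthonormal ℝ m)
    (hmb : ∀ i, MemLp (m i) ∞ (timeMeasure T)) {h : MultiIndex → H}
    {f : MultiIndex → ℝ → StrongDual ℝ V} (hf : ∀ α, MemLp (f α) 2 (timeMeasure T))
    {g : ℕ → MultiIndex → ℝ → H} (hg : ∀ k α, MemLp (g k α) 2 (timeMeasure T))
    {c : MultiIndex → ℝ → V} {y : MultiIndex → ℝ → H}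
    (hc : IsChaosFamily T ι A M (fun i => m i) h f g c y) {t : ℝ} (ht : t ∈ Icc 0 T) :
    (∑' α, ‖y α t‖ₑ ^ 2) ^ (1 / 2 : ℝ) ≤ ENNReal.ofReal √(chaosConst T δ C₁ C₂) * ∑' γ,
      (‖h γ‖ₑ + (∫⁻ s in Ioo 0 t, ‖f γ s‖ₑ ^ 2) ^ (1 / 2 : ℝ) +
        (∑' k, ∫⁻ s in Ioo 0 t, ‖g k γ s‖ₑ ^ 2) ^ (1 / 2 : ℝ)) := by
  classical
  have hex : ∀ γ, ∃ d z, IsChaosFamily T ι A M (fun i => m i) (fun α => if α = 0 then h γ else 0)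
      (fun α t => if α = 0 then f γ t else 0) (fun k α t => if α = 0 then g k γ t else 0) d z :=
    fun γ => by
      refine hP.exists_isChaosFamily hmb _ (fun α => ?_) (fun k α => ?_)
      · by_cases hα : α = 0
        · simpa only [if_pos hα] using hf γ
        · simpa only [if_neg hα] using memLp_const (0 : StrongDual ℝ V)
      · by_cases hα : α = 0
        · simpa only [if_pos hα] using hg k γ
        · simpa only [if_neg hα] using memLp_const (0 : H)
  choose d z hdz using hex
  have hy : ∀ α, y α t = ∑ x ∈ Finset.HasAntidiagonal.antidiagonal α, z x.1 x.2 t := fun α =>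
    (hc.unique hP (IsChaosFamily.superposition hdz) α).1 t ht
  set K := ENNReal.ofReal √(chaosConst T δ C₁ C₂)
  set D : MultiIndex → ℝ≥0∞ := fun γ =>
    ‖h γ‖ₑ + (∫⁻ s in Ioo 0 t, ‖f γ s‖ₑ ^ 2) ^ (1 / 2 : ℝ) +
        (∑' k, ∫⁻ s in Ioo 0 t, ‖g k γ s‖ₑ ^ 2) ^ (1 / 2 : ℝ)
  rw [rpow_half_le_iff, ENNReal.tsum_eq_iSup_sum]
  refine iSup_le fun F => rpow_half_le_iff.1 ?_
  -- `E γ α` is the contribution to the coefficient `α` of the data with the index `γ`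
  set G : Finset MultiIndex := F.biUnion fun α =>
    (Finset.HasAntidiagonal.antidiagonal α).image Prod.fst with hG
  set E : MultiIndex → MultiIndex → ℝ≥0∞ := fun γ α => if γ ≤ α then ‖z γ (α - γ) t‖ₑ else 0 with hE
  have h1 : ∀ α ∈ F, ‖y α t‖ₑ ≤ ∑ γ ∈ G, E γ α := fun α hα => by
    have h2 : ∀ x ∈ Finset.HasAntidiagonal.antidiagonal α, ‖z x.1 x.2 t‖ₑ = E x.1 α := fun x hx => by
      rw [Finset.HasAntidiagonal.mem_antidiagonal] at hx
      simp only [hE]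
      rw [if_pos (hx ▸ le_self_add), ← hx, add_tsub_cancel_left]
    rw [hy α]
    refine (enorm_sum_le _ _).trans ?_
    rw [Finset.sum_congr rfl h2, ← Finset.sum_image (f := fun γ => E γ α) (g := Prod.fst)]
    · exact Finset.sum_le_sum_of_subset
        (Finset.subset_biUnion_of_mem (fun α : MultiIndex =>
          (Finset.HasAntidiagonal.antidiagonal α).image Prod.fst) hα)
    · intro x hx x' hx' hxx'
      rw [Finset.mem_coe, Finset.HasAntidiagonal.mem_antidiagonal] at hx hx'
      exact Prod.ext hxx' (add_left_cancel (hx.trans (hxx' ▸ hx').symm))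
  have h2 : ∀ γ, (∑ α ∈ F, E γ α ^ 2) ^ (1 / 2 : ℝ) ≤ K * D γ := fun γ => by
    rw [rpow_half_le_iff]
    refine le_trans ?_ ((hdz γ).sum_enorm_sq_le hP hm (hf γ) (fun k => hg k γ)
      ((F.filter fun α => γ ≤ α).image fun α => α - γ) ht)
    rw [Finset.sum_image, Finset.sum_filter]
    · refine Finset.sum_le_sum fun α _ => ?_
      simp only [hE]
      split_ifs
      · exact le_rfl
      · simp
    · intro α hα α' hα' h3
      rw [Finset.mem_coe, Finset.mem_filter] at hα hα'
      simp only at h3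
      rw [← tsub_add_cancel_of_le hα.2, h3, tsub_add_cancel_of_le hα'.2]
  calc (∑ α ∈ F, ‖y α t‖ₑ ^ 2) ^ (1 / 2 : ℝ) ≤ (∑ α ∈ F, (∑ γ ∈ G, E γ α) ^ 2) ^ (1 / 2 : ℝ) := by
        refine ENNReal.rpow_le_rpow (Finset.sum_le_sum fun α hα => ?_) (by norm_num)
        exact pow_le_pow_left' (h1 α hα) 2
    _ ≤ ∑ γ ∈ G, (∑ α ∈ F, E γ α ^ 2) ^ (1 / 2 : ℝ) := rpow_half_sum_sq_le G F E
    _ ≤ ∑ γ ∈ G, K * D γ := Finset.sum_le_sum fun γ _ => h2 γ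
    _ ≤ K * ∑' γ, D γ := by
        rw [← Finset.mul_sum]
        gcongr
        exact ENNReal.sum_le_tsum _

end FamilyEstimate

/-! ### Wiener chaos solutions and the normalized system -/

section Solutions

/-- The normalization `1 / √(α!)`. -/
def MultiIndex.scale (α : MultiIndex) : ℝ := (√(α.fact : ℝ))⁻¹

theorem MultiIndex.sqrt_fact_pos (α : MultiIndex) : 0 < √(α.fact : ℝ) :=
  Real.sqrt_pos.2 (Nat.cast_pos.2 α.fact_pos)

theorem MultiIndex.scale_mul_sqrt {α : MultiIndex} {r : ℕ × ℕ} (hr : r ∈ α.support) :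
    α.scale * √(α r : ℝ) = (α.pred r).scale := by
  have h1 : 0 < √(α r : ℝ) := Real.sqrt_pos.2 (Nat.cast_pos.2
    (Nat.pos_of_ne_zero (Finsupp.mem_support_iff.1 hr)))
  unfold MultiIndex.scale
  rw [MultiIndex.fact_eq_mul_fact_pred hr, Nat.cast_mul, Real.sqrt_mul (Nat.cast_nonneg _), mul_inv,
    mul_right_comm, inv_mul_cancel₀ h1.ne', one_mul]

theorem MultiIndex.sqrt_fact_mul_scale (α : MultiIndex) : √(α.fact : ℝ) * α.scale = 1 :=
  mul_inv_cancel₀ α.sqrt_fact_pos.ne'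

theorem MultiIndex.sqrt_fact_eq {α : MultiIndex} {r : ℕ × ℕ} (hr : r ∈ α.support) :
    √(α.fact : ℝ) = √(α r : ℝ) * √((α.pred r).fact : ℝ) := by
  rw [MultiIndex.fact_eq_mul_fact_pred hr, Nat.cast_mul, Real.sqrt_mul (Nat.cast_nonneg _)]

variable {Ω : Type*} [MeasurableSpace Ω] {P : Measure Ω} {T : ℝ} {N : WienerNoise Ω P T}
  {V H : Type*} [NormedAddCommGroup V] [InnerProductSpace ℝ V]
  [NormedAddCommGroup H] [InnerProductSpace ℝ H]
  {ι : V →L[ℝ] H} {A : ℝ → V →L[ℝ] StrongDual ℝ V} {M : ℕ → ℝ → V →L[ℝ] H} {δ C₁ C₂ : ℝ}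
  {u₀ : GenElement N H} {f : GenElement N (Lp (StrongDual ℝ V) 2 (timeMeasure T))}
  {g : ℕ → GenElement N (Lp H 2 (timeMeasure T))} {u : GenElement N (Lp V 1 (timeMeasure T))}

/-- The right-hand side of the equation for the coefficient `u_α`. -/
def drift (N : WienerNoise Ω P T) (ι : V →L[ℝ] H) (A : ℝ → V →L[ℝ] StrongDual ℝ V)
    (M : ℕ → ℝ → V →L[ℝ] H) (f : GenElement N (Lp (StrongDual ℝ V) 2 (timeMeasure T)))
    (g : ℕ → GenElement N (Lp H 2 (timeMeasure T))) (v : MultiIndex → ℝ → V) (α : MultiIndex)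
    (t : ℝ) : StrongDual ℝ V :=
  A t (v α t) + (coeff f α t + ∑ r ∈ α.support, (√(α r : ℝ) * N.m r.1 t) •
    toDual ι (M r.2 t (v (α.pred r) t) + coeff (g r.2) (α.pred r) t))

theorem IsParabolic.memLp_drift (hP : IsParabolic T ι A M δ C₁ C₂) {v : MultiIndex → ℝ → V}
    (hv : ∀ α, MemLp (v α) 2 (timeMeasure T)) (α : MultiIndex) :
    MemLp (drift N ι A M f g v α) 2 (timeMeasure T) :=
  memLp_fun_add (hP.memLp_A (hv α)) (memLp_fun_add (Lp.memLp (coeff f α))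
    (hP.memLp_lower N.m_bounded α.support (a := fun r => √(α r : ℝ)) (fun _ _ => hv _)
      fun r _ => Lp.memLp (coeff (g r.2) (α.pred r))))

/-- The integrals of the definition are combined into one, which is legitimate since all integrands
are square integrable. -/
theorem isWienerChaosSolution_iff (hP : IsParabolic T ι A M δ C₁ C₂)
    (hu : ∀ α, MemLp (fun t => coeff u α t) 2 (timeMeasure T)) :
    IsWienerChaosSolution N ι A M u₀ f g u ↔ ∀ α, ∀ᵐ t ∂(timeMeasure T),
      toDual ι (ι (coeff u α t)) = toDual ι (coeff u₀ α) +
        ∫ s in (0 : ℝ)..t, drift N ι A M f g (fun α t => coeff u α t) α s := by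
  refine forall_congr' fun α => ?_
  have key : ∀ t ∈ Ioo 0 T, (∫ s in (0 : ℝ)..t, (A s (coeff u α s) + coeff f α s)) +
      skorokhodCoeff N (fun k β s => toDual ι (M k s (coeff u β s) + coeff (g k) β s)) α t =
      ∫ s in (0 : ℝ)..t, drift N ι A M f g (fun α t => coeff u α t) α s := fun t ht => by
    have ht' := Ioo_subset_Icc_self ht
    have h0 : (0 : ℝ) ∈ Icc 0 T := ⟨le_rfl, hP.T_pos.le⟩
    have h1 : MemLp (fun s => A s (coeff u α s) + coeff f α s) 2 (timeMeasure T) :=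
      memLp_fun_add (hP.memLp_A (hu α)) (Lp.memLp (coeff f α))
    have h2 : ∀ s : Finset (ℕ × ℕ), MemLp (fun t => ∑ r ∈ s, (√(α r : ℝ) * N.m r.1 t) •
        toDual ι (M r.2 t (coeff u (α.pred r) t) + coeff (g r.2) (α.pred r) t)) 2 (timeMeasure T) :=
      fun s => hP.memLp_lower N.m_bounded s (a := fun r => √(α r : ℝ)) (fun r _ => hu _)
        fun r _ => Lp.memLp (coeff (g r.2) (α.pred r))
    have h3 : ∀ r ∈ α.support, IntervalIntegrable (fun s => (√(α r : ℝ) * N.m r.1 s) •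
        toDual ι (M r.2 s (coeff u (α.pred r) s) + coeff (g r.2) (α.pred r) s)) volume 0 t :=
      fun r _ => by simpa using intervalIntegrable_of_memLp (h2 {r}) h0 ht'
    rw [skorokhodCoeff, ← intervalIntegral.integral_finsetSum h3, ← intervalIntegral.integral_add
      (intervalIntegrable_of_memLp h1 h0 ht') (intervalIntegrable_of_memLp (h2 _) h0 ht')]
    refine intervalIntegral.integral_congr fun s _ => ?_
    simp only [drift, add_assoc]
  have hae := ae_timeMeasure_mem T
  constructor
  · intro h
    filter_upwards [h, hae] with t h1 h2
    rw [h1, add_assoc, key t h2]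
  · intro h
    filter_upwards [h, hae] with t h1 h2
    rw [h1, add_assoc, key t h2]

variable [CompleteSpace V] [CompleteSpace H]

/-- The normalized coefficients of a solution solve the normalized system. -/
theorem IsWienerChaosSolution.exists_isChaosFamily (hP : IsParabolic T ι A M δ C₁ C₂)
    (hu : ∀ α, MemLp (fun t => coeff u α t) 2 (timeMeasure T))
    (h : IsWienerChaosSolution N ι A M u₀ f g u) :
    ∃ y, IsChaosFamily T ι A M (fun i => N.m i) (fun α => α.scale • coeff u₀ α)
      (fun α t => α.scale • coeff f α t) (fun k α t => α.scale • coeff (g k) α t)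
      (fun α t => α.scale • coeff u α t) y := by
  have h1 : ∀ α, ∃ y, IsPath T ι (coeff u₀ α)
      (drift N ι A M f g (fun α t => coeff u α t) α) (fun t => coeff u α t) y := fun α =>
    exists_isPath hP.injective hP.denseRange (hP.memLp_drift hu α) (hu α)
      ((isWienerChaosSolution_iff hP hu).1 h α)
  choose y hy using h1
  refine ⟨fun α t => α.scale • y α t, fun α => ?_⟩
  convert (hy α).const_smul α.scale using 1
  funext t
  rw [drift, smul_add, smul_add, map_smul, Finset.smul_sum]
  congr 2
  refine Finset.sum_congr rfl fun r hr => ?_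
  rw [map_smul, ← smul_add, toDual_smul, ← MultiIndex.scale_mul_sqrt hr, smul_smul, smul_smul]
  congr 1
  ring

/-- The coefficients `√(α!) c_α` of a solution `c` of the normalized system determine a generalized
random element, because the `ξ_α` are linearly independent. -/
theorem IsParabolic.exists_isWienerChaosSolution [IsProbabilityMeasure P]
    (hP : IsParabolic T ι A M δ C₁ C₂) (u₀ : GenElement N H)
    (f : GenElement N (Lp (StrongDual ℝ V) 2 (timeMeasure T)))
    (g : ℕ → GenElement N (Lp H 2 (timeMeasure T))) :
    ∃ u : GenElement N (Lp V 1 (timeMeasure T)), IsWienerChaosSolution N ι A M u₀ f g u ∧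
      ∀ α, MemLp (fun t => coeff u α t) 2 (timeMeasure T) := by
  obtain ⟨c, y, hc⟩ := hP.exists_isChaosFamily N.m_bounded (fun α => α.scale • coeff u₀ α)
    (f := fun α t => α.scale • coeff f α t) (fun α => (Lp.memLp (coeff f α)).const_smul α.scale)
    (g := fun k α t => α.scale • coeff (g k) α t)
    (fun k α => (Lp.memLp (coeff (g k) α)).const_smul α.scale)
  have hmem : ∀ α, MemLp (fun t => √(α.fact : ℝ) • c α t) 2 (timeMeasure T) := fun α =>
    (hc α).memLp.const_smul _
  have hmem1 : ∀ α, MemLp (fun t => √(α.fact : ℝ) • c α t) 1 (timeMeasure T) := fun α =>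
    (hmem α).mono_exponent one_le_two
  obtain ⟨u, hu⟩ := exists_genElement_coeff_eq N fun α => (hmem1 α).toLp
  have hcu : ∀ α, (fun t => coeff u α t) =ᵐ[timeMeasure T] fun t => √(α.fact : ℝ) • c α t :=
    fun α => by
      rw [hu α]
      exact (hmem1 α).coeFn_toLp
  have hu2 : ∀ α, MemLp (fun t => coeff u α t) 2 (timeMeasure T) := fun α =>
    (hmem α).ae_eq (hcu α).symm
  refine ⟨u, (isWienerChaosSolution_iff hP hu2).2 fun α => ?_, hu2⟩
  have h1 : IsPath T ι (coeff u₀ α) (drift N ι A M f g (fun α t => coeff u α t) α)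
      (fun t => coeff u α t) (fun t => √(α.fact : ℝ) • y α t) := by
    have h2 := (hc α).const_smul √(α.fact : ℝ)
    rw [smul_smul, α.sqrt_fact_mul_scale, one_smul] at h2
    refine h2.congr ?_ (hcu α).symm
    have h3 : ∀ᵐ t ∂(timeMeasure T), ∀ r ∈ α.support,
        coeff u (α.pred r) t = √((α.pred r).fact : ℝ) • c (α.pred r) t :=
      (ae_ball_iff α.support.countable_toSet).2 fun r _ => hcu (α.pred r)
    filter_upwards [hcu α, h3] with t h4 h5
    rw [drift, h4, smul_add, smul_add, smul_smul, α.sqrt_fact_mul_scale, one_smul, map_smul,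
      Finset.smul_sum]
    congr 2
    refine Finset.sum_congr rfl fun r hr => ?_
    have h6 : coeff (g r.2) (α.pred r) t =
        √((α.pred r).fact : ℝ) • (α.pred r).scale • coeff (g r.2) (α.pred r) t := by
      rw [smul_smul, MultiIndex.sqrt_fact_mul_scale, one_smul]
    have h7 : toDual ι (M r.2 t (coeff u (α.pred r) t) + coeff (g r.2) (α.pred r) t) =
        √((α.pred r).fact : ℝ) • toDual ι
          (M r.2 t (c (α.pred r) t) + (α.pred r).scale • coeff (g r.2) (α.pred r) t) := by
      rw [← toDual_smul, smul_add, ← map_smul, ← h5 r hr, ← h6]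
    rw [h7, smul_smul, smul_smul, MultiIndex.sqrt_fact_eq hr]
    congr 1
    ring
  filter_upwards [h1.ae_eq, ae_timeMeasure_mem T] with t h2 h3
  rw [← h2]
  exact h1.eq_add_integral t (Ioo_subset_Icc_self h3)

theorem IsWienerChaosSolution.unique [IsProbabilityMeasure P] (hP : IsParabolic T ι A M δ C₁ C₂)
    {u' : GenElement N (Lp V 1 (timeMeasure T))}
    (hu : ∀ α, MemLp (fun t => coeff u α t) 2 (timeMeasure T))
    (h : IsWienerChaosSolution N ι A M u₀ f g u)
    (hu' : ∀ α, MemLp (fun t => coeff u' α t) 2 (timeMeasure T))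
    (h' : IsWienerChaosSolution N ι A M u₀ f g u') : u = u' := by
  obtain ⟨y, hy⟩ := h.exists_isChaosFamily hP hu
  obtain ⟨y', hy'⟩ := h'.exists_isChaosFamily hP hu'
  refine genElement_ext fun α => Lp.ext ?_
  filter_upwards [(hy.unique hP hy' α).2] with t ht
  have h1 : ∀ v : V, √(α.fact : ℝ) • α.scale • v = v := fun v => by
    rw [smul_smul, α.sqrt_fact_mul_scale, one_smul]
  rw [← h1 (coeff u α t), ht, h1]

theorem MultiIndex.enorm_scale (α : MultiIndex) :
    ‖α.scale‖ₑ = ((α.fact : ℝ≥0∞) ^ (1 / 2 : ℝ))⁻¹ := by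
  have h1 : (0 : ℝ) < α.fact := Nat.cast_pos.2 α.fact_pos
  rw [scale, Real.enorm_eq_ofReal (inv_nonneg.2 (Real.sqrt_nonneg _)),
    ENNReal.ofReal_inv_of_pos α.sqrt_fact_pos, Real.sqrt_eq_rpow,
    ← ENNReal.ofReal_rpow_of_nonneg h1.le (by norm_num), ENNReal.ofReal_natCast]

/-- The estimate for the coefficients of a solution. -/
theorem IsWienerChaosSolution.exists_estimate (hP : IsParabolic T ι A M δ C₁ C₂)
    (hu : ∀ α, MemLp (fun t => coeff u α t) 2 (timeMeasure T))
    (h : IsWienerChaosSolution N ι A M u₀ f g u) :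
    ∃ uc : MultiIndex → ℝ → H, (∀ α, ContinuousOn (uc α) (Icc 0 T) ∧
        ∀ᵐ t ∂(timeMeasure T), uc α t = ι (coeff u α t)) ∧
      ∀ t ∈ Icc 0 T, (∑' α : MultiIndex, ‖uc α t‖ₑ ^ 2 / (α.fact : ℝ≥0∞)) ^ (1 / 2 : ℝ) ≤
        ENNReal.ofReal √(chaosConst T δ C₁ C₂) * ∑' α : MultiIndex,
          (‖coeff u₀ α‖ₑ + (∫⁻ s in Ioo 0 t, ‖coeff f α s‖ₑ ^ 2) ^ (1 / 2 : ℝ) +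
            (∑' k, ∫⁻ s in Ioo 0 t, ‖coeff (g k) α s‖ₑ ^ 2) ^ (1 / 2 : ℝ)) /
          (α.fact : ℝ≥0∞) ^ (1 / 2 : ℝ) := by
  obtain ⟨y, hy⟩ := h.exists_isChaosFamily hP hu
  refine ⟨fun α t => √(α.fact : ℝ) • y α t, fun α => ⟨?_, ?_⟩, fun t ht => ?_⟩
  · exact ((hy α).continuousOn hP.T_pos.le hP.injective hP.denseRange).const_smul _
  · filter_upwards [(hy α).ae_eq] with t ht
    rw [ht, map_smul, smul_smul, α.sqrt_fact_mul_scale, one_smul]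
  · have h1 := hy.tsum_enorm_sq_le hP N.m.orthonormal N.m_bounded
      (f := fun α t => α.scale • coeff f α t) (g := fun k α t => α.scale • coeff (g k) α t)
      (fun α => (Lp.memLp (coeff f α)).const_smul α.scale)
      (fun k α => (Lp.memLp (coeff (g k) α)).const_smul α.scale) ht
    have h2 : ∀ α : MultiIndex, ‖√(α.fact : ℝ) • y α t‖ₑ ^ 2 / (α.fact : ℝ≥0∞) = ‖y α t‖ₑ ^ 2 :=
      fun α => by
        have h3 : ‖√(α.fact : ℝ)‖ₑ ^ 2 = (α.fact : ℝ≥0∞) := by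
          rw [Real.enorm_eq_ofReal (Real.sqrt_nonneg _), ← ENNReal.ofReal_pow (Real.sqrt_nonneg _),
            Real.sq_sqrt (Nat.cast_nonneg _), ENNReal.ofReal_natCast]
        rw [enorm_smul, mul_pow, h3, mul_comm, ENNReal.mul_div_cancel_right
          (Nat.cast_ne_zero.2 α.fact_pos.ne') (ENNReal.natCast_ne_top _)]
    simp only [h2]
    refine h1.trans (le_of_eq ?_)
    congr 1
    refine tsum_congr fun α => ?_
    have hs : ‖α.scale‖ₑ ^ 2 ≠ ∞ := ENNReal.pow_ne_top enorm_ne_top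
    have h4 : ∀ a : ℝ≥0∞, (‖α.scale‖ₑ ^ 2 * a) ^ (1 / 2 : ℝ) = ‖α.scale‖ₑ * a ^ (1 / 2 : ℝ) :=
      fun a => by
        rw [ENNReal.mul_rpow_of_nonneg _ _ (by norm_num), ← ENNReal.rpow_two, ← ENNReal.rpow_mul]
        norm_num
    simp only [enorm_smul, mul_pow]
    rw [lintegral_const_mul' _ _ hs]
    simp only [lintegral_const_mul' _ _ hs]
    rw [ENNReal.tsum_mul_left, h4, h4, ← mul_add, ← mul_add, α.enorm_scale, mul_comm,
      ENNReal.div_eq_inv_mul, mul_comm]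

end Solutions

end

end WienerChaos

theorem mainTheorem8 (T δ C₁ C₂ : ℝ) (hT : 0 < T) (hδ : 0 < δ) (hC₁ : 0 < C₁) :
    ∃ C : ℝ≥0, 0 < C ∧
      ∀ (Ω : Type*) [MeasurableSpace Ω] (P : Measure Ω) [IsProbabilityMeasure P]
        (N : WienerNoise Ω P T)
        (V : Type*) [NormedAddCommGroup V] [InnerProductSpace ℝ V] [CompleteSpace V]
        (H : Type*) [NormedAddCommGroup H] [InnerProductSpace ℝ H] [CompleteSpace H]
        (ι : V →L[ℝ] H) (_ : Function.Injective ι) (_ : DenseRange ι)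
        (A : ℝ → V →L[ℝ] StrongDual ℝ V) (M : ℕ → ℝ → V →L[ℝ] H)
        (_ : ∀ v, AEStronglyMeasurable (fun t => A t v) (timeMeasure T))
        (_ : ∀ k v, AEStronglyMeasurable (fun t => M k t v) (timeMeasure T))
        (_ : ∃ K : ℝ, ∀ t ∈ Icc 0 T, ‖A t‖ ≤ K)
        (_ : ∀ t ∈ Icc 0 T, ∀ v, A t v v + δ * ‖v‖ ^ 2 ≤ C₁ * ‖ι v‖ ^ 2)
        (_ : ∀ t ∈ Icc 0 T, ∀ v, Summable (fun k => ‖M k t v‖ ^ 2) ∧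
          2 * A t v v + ∑' k, ‖M k t v‖ ^ 2 ≤ C₂ * ‖ι v‖ ^ 2)
        (u₀ : GenElement N H)
        (f : GenElement N (Lp (StrongDual ℝ V) 2 (timeMeasure T)))
        (g : ℕ → GenElement N (Lp H 2 (timeMeasure T))),
        (∃! u : GenElement N (Lp V 1 (timeMeasure T)),
          IsWienerChaosSolution N ι A M u₀ f g u ∧
            ∀ α, MemLp (fun t => coeff u α t) 2 (timeMeasure T)) ∧
        ∀ u : GenElement N (Lp V 1 (timeMeasure T)),
          IsWienerChaosSolution N ι A M u₀ f g u →
          (∀ α, MemLp (fun t => coeff u α t) 2 (timeMeasure T)) →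
          ∃ uc : MultiIndex → ℝ → H,
            (∀ α, ContinuousOn (uc α) (Icc 0 T) ∧
              ∀ᵐ t ∂(timeMeasure T), uc α t = ι (coeff u α t)) ∧
            ∀ t ∈ Icc 0 T,
              (∑' α : MultiIndex, ‖uc α t‖ₑ ^ 2 / (α.fact : ℝ≥0∞)) ^ (1 / 2 : ℝ) ≤
                (C : ℝ≥0∞) * ∑' α : MultiIndex,
                  (‖coeff u₀ α‖ₑ
                    + (∫⁻ s in Ioo 0 t, ‖coeff f α s‖ₑ ^ 2) ^ (1 / 2 : ℝ)
                    + (∑' k, ∫⁻ s in Ioo 0 t, ‖coeff (g k) α s‖ₑ ^ 2) ^ (1 / 2 : ℝ))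
                  / (α.fact : ℝ≥0∞) ^ (1 / 2 : ℝ) := by
  refine ⟨Real.toNNReal √(chaosConst T δ C₁ C₂),
    Real.toNNReal_pos.2 (Real.sqrt_pos.2 (chaosConst_pos hT hδ hC₁)), ?_⟩
  intro Ω _ P _ N V _ _ _ H _ _ _ ι hι hd A M hA hM hK hcoer hpar u₀ f g
  have hP : IsParabolic T ι A M δ C₁ C₂ := ⟨hT, hι, hd, hA, hM, hK, hδ, hC₁, hcoer, hpar⟩
  refine ⟨?_, fun u hu hu2 => hu.exists_estimate hP hu2⟩
  obtain ⟨u, hu, hu2⟩ := hP.exists_isWienerChaosSolution u₀ f g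
  exact ⟨u, ⟨hu, hu2⟩, fun u' hu' => hu'.1.unique hP hu'.2 hu2 hu⟩
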